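/- **Setting.** Let $\mathcal M$ be a finite-horizon MDP with horizon $H\ge 1$, finite state space $\mathcal X$, finite non-empty action space $\mathcal A$, fixed initial state $x_1$, transition probabilities $P_h(\cdot\mid x,a)$ and mean rewards $r_h(x,a)\in[0,1]$ ($h\in[H]$). Assume that $\mathcal M$ is a linear MDP: for a known $\phi:\mathcal X\times\mathcal A\to\mathbb R^d$ and unknown $\theta_h\in\mathbb R^d$, $\psi_h:\mathcal X\to\mathbb R^d$, we have $r_h(x,a)=\phi(x,a)^{\top}\theta_h$ and $P_h(x'\mid x,a)=\phi(x,a)^{\top}\psi_h(x')$, with $\|\phi(x,a)\|\le 1$, $\|\theta_h\|\le\sqrt d$ and $\big\|\sum_{x}|\psi_h(x)|\big\|\le\sqrt d$ (entrywise absolute value). The value $V^\pi(x_1)$ of a stochastic Markov policy $\pi$ is its expected cumulative mean reward from $x_1$, and $V^\star(x_1)$ is the maximum of $V^\pi(x_1)$ over such policies. In each episode $k=1,\dots,K$ ($K\ge 1$) the learner plays a Markov policy $\pi^k$ and observes the trajectory $(x_h^k,a_h^k)_{h\in[H]}$, which given the past has the law induced by $P$ and $\pi^k$, and only the aggregate reward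 $v^k=\sum_{h} r_h^k$. Here $r_h^k\in[0,1]$ has conditional mean $r_h(x_h^k,a_h^k)$ given the past and the trajectory of episode $k$. The regret is $\mathrm{Regret}=\sum_{k=1}^K\big(V^\star(x_1)-V^{\pi^k}(x_1)\big)$. **Algorithm (RE-LSVI).** Write $\phi_h^k=\phi(x_h^k,a_h^k)$, let $\phi^k\in\mathbb R^{dH}$ be the concatenation of $\phi_1^k,\dots,\phi_H^k$, and let $\|v\|_B=\sqrt{v^\top Bv}$ and $\mathrm{clip}_\beta[z]=\min\{\beta,\max\{-\beta,z\}\}$. In episode $k$ put $$\Lambda^k=\lambda_r I+\sum_{\tau<k}\phi^\tau(\phi^\tau)^\top,\quad \Lambda_h^k=\lambda_p I+\sum_{\tau<k}\phi_h^\tau(\phi_h^\tau)^\top,\quad \hat\theta^k=(\Lambda^k)^{-1}\sum_{\tau<k}\phi^\tau v^\tau,\quad \hat\psi_h^kV=(\Lambda_h^k)^{-1}\sum_{\tau<k}\phi_h^\tau V(x_{h+1}^\tau).$$ Draw $\zeta^{k,1},\dots,\zeta^{k,m}$, independent and with law $\mathcal N(0,\beta_r^2(\Lambda^k)^{-1})$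 given the past. For each $i\in[m]$ set $\hat V^{k,i}_{H+1}=0$ and, for $h=H,\dots,1$, $$\hat Q_h^{k,i}(x,a)=\mathrm{clip}_{(H+1-h)\beta_{r\zeta}}\Big[\phi(x,a)^\top\big(\hat\theta_h^k+\zeta_h^{k,i}+\hat\psi_h^k\hat V_{h+1}^{k,i}\big)+\beta_p\|\phi(x,a)\|_{(\Lambda_h^k)^{-1}}\Big],$$ $$\hat V_h^{k,i}(x)=\max_a\hat Q_h^{k,i}(x,a),\qquad \pi_h^{k,i}(x)\in\arg\max_a\hat Q_h^{k,i}(x,a),$$ where $\hat\theta^k_h,\zeta^{k,i}_h\in\mathbb R^d$ are the $h$-th blocks of $\hat\theta^k$ and $\zeta^{k,i}$. Play $\pi^k=\pi^{k,i_k}$ with $i_k\in\arg\max_i\hat V_1^{k,i}(x_1)$. Ties may be broken arbitrarily. **Parameters.** Let $\delta\in(0,1)$ and $$\lambda_p=1,\quad\lambda_r=H,\quad m=\lceil 9\log(5K/\delta)\rceil,\quad \beta_r=2H\sqrt{2dH\log(10K/\delta)},\quad \beta_\zeta=\sqrt{\tfrac{11dH}{2}\log\tfrac{5mK}{\delta}},$$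 $$\beta_{r\zeta}=\frac{2\beta_\zeta\beta_r}{\sqrt H},\qquad \beta_p=40\,\beta_\zeta\beta_r\,d\sqrt{H\log(163KdH/\delta)}.$$ **Theorem.** There is a universal constant $C>0$ such that for every such linear MDP and every $d,H,K,\delta$, RE-LSVI with these parameters satisfies, with probability at least $1-\delta$, both $$\mathrm{Regret}\le 1088\sqrt{d^5H^7K}\;\log^2\!\big(1467\,KdH\log(5K/\delta)/\delta\big)\quad\text{and}\quad \mathrm{Regret}\le C\sqrt{d^5H^7K\log^6(dHK/\delta)}.$$ -/

import Mathlib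

open MeasureTheory ProbabilityTheory Matrix
open scoped BigOperators

noncomputable section

namespace AggMDP

/-! ### Finite-horizon MDPs

Steps are indexed by `Fin H`, so that `h : Fin H` stands for step `h + 1`. -/

/-- A finite-horizon MDP with finite state and action spaces: a fixed initial state, transition
probabilities and mean rewards in `[0, 1]`. -/
structure MDP (X A : Type*) [Fintype X] (H : ℕ) where
  /-- the initial state -/
  init : X
  /-- `P h x a x'` is the probability of moving from `x` to `x'` under action `a` at step `h` -/
  P : Fin H → X → A → X → ℝ
  P_mem : ∀ h x a, P h x a ∈ stdSimplex ℝ X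
  /-- the mean rewards -/
  r : Fin H → X → A → ℝ
  r_mem : ∀ h x a, r h x a ∈ Set.Icc (0 : ℝ) 1

/-- Trajectories: sequences of `H` state-action pairs. -/
abbrev Traj (X A : Type*) (H : ℕ) := Fin H → X × A

/-- Stochastic Markov policies: a distribution over actions for every step and state. -/
def Policy (X A : Type*) [Fintype A] (H : ℕ) :=
  {π : Fin H → X → A → ℝ // ∀ h x, π h x ∈ stdSimplex ℝ A}

open Classical in
/-- The deterministic Markov policy given by a choice of action for every step and state. -/
def Policy.det {X A : Type*} [Fintype A] {H : ℕ} (π : Fin H → X → A) : Policy X A H :=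
  ⟨fun h x => Pi.single (π h x) 1, fun h x => single_mem_stdSimplex ℝ (π h x)⟩

section MDP

variable {X A : Type*} [Fintype X] {H : ℕ}

open Classical in
/-- The probability of arriving at the state `(ι h).1` of step `h`, given the previous
state-action pair of `ι`; the first state is the initial state. -/
def MDP.arriveProb (M : MDP X A H) (ι : Traj X A H) (h : Fin H) : ℝ :=
  if h.val = 0 then (if (ι h).1 = M.init then 1 else 0)
  else
    let h' : Fin H := ⟨h.val - 1, lt_of_le_of_lt (Nat.sub_le _ _) h.isLt⟩
    M.P h' (ι h').1 (ι h').2 (ι h).1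

variable [Fintype A]

/-- The probability of the trajectory `ι` under the dynamics of `M` and the policy `π`. -/
def MDP.trajProb (M : MDP X A H) (π : Policy X A H) (ι : Traj X A H) : ℝ :=
  ∏ h, M.arriveProb ι h * π.1 h (ι h).1 (ι h).2

/-- The expectation of `f` over trajectories under the dynamics of `M` and the policy `π`. -/
def MDP.expect (M : MDP X A H) (π : Policy X A H) (f : Traj X A H → ℝ) : ℝ :=
  ∑ ι, M.trajProb π ι * f ι

/-- The value of a policy from the initial state: its expected cumulative reward. -/
def MDP.value (M : MDP X A H) (π : Policy X A H) : ℝ :=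
  M.expect π fun ι => ∑ h, M.r h (ι h).1 (ι h).2

/-- The optimal value over all stochastic Markov policies. -/
def MDP.optValue (M : MDP X A H) : ℝ := ⨆ π : Policy X A H, M.value π

/-- `M` is a linear MDP with (known) feature map `φ`: rewards and transitions are linear in `φ`
with some (unknown) parameters `θ`, `ψ`, under the usual normalization. -/
def MDP.IsLinear {d : ℕ} (M : MDP X A H) (φ : X → A → EuclideanSpace ℝ (Fin d)) : Prop :=
  (∀ x a, ‖φ x a‖ ≤ 1) ∧
  ∃ (θ : Fin H → EuclideanSpace ℝ (Fin d)) (ψ : Fin H → X → EuclideanSpace ℝ (Fin d)),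
    (∀ h x a, M.r h x a = φ x a ⬝ᵥ θ h) ∧
    (∀ h x a x', M.P h x a x' = φ x a ⬝ᵥ ψ h x') ∧
    (∀ h, ‖θ h‖ ≤ √(d : ℝ)) ∧
    (∀ h, ‖WithLp.toLp 2 fun j : Fin d => ∑ x, |ψ h x j|‖ ≤ √(d : ℝ))

end MDP

/-! ### The computations of RE-LSVI

Episodes are indexed by `ℕ` from `0`; in episode `k` the algorithm uses the trajectories `ι τ` and
the aggregate rewards `v τ` of the episodes `τ < k`. -/

/-- The input parameters `λ_r`, `λ_p`, `β_r`, `β_p`, `β_{rζ}`, `m` of the algorithm. -/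
structure Params where
  lamR : ℝ
  lamP : ℝ
  betaR : ℝ
  betaP : ℝ
  betaRZ : ℝ
  m : ℕ

/-- The norm `‖v‖_B = √(vᵀ B v)`. -/
def wnorm {n : Type*} [Fintype n] (B : Matrix n n ℝ) (v : n → ℝ) : ℝ := √(v ⬝ᵥ B *ᵥ v)

/-- Truncation to `[-β, β]`. -/
def clip (β z : ℝ) : ℝ := min β (max (-β) z)

section Algorithm

variable {X A : Type*} {H d : ℕ}

/-- The concatenation of the features along a trajectory, a vector in `ℝ^{dH}`. -/
def aggFeat (φ : X → A → EuclideanSpace ℝ (Fin d)) (ι : Traj X A H) : Fin H × Fin d → ℝ :=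
  fun p => φ (ι p.1).1 (ι p.1).2 p.2

/-- The aggregate covariance matrix `Λ^k = λ I + ∑_{τ < k} φ^τ (φ^τ)ᵀ`. -/
def aggCov (φ : X → A → EuclideanSpace ℝ (Fin d)) (lam : ℝ) (ι : ℕ → Traj X A H) (k : ℕ) :
    Matrix (Fin H × Fin d) (Fin H × Fin d) ℝ :=
  lam • (1 : Matrix (Fin H × Fin d) (Fin H × Fin d) ℝ) +
    ∑ τ ∈ Finset.range k, vecMulVec (aggFeat φ (ι τ)) (aggFeat φ (ι τ))

/-- The covariance matrix of step `h`, `Λ_h^k = λ I + ∑_{τ < k} φ_h^τ (φ_h^τ)ᵀ`. -/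
def stepCov (φ : X → A → EuclideanSpace ℝ (Fin d)) (lam : ℝ) (ι : ℕ → Traj X A H) (k : ℕ)
    (h : Fin H) : Matrix (Fin d) (Fin d) ℝ :=
  lam • (1 : Matrix (Fin d) (Fin d) ℝ) +
    ∑ τ ∈ Finset.range k, vecMulVec (φ (ι τ h).1 (ι τ h).2) (φ (ι τ h).1 (ι τ h).2)

/-- The least-squares estimate of the aggregate reward vector from aggregate rewards. -/
def thetaHat (φ : X → A → EuclideanSpace ℝ (Fin d)) (lam : ℝ) (ι : ℕ → Traj X A H) (v : ℕ → ℝ)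
    (k : ℕ) : Fin H × Fin d → ℝ :=
  (aggCov φ lam ι k)⁻¹ *ᵥ ∑ τ ∈ Finset.range k, v τ • aggFeat φ (ι τ)

/-- The value `V (x_{h+1})` of the state following step `h`. After the last step there is no further
state; the only value function used there is the zero function. -/
def nextVal (ι : Traj X A H) (h : Fin H) (V : X → ℝ) : ℝ :=
  if hh : h.val + 1 < H then V (ι ⟨h.val + 1, hh⟩).1 else 0

/-- The least-squares dynamics backup
`(Λ_h^k)⁻¹ ∑_{τ < k} φ_h^τ V (x_{h+1}^τ)`. -/
def psiHat (φ : X → A → EuclideanSpace ℝ (Fin d)) (lam : ℝ) (ι : ℕ → Traj X A H) (k : ℕ)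
    (h : Fin H) (V : X → ℝ) : Fin d → ℝ :=
  (stepCov φ lam ι k h)⁻¹ *ᵥ
    ∑ τ ∈ Finset.range k, nextVal (ι τ) h V • (φ (ι τ h).1 (ι τ h).2 : Fin d → ℝ)

variable [Fintype A] [Nonempty A]

/-- One backup of the Q-estimate at step `h` of episode `k`, with reward perturbation `ζ`, from the
value estimate `V` of the next step:
`clip [ φ(x,a)ᵀ (θ̂_h + ζ_h + ψ̂_h V) + β_p ‖φ(x,a)‖_{(Λ_h^k)⁻¹} ]`. -/
def qBackup (φ : X → A → EuclideanSpace ℝ (Fin d)) (prm : Params) (ι : ℕ → Traj X A H) (v : ℕ → ℝ)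
    (k : ℕ) (ζ : EuclideanSpace ℝ (Fin H × Fin d)) (h : Fin H) (V : X → ℝ) (x : X) (a : A) : ℝ :=
  let w : Fin d → ℝ := fun j =>
    thetaHat φ prm.lamR ι v k (h, j) + ζ (h, j) + psiHat φ prm.lamP ι k h V j
  clip (((H : ℝ) - h.val) * prm.betaRZ)
    (φ x a ⬝ᵥ w + prm.betaP * wnorm (stepCov φ prm.lamP ι k h)⁻¹ (φ x a))

/-- The value estimates `V̂_h`, by backward induction from `V̂ = 0` after the last step. -/
def vHat (φ : X → A → EuclideanSpace ℝ (Fin d)) (prm : Params) (ι : ℕ → Traj X A H) (v : ℕ → ℝ)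
    (k : ℕ) (ζ : EuclideanSpace ℝ (Fin H × Fin d)) (n : ℕ) (x : X) : ℝ :=
  if hn : n < H then
    Finset.univ.sup' Finset.univ_nonempty fun a : A =>
      qBackup φ prm ι v k ζ ⟨n, hn⟩ (fun x' => vHat φ prm ι v k ζ (n + 1) x') x a
  else 0
termination_by H - n

/-- The Q-estimates `Q̂_h`. -/
def qHat (φ : X → A → EuclideanSpace ℝ (Fin d)) (prm : Params) (ι : ℕ → Traj X A H) (v : ℕ → ℝ)
    (k : ℕ) (ζ : EuclideanSpace ℝ (Fin H × Fin d)) (h : Fin H) (x : X) (a : A) : ℝ :=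
  qBackup φ prm ι v k ζ h (vHat φ prm ι v k ζ (h.val + 1)) x a

end Algorithm

/-! ### The interaction as a random process -/

/-- The random quantities of the interaction of an ensemble algorithm with an MDP. In episode `k`:
the reward perturbations of the `m` ensemble members, their (deterministic) policies, the member
whose policy is played, the resulting trajectory and the sampled rewards of the `H` steps. -/
structure Interaction (Ω X A : Type*) (H d m : ℕ) where
  noise : ℕ → Ω → Fin m → EuclideanSpace ℝ (Fin H × Fin d)
  policy : ℕ → Ω → Fin m → Fin H → X → A
  leader : ℕ → Ω → Fin m
  traj : ℕ → Ω → Traj X A H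
  reward : ℕ → Ω → Fin H → ℝ

namespace Interaction

variable {Ω X A : Type*} {H d m : ℕ} (R : Interaction Ω X A H d m)

/-- The observed aggregate reward of episode `k`. -/
def aggReward (k : ℕ) (ω : Ω) : ℝ := ∑ h, R.reward k ω h

/-- The policy played in episode `k`. -/
def played (k : ℕ) (ω : Ω) : Fin H → X → A := R.policy k ω (R.leader k ω)

/-- What is generated in episode `k` before its trajectory. -/
abbrev planInfo (k : ℕ) : MeasurableSpace Ω :=
  MeasurableSpace.comap (R.noise k) inferInstance ⊔
    MeasurableSpace.comap (R.policy k) ⊤ ⊔ MeasurableSpace.comap (R.leader k) ⊤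

/-- The history before episode `k`. -/
abbrev before (k : ℕ) : MeasurableSpace Ω :=
  ⨆ τ ∈ Finset.range k, (R.planInfo τ ⊔ MeasurableSpace.comap (R.traj τ) ⊤ ⊔
    MeasurableSpace.comap (R.reward τ) inferInstance)

/-- The history up to the choice of the policy of episode `k`. -/
abbrev planned (k : ℕ) : MeasurableSpace Ω := R.before k ⊔ R.planInfo k

/-- The history up to the trajectory of episode `k`, before its rewards. -/
abbrev observed (k : ℕ) : MeasurableSpace Ω :=
  R.planned k ⊔ MeasurableSpace.comap (R.traj k) ⊤

end Interaction

/-- Conditionally on the σ-algebra `m`, the random variable `Z` has law `ν ω`. -/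
def HasCondLaw {Ω E : Type*} [MeasurableSpace Ω] [MeasurableSpace E] (μ : Measure Ω)
    (m : MeasurableSpace Ω) (Z : Ω → E) (ν : Ω → Measure E) : Prop :=
  ∀ B : Set E, MeasurableSet B → μ⟦Z ⁻¹' B | m⟧ =ᵐ[μ] fun ω => (ν ω).real B

/-- `R` is a run of RE-LSVI with parameters `prm` for `K` episodes on the MDP `M` with features `φ`
and aggregate feedback. -/
structure IsRELSVIRun {Ω X A : Type*} [MeasurableSpace Ω] [Fintype X] [Fintype A] [Nonempty A]
    {H d : ℕ} (μ : Measure Ω) (M : MDP X A H) (φ : X → A → EuclideanSpace ℝ (Fin d))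
    (prm : Params) (K : ℕ) (R : Interaction Ω X A H d prm.m) : Prop where
  noise_meas : ∀ k < K, Measurable (R.noise k)
  policy_meas : ∀ k < K, Measurable[_, ⊤] (R.policy k)
  leader_meas : ∀ k < K, Measurable[_, ⊤] (R.leader k)
  traj_meas : ∀ k < K, Measurable[_, ⊤] (R.traj k)
  reward_meas : ∀ k < K, Measurable (R.reward k)
  /-- Given the past, the perturbations of the ensemble members are independent, each with the
  Gaussian law `N(0, β_r² (Λ^k)⁻¹)`. -/
  noise_law : ∀ k < K, HasCondLaw μ (R.before k) (R.noise k) fun ω =>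
    Measure.pi fun _ : Fin prm.m => multivariateGaussian 0
      (prm.betaR ^ 2 • (aggCov φ prm.lamR (fun τ => R.traj τ ω) k)⁻¹)
  /-- The policy of each member is greedy with respect to its Q-estimates. -/
  greedy : ∀ k < K, ∀ ω i h x a,
    qHat φ prm (fun τ => R.traj τ ω) (fun τ => R.aggReward τ ω) k (R.noise k ω i) h x a ≤
    qHat φ prm (fun τ => R.traj τ ω) (fun τ => R.aggReward τ ω) k (R.noise k ω i) h x
      (R.policy k ω i h x)
  /-- The member with the largest initial value estimate is played. -/
  leader_max : ∀ k < K, ∀ ω i,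
    vHat φ prm (fun τ => R.traj τ ω) (fun τ => R.aggReward τ ω) k (R.noise k ω i) 0 M.init ≤
    vHat φ prm (fun τ => R.traj τ ω) (fun τ => R.aggReward τ ω) k
      (R.noise k ω (R.leader k ω)) 0 M.init
  /-- The trajectory is sampled from the MDP under the played policy. -/
  traj_law : ∀ k < K, ∀ ι : Traj X A H,
    μ⟦R.traj k ⁻¹' {ι} | R.planned k⟧ =ᵐ[μ]
      fun ω => M.trajProb (Policy.det (R.played k ω)) ι
  reward_mem : ∀ k < K, ∀ ω h, R.reward k ω h ∈ Set.Icc (0 : ℝ) 1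
  /-- The sampled rewards have the mean rewards of the visited state-action pairs. -/
  reward_mean : ∀ k < K, ∀ h,
    μ[fun ω => R.reward k ω h | R.observed k] =ᵐ[μ]
      fun ω => M.r h (R.traj k ω h).1 (R.traj k ω h).2

/-- The regret of the played policies over `K` episodes. -/
def regret {Ω X A : Type*} [Fintype X] [Fintype A] {H d m : ℕ} (M : MDP X A H)
    (R : Interaction Ω X A H d m) (K : ℕ) (ω : Ω) : ℝ :=
  ∑ k ∈ Finset.range K, (M.optValue - M.value (Policy.det (R.played k ω)))

/-! ### The parameters -/

/-- The ensemble size `9 log (5K/δ)`, rounded up to an integer. -/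
def ensembleSize (K : ℕ) (δ : ℝ) : ℕ := ⌈9 * Real.log (5 * K / δ)⌉₊

/-- `β_r = 2 H √(2 d H log (10K/δ))`. -/
def betaR (d H K : ℕ) (δ : ℝ) : ℝ := 2 * H * √(2 * d * H * Real.log (10 * K / δ))

/-- `β_ζ = √((11 d H / 2) log (5mK/δ))`. -/
def betaZ (d H K : ℕ) (δ : ℝ) : ℝ :=
  √(11 * d * H / 2 * Real.log (5 * ensembleSize K δ * K / δ))

/-- The parameter setting of the regret bound: `λ_r = H`, `λ_p = 1`,
`β_p = 40 β_ζ β_r d √(H log (163KdH/δ))` and `β_{rζ} = 2 β_ζ β_r / √H`. -/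
def params (d H K : ℕ) (δ : ℝ) : Params where
  lamR := H
  lamP := 1
  betaR := betaR d H K δ
  betaP := 40 * betaZ d H K δ * betaR d H K δ * d * √(H * Real.log (163 * K * d * H / δ))
  betaRZ := 2 * betaZ d H K δ * betaR d H K δ / √(H : ℝ)
  m := ensembleSize K δ

end AggMDP

end

open MeasureTheory ProbabilityTheory Matrix
open scoped BigOperators

noncomputable section

namespace AggMDP

/-! ### Weighted norms -/

section LinearAlgebra

variable {n : Type*} [Fintype n]

/-! The value of a policy is a single inner product of its expected concatenated features with the
stacked reward parameter (`value_eq_expFeat`). One ridge regression in dimension dH estimates that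
parameter accurately in the norm of Λ^k, although its individual blocks are only crudely bounded.
The rewards are therefore explored by Gaussian perturbations of the whole vector, and the
transitions by stepwise bonuses.

Optimism is needed in one direction only. Let u be the expected features of a fixed optimal policy.
Once the bonuses dominate the transition errors, Q̂ lies between the backup "perturbed reward plus
true transition of V̂" and that backup plus twice the bonus (`AggMDP.qHat_bounds`); truncation is
harmless because the backup lies inside the truncation window. Unrolling the lower bound along the
optimal policy gives V̂ ≥ uᵀ(θ̂ + ζ). Here uᵀ(θ̂ − θ) ≥ −β_r‖u‖ in the norm of (Λ^k)⁻¹, and some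
ensemble member has uᵀζ ≥ β_r‖u‖, one standard deviation, with probability at least 1 − (8/9)^m,
because u does not depend on the data. The leader inherits V̂ ≥ V*. Unrolling the upper bound along
its greedy policy bounds the regret of the episode by the expectation of (β_r + β_rβ_ζ)‖φ^k‖ + 2β_p
∑_h ‖φ_h^k‖ in inverse covariance norms (`AggMDP.optValue_sub_value_le`). Azuma–Hoeffding passes to
the realized trajectories, where Cauchy–Schwarz and the elliptical potential lemma sum the norms
(`sum_normBound_le`).

Concentration rests on the process exp(‖S‖²/2)/√det. It is a product of one-step factors, each below
an affine function of the increment with constant term 1 (`selfNormFactor_le_affine`), so its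
expectation stays at most 1 for centred increments in [−1, 1]; no Gaussian mixture is used. It is
applied to the aggregate reward noise and to the next-state noise. Since V̂ depends on the data, the
second application runs over a finite net of value functions (`exists_gridVal_near_vHat`), whose
log-cardinality of order d² log accounts for the factor d in β_p.

Five failure events of probability δ/5 each make up the complement of the good event
(`measureReal_goodEvent`), and `total_le` does the arithmetic. Dimension one is separate: there all
policies have the same value. -/

open scoped MatrixOrder in
theorem exists_sqrt_posSemidef [DecidableEq n] {B : Matrix n n ℝ} (hB : B.PosSemidef) :
    ∃ R : Matrix n n ℝ, R = CFC.sqrt B ∧ Rᵀ = R ∧ R * R = B := by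
  refine ⟨_, rfl, ?_, CFC.sqrt_mul_sqrt_self _ hB.nonneg⟩
  have h := (CFC.sqrt_nonneg B).isSelfAdjoint
  rw [isSelfAdjoint_iff, star_eq_conjTranspose, conjTranspose_eq_transpose_of_trivial] at h
  exact h

theorem dotProduct_mulVec_of_sq {R : Matrix n n ℝ} (hR : Rᵀ = R) (x y : n → ℝ) :
    x ⬝ᵥ (R * R) *ᵥ y = (R *ᵥ x) ⬝ᵥ (R *ᵥ y) := by
  rw [← mulVec_mulVec, dotProduct_mulVec, ← mulVec_transpose, hR]

theorem norm_toLp_sq (x : n → ℝ) : ‖WithLp.toLp 2 x‖ ^ 2 = x ⬝ᵥ x := by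
  rw [EuclideanSpace.norm_sq_eq, dotProduct]
  exact Finset.sum_congr rfl fun i _ => by rw [Real.norm_eq_abs, sq_abs, sq]

theorem norm_euclidean_sq (x : EuclideanSpace ℝ n) : ‖x‖ ^ 2 = x ⬝ᵥ x :=
  norm_toLp_sq (x : n → ℝ)

/-- A symmetric square root turns the weighted norm into a Euclidean one, so the triangle
inequality, homogeneity and Cauchy–Schwarz are inherited. -/
theorem exists_wnorm_eq_norm {B : Matrix n n ℝ} (hB : B.PosSemidef) :
    ∃ R : Matrix n n ℝ, Rᵀ = R ∧ R * R = B ∧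
      ∀ x, wnorm B x = ‖WithLp.toLp 2 (R *ᵥ x)‖ := by
  classical
  obtain ⟨R, -, h1, h2⟩ := exists_sqrt_posSemidef hB
  refine ⟨R, h1, h2, fun x => ?_⟩
  rw [wnorm, ← h2, dotProduct_mulVec_of_sq h1, ← norm_toLp_sq, Real.sqrt_sq (norm_nonneg _)]

theorem wnorm_nonneg (B : Matrix n n ℝ) (x : n → ℝ) : 0 ≤ wnorm B x := Real.sqrt_nonneg _

theorem wnorm_sq {B : Matrix n n ℝ} (hB : B.PosSemidef) (x : n → ℝ) :
    wnorm B x ^ 2 = x ⬝ᵥ B *ᵥ x :=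
  Real.sq_sqrt (by simpa using hB.dotProduct_mulVec_nonneg x)

theorem wnorm_add_le {B : Matrix n n ℝ} (hB : B.PosSemidef) (x y : n → ℝ) :
    wnorm B (x + y) ≤ wnorm B x + wnorm B y := by
  obtain ⟨R, -, -, h⟩ := exists_wnorm_eq_norm hB
  rw [h, h, h, mulVec_add, WithLp.toLp_add]
  exact norm_add_le _ _

theorem wnorm_smul {B : Matrix n n ℝ} (hB : B.PosSemidef) (c : ℝ) (x : n → ℝ) :
    wnorm B (c • x) = |c| * wnorm B x := by
  obtain ⟨R, -, -, h⟩ := exists_wnorm_eq_norm hB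
  rw [h, h, mulVec_smul, WithLp.toLp_smul, norm_smul, Real.norm_eq_abs]

theorem wnorm_zero (B : Matrix n n ℝ) : wnorm B 0 = 0 := by simp [wnorm]

theorem wnorm_sub_le {B : Matrix n n ℝ} (hB : B.PosSemidef) (x y : n → ℝ) :
    wnorm B (x - y) ≤ wnorm B x + wnorm B y := by
  have h := wnorm_add_le hB x ((-1 : ℝ) • y)
  rw [wnorm_smul hB] at h
  simpa [sub_eq_add_neg] using h

theorem wnorm_sum_le {B : Matrix n n ℝ} (hB : B.PosSemidef) {ι : Type*} (s : Finset ι)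
    (f : ι → n → ℝ) : wnorm B (∑ i ∈ s, f i) ≤ ∑ i ∈ s, wnorm B (f i) := by
  classical
  induction s using Finset.induction_on with
  | empty => simp [wnorm_zero]
  | insert a s ha ih =>
    rw [Finset.sum_insert ha, Finset.sum_insert ha]
    exact (wnorm_add_le hB _ _).trans (by gcongr)

theorem abs_dotProduct_mulVec_le {B : Matrix n n ℝ} (hB : B.PosSemidef) (x y : n → ℝ) :
    |x ⬝ᵥ B *ᵥ y| ≤ wnorm B x * wnorm B y := by
  obtain ⟨R, h1, h2, h⟩ := exists_wnorm_eq_norm hB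
  rw [h, h, ← h2, dotProduct_mulVec_of_sq h1]
  have := abs_real_inner_le_norm (WithLp.toLp 2 (R *ᵥ y) : EuclideanSpace ℝ n)
    (WithLp.toLp 2 (R *ᵥ x))
  rw [EuclideanSpace.inner_toLp_toLp] at this
  simpa [mul_comm] using this

variable [DecidableEq n]

theorem inv_mulVec_mulVec {B : Matrix n n ℝ} (hB : B.PosDef) (x : n → ℝ) :
    B⁻¹ *ᵥ B *ᵥ x = x := by
  rw [mulVec_mulVec, nonsing_inv_mul _ ((isUnit_iff_isUnit_det _).1 hB.isUnit), one_mulVec]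

theorem mulVec_inv_mulVec {B : Matrix n n ℝ} (hB : B.PosDef) (x : n → ℝ) :
    B *ᵥ B⁻¹ *ᵥ x = x := by
  rw [mulVec_mulVec, mul_nonsing_inv _ ((isUnit_iff_isUnit_det _).1 hB.isUnit), one_mulVec]

theorem wnorm_inv_mulVec {B : Matrix n n ℝ} (hB : B.PosDef) (x : n → ℝ) :
    wnorm B⁻¹ (B *ᵥ x) = wnorm B x := by
  rw [wnorm, wnorm, inv_mulVec_mulVec hB, dotProduct_comm]

theorem wnorm_mulVec_inv {B : Matrix n n ℝ} (hB : B.PosDef) (x : n → ℝ) :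
    wnorm B (B⁻¹ *ᵥ x) = wnorm B⁻¹ x := by
  rw [wnorm, wnorm, mulVec_inv_mulVec hB, dotProduct_comm]

/-- The norms of `B` and `B⁻¹` are dual. Every later estimate splits "feature times error" this way,
features in the inverse covariance norm and errors in the covariance norm. -/
theorem abs_dotProduct_le_wnorm {B : Matrix n n ℝ} (hB : B.PosDef) (x y : n → ℝ) :
    |x ⬝ᵥ y| ≤ wnorm B⁻¹ x * wnorm B y := by
  have h := abs_dotProduct_mulVec_le hB.inv.posSemidef x (B *ᵥ y)
  rwa [inv_mulVec_mulVec hB, wnorm_inv_mulVec hB] at h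

theorem dotProduct_mulVec_comm_of_isHermitian {B : Matrix n n ℝ} (hB : B.IsHermitian)
    (x y : n → ℝ) : x ⬝ᵥ B *ᵥ y = y ⬝ᵥ B *ᵥ x := by
  rw [dotProduct_mulVec, ← mulVec_transpose, dotProduct_comm]
  congr 2

/-! ### Regularized covariance matrices -/

/-- The matrix `λ I + ∑_{τ < k} f_τ f_τᵀ`. -/
def regCov (lam : ℝ) (f : ℕ → n → ℝ) (k : ℕ) : Matrix n n ℝ :=
  lam • (1 : Matrix n n ℝ) + ∑ τ ∈ Finset.range k, vecMulVec (f τ) (f τ)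

variable {lam : ℝ} (f : ℕ → n → ℝ) (k : ℕ)

theorem regCov_zero : regCov lam f 0 = lam • (1 : Matrix n n ℝ) := by simp [regCov]

theorem regCov_succ : regCov lam f (k + 1) = regCov lam f k + vecMulVec (f k) (f k) := by
  rw [regCov, regCov, Finset.sum_range_succ, add_assoc]

theorem posDef_regCov (hlam : 0 < lam) : (regCov lam f k).PosDef := by
  refine PosDef.add_posSemidef (PosDef.smul PosDef.one hlam) (posSemidef_sum _ fun τ _ => ?_)
  simpa using posSemidef_vecMulVec_self_star (f τ)

theorem dotProduct_regCov_mulVec (x : n → ℝ) :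
    x ⬝ᵥ regCov lam f k *ᵥ x = lam * (x ⬝ᵥ x) + ∑ τ ∈ Finset.range k, (f τ ⬝ᵥ x) ^ 2 := by
  induction k with
  | zero => simp [regCov_zero, smul_mulVec]
  | succ k ih =>
    rw [regCov_succ, add_mulVec, dotProduct_add, ih, Finset.sum_range_succ, vecMulVec_mulVec,
      add_assoc]
    congr 2
    simp [dotProduct_comm x, sq]

theorem regCov_mulVec (x : n → ℝ) :
    regCov lam f k *ᵥ x = lam • x + ∑ τ ∈ Finset.range k, (f τ ⬝ᵥ x) • f τ := by
  induction k with
  | zero => simp [regCov_zero, smul_mulVec]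
  | succ k ih =>
    rw [regCov_succ, add_mulVec, ih, Finset.sum_range_succ, vecMulVec_mulVec, add_assoc]
    simp

theorem mul_norm_sq_le_regCov (hlam : 0 < lam) (x : n → ℝ) :
    lam * (x ⬝ᵥ x) ≤ wnorm (regCov lam f k) x ^ 2 := by
  rw [wnorm_sq (posDef_regCov f k hlam).posSemidef, dotProduct_regCov_mulVec]
  linarith [Finset.sum_nonneg fun τ (_ : τ ∈ Finset.range k) => sq_nonneg (f τ ⬝ᵥ x)]

theorem sqrt_mul_norm_le_regCov (hlam : 0 < lam) (x : n → ℝ) :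
    √lam * ‖WithLp.toLp 2 x‖ ≤ wnorm (regCov lam f k) x := by
  refine abs_le_of_sq_le_sq' ?_ (wnorm_nonneg _ _) |>.2
  rw [mul_pow, Real.sq_sqrt hlam.le, norm_toLp_sq]
  exact mul_norm_sq_le_regCov f k hlam x

theorem wnorm_inv_regCov_sq_le (hlam : 0 < lam) (x : n → ℝ) :
    lam * wnorm (regCov lam f k)⁻¹ x ^ 2 ≤ x ⬝ᵥ x := by
  have hB := posDef_regCov f k hlam
  set y := (regCov lam f k)⁻¹ *ᵥ x with hy
  have h1 : lam * (y ⬝ᵥ y) ≤ wnorm (regCov lam f k)⁻¹ x ^ 2 := by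
    have := mul_norm_sq_le_regCov f k hlam y
    rwa [hy, wnorm_mulVec_inv hB] at this
  have h2 : wnorm (regCov lam f k)⁻¹ x ^ 2 = x ⬝ᵥ y := wnorm_sq hB.inv.posSemidef x
  -- Expanding this square and using λ yᵀy ≤ xᵀy from `h1` leaves λ xᵀy ≤ xᵀx, which is the claim.
  have h3 : 0 ≤ (x - lam • y) ⬝ᵥ (x - lam • y) := by
    rw [← norm_toLp_sq]; positivity
  simp only [sub_dotProduct, dotProduct_sub, smul_dotProduct, dotProduct_smul, smul_eq_mul] at h3
  rw [dotProduct_comm y x] at h3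
  rw [h2] at h1 ⊢
  nlinarith

theorem wnorm_inv_regCov_le (hlam : 0 < lam) (x : n → ℝ) :
    √lam * wnorm (regCov lam f k)⁻¹ x ≤ ‖WithLp.toLp 2 x‖ := by
  refine abs_le_of_sq_le_sq' ?_ (norm_nonneg _) |>.2
  rw [mul_pow, Real.sq_sqrt hlam.le, norm_toLp_sq]
  exact wnorm_inv_regCov_sq_le f k hlam x

/-- **Sherman–Morrison** for the quadratic form of the inverse. -/
theorem dotProduct_inv_add_vecMulVec {B : Matrix n n ℝ} (hB : B.PosDef) (v x : n → ℝ) :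
    x ⬝ᵥ (B + vecMulVec v v)⁻¹ *ᵥ x =
      x ⬝ᵥ B⁻¹ *ᵥ x - (v ⬝ᵥ B⁻¹ *ᵥ x) ^ 2 / (1 + v ⬝ᵥ B⁻¹ *ᵥ v) := by
  have hB' : (B + vecMulVec v v).PosDef :=
    hB.add_posSemidef (by simpa using posSemidef_vecMulVec_self_star v)
  have hu : 0 ≤ v ⬝ᵥ B⁻¹ *ᵥ v := by simpa using hB.inv.posSemidef.dotProduct_mulVec_nonneg v
  set b := v ⬝ᵥ B⁻¹ *ᵥ x with hb
  set u := v ⬝ᵥ B⁻¹ *ᵥ v with hu'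
  -- It suffices to check that the Sherman–Morrison candidate for the inverse image is mapped to
  -- `x`.
  have key : (B + vecMulVec v v) *ᵥ (B⁻¹ *ᵥ x - (b / (1 + u)) • B⁻¹ *ᵥ v) = x := by
    rw [mulVec_sub, mulVec_smul, add_mulVec, add_mulVec, mulVec_inv_mulVec hB,
      mulVec_inv_mulVec hB, vecMulVec_mulVec, vecMulVec_mulVec, ← hb, ← hu']
    ext i
    simp
    field_simp
    ring
  have h2 : (B + vecMulVec v v)⁻¹ *ᵥ x = B⁻¹ *ᵥ x - (b / (1 + u)) • B⁻¹ *ᵥ v := by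
    conv_lhs => rw [← key]
    exact inv_mulVec_mulVec hB' _
  rw [h2, dotProduct_sub, dotProduct_smul,
    dotProduct_mulVec_comm_of_isHermitian hB.inv.isHermitian x v, ← hb, smul_eq_mul]
  ring

theorem det_add_vecMulVec {B : Matrix n n ℝ} (hB : B.PosDef) (v : n → ℝ) :
    (B + vecMulVec v v).det = B.det * (1 + v ⬝ᵥ B⁻¹ *ᵥ v) := by
  rw [vecMulVec_eq Unit, det_add_replicateCol_mul_replicateRow hB.det_pos.ne'.isUnit]
  congr 1
  rw [det_eq_elem_of_subsingleton _ (), Matrix.add_apply, one_apply_eq, Matrix.mul_assoc, ← replicateCol_mulVec,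
    replicateRow_mul_replicateCol_apply]

theorem trace_regCov :
    (regCov lam f k).trace = lam * Fintype.card n + ∑ τ ∈ Finset.range k, f τ ⬝ᵥ f τ := by
  simp [regCov, trace_add, trace_sum, trace_vecMulVec, trace_smul]

/-- The determinant of a positive definite matrix is at most that of the multiple of the identity
of the same trace. -/
theorem log_det_le {B : Matrix n n ℝ} (hB : B.PosDef) [Nonempty n] :
    Real.log B.det ≤ Fintype.card n * Real.log (B.trace / Fintype.card n) := by
  have hev : ∀ i, 0 < hB.1.eigenvalues i := hB.eigenvalues_pos
  have hc : (0 : ℝ) < Fintype.card n := by exact_mod_cast Fintype.card_pos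
  rw [hB.1.det_eq_prod_eigenvalues, hB.1.trace_eq_sum_eigenvalues]
  simp only [RCLike.ofReal_real_eq_id, id_eq]
  rw [Real.log_prod fun i _ => (hev i).ne']
  -- AM–GM for the eigenvalues, as Jensen's inequality for log with uniform weights.
  have h := strictConcaveOn_log_Ioi.concaveOn.le_map_sum (t := Finset.univ)
    (w := fun _ : n => (1 : ℝ) / Fintype.card n) (p := hB.1.eigenvalues)
    (fun _ _ => by positivity) (by simp [hc.ne']) (fun i _ => hev i)
  simp only [smul_eq_mul, ← Finset.mul_sum] at h
  rw [one_div, inv_mul_le_iff₀ hc] at h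
  rwa [inv_mul_eq_div] at h

/-- Logarithm of the determinant ratio of regularized covariance matrices. -/
theorem log_det_regCov_le [Nonempty n] (hlam : 0 < lam) {L : ℝ} (hL : ∀ τ < k, f τ ⬝ᵥ f τ ≤ L) :
    Real.log ((regCov lam f k).det / (regCov lam f 0).det) ≤
      Fintype.card n * Real.log (1 + k * L / (lam * Fintype.card n)) := by
  have hB := posDef_regCov f k hlam
  have hc : (0 : ℝ) < Fintype.card n := by exact_mod_cast Fintype.card_pos
  have h0 : (regCov lam f 0).det = lam ^ Fintype.card n := by rw [regCov_zero]; simp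
  rw [Real.log_div hB.det_pos.ne' (posDef_regCov f 0 hlam).det_pos.ne', h0, Real.log_pow]
  have h1 := log_det_le hB
  have htr : (regCov lam f k).trace / Fintype.card n ≤
      lam * (1 + k * L / (lam * Fintype.card n)) := by
    rw [trace_regCov, div_le_iff₀ hc]
    have : ∑ τ ∈ Finset.range k, f τ ⬝ᵥ f τ ≤ k * L := by
      calc _ ≤ ∑ τ ∈ Finset.range k, L := Finset.sum_le_sum fun τ h => hL τ (Finset.mem_range.1 h)
        _ = _ := by simp
    calc _ ≤ lam * Fintype.card n + k * L := by linarith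
      _ = _ := by field_simp
  have htp : 0 < (regCov lam f k).trace / Fintype.card n := by
    have := hB.trace_pos
    positivity
  have h2 : Real.log ((regCov lam f k).trace / Fintype.card n) ≤
      Real.log lam + Real.log (1 + k * L / (lam * Fintype.card n)) := by
    rw [← Real.log_mul hlam.ne' ?_]
    · exact Real.log_le_log htp htr
    · have := htp.trans_le htr
      exact (pos_of_mul_pos_right this hlam.le).ne'
  calc _ ≤ Fintype.card n * (Real.log lam + Real.log (1 + k * L / (lam * Fintype.card n)))
        - Fintype.card n * Real.log lam := by
        gcongr
        exact h1.trans (by gcongr)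
    _ = _ := by ring

theorem det_regCov_ratio (hlam : 0 < lam) :
    (regCov lam f k).det / (regCov lam f 0).det =
      ∏ τ ∈ Finset.range k, (1 + wnorm (regCov lam f τ)⁻¹ (f τ) ^ 2) := by
  induction k with
  | zero => simp [(posDef_regCov f 0 hlam).det_pos.ne']
  | succ k ih =>
    rw [Finset.prod_range_succ, ← ih, regCov_succ, det_add_vecMulVec (posDef_regCov f k hlam),
      wnorm_sq (posDef_regCov f k hlam).inv.posSemidef]
    ring

/-- The **elliptical potential lemma**. -/
theorem sum_wnorm_sq_le [Nonempty n] (hlam : 0 < lam) (hL : ∀ τ < k, f τ ⬝ᵥ f τ ≤ lam) :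
    ∑ τ ∈ Finset.range k, wnorm (regCov lam f τ)⁻¹ (f τ) ^ 2 ≤
      2 * (Fintype.card n * Real.log (1 + k)) := by
  have hc : (1 : ℝ) ≤ Fintype.card n := by exact_mod_cast Fintype.card_pos
  -- The bound u ≤ 2 log(1 + u) below needs u ≤ 1, which forces the regularization to dominate the
  -- squared features: hence λ_r = H and λ_p = 1.
  have h1 : ∀ τ < k, wnorm (regCov lam f τ)⁻¹ (f τ) ^ 2 ≤ 1 := fun τ hτ => by
    have := (wnorm_inv_regCov_sq_le f τ hlam (f τ)).trans (hL τ hτ)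
    exact le_of_mul_le_mul_left (by linarith) hlam
  have h2 : ∀ u : ℝ, 0 ≤ u → u ≤ 1 → u ≤ 2 * Real.log (1 + u) := fun u h0 h1 => by
    have := Real.one_sub_inv_le_log_of_pos (by linarith : 0 < 1 + u)
    have h3 : u / 2 ≤ 1 - (1 + u)⁻¹ := by
      rw [le_sub_iff_add_le, inv_eq_one_div, div_add_div _ _ (by norm_num) (by linarith),
        div_le_one (by linarith)]
      nlinarith
    linarith
  calc _ ≤ ∑ τ ∈ Finset.range k, 2 * Real.log (1 + wnorm (regCov lam f τ)⁻¹ (f τ) ^ 2) :=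
        Finset.sum_le_sum fun τ hτ => h2 _ (sq_nonneg _) (h1 τ (Finset.mem_range.1 hτ))
    _ = 2 * Real.log ((regCov lam f k).det / (regCov lam f 0).det) := by
        rw [det_regCov_ratio f k hlam, Real.log_prod fun i _ => by positivity, Finset.mul_sum]
    _ ≤ _ := by
        have := log_det_regCov_le f k hlam hL
        have h3 : (k : ℝ) * lam / (lam * Fintype.card n) ≤ k := by
          rw [mul_comm, mul_div_mul_left _ _ hlam.ne']
          exact div_le_self (by positivity) hc
        have h4 : 0 ≤ (k : ℝ) * lam / (lam * Fintype.card n) := by positivity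
        have := this.trans (mul_le_mul_of_nonneg_left
          (Real.log_le_log (by linarith) (add_le_add_right h3 1)) (by linarith))
        linarith

end LinearAlgebra

/-! ### Self-normalized processes -/

/-- The factor by which the self-normalized process `exp (‖S‖² / 2) / √det` grows in one step. -/
def selfNormFactor (b u y : ℝ) : ℝ :=
  Real.exp ((2 * y * b + y ^ 2 * u - b ^ 2) / (2 * (1 + u))) / √(1 + u)

theorem selfNormFactor_pos {u : ℝ} (hu : 0 ≤ u) (b y : ℝ) : 0 < selfNormFactor b u y := by
  have : 0 < 1 + u := by linarith
  unfold selfNormFactor; positivity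

theorem selfNormFactor_le {b u y : ℝ} (hu : 0 ≤ u) (hy : |y| ≤ 1) :
    selfNormFactor b u y ≤ Real.exp (1 / 2) := by
  have h1 : 1 ≤ √(1 + u) := Real.one_le_sqrt.2 (by linarith)
  have hy2 : y ^ 2 ≤ 1 := (sq_le_one_iff_abs_le_one y).2 hy
  refine (div_le_self (Real.exp_pos _).le h1).trans (Real.exp_le_exp.2 ?_)
  rw [div_le_div_iff₀ (by linarith) (by norm_num)]
  nlinarith [sq_nonneg (y - b)]

/-- The coefficient of `y` in the linear upper bound for `selfNormFactor`. -/
def selfNormSlope (b u : ℝ) : ℝ := (selfNormFactor b u 1 - selfNormFactor b u (-1)) / 2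

theorem abs_selfNormSlope_le {u : ℝ} (hu : 0 ≤ u) (b : ℝ) :
    |selfNormSlope b u| ≤ Real.exp (1 / 2) := by
  have h1 := selfNormFactor_pos hu b 1
  have h2 := selfNormFactor_pos hu b (-1)
  have h3 := selfNormFactor_le (b := b) hu (y := 1) (by simp)
  have h4 := selfNormFactor_le (b := b) hu (y := -1) (by simp)
  rw [selfNormSlope, abs_le]
  constructor <;> linarith

/-- The two factors average to exp((u − b²)/(2(1+u))) cosh(b/(1+u)) / √(1+u). After cosh t ≤
exp(t²/2) the terms in b² have a nonpositive sum, and what remains is u/(1+u) ≤ log(1+u). -/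
theorem selfNormFactor_add_neg_le {u : ℝ} (hu : 0 ≤ u) (b : ℝ) :
    selfNormFactor b u 1 + selfNormFactor b u (-1) ≤ 2 := by
  have hu1 : 0 < 1 + u := by linarith
  have e1 : selfNormFactor b u 1 + selfNormFactor b u (-1) =
      2 * (Real.exp ((u - b ^ 2) / (2 * (1 + u))) * Real.cosh (b / (1 + u)) / √(1 + u)) := by
    rw [selfNormFactor, selfNormFactor, Real.cosh_eq,
      show (2 * 1 * b + 1 ^ 2 * u - b ^ 2) / (2 * (1 + u)) =
        (u - b ^ 2) / (2 * (1 + u)) + b / (1 + u) by field_simp; ring,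
      show (2 * (-1) * b + (-1) ^ 2 * u - b ^ 2) / (2 * (1 + u)) =
        (u - b ^ 2) / (2 * (1 + u)) + -(b / (1 + u)) by field_simp; ring,
      Real.exp_add, Real.exp_add]
    ring
  rw [e1]
  suffices Real.exp ((u - b ^ 2) / (2 * (1 + u))) * Real.cosh (b / (1 + u)) ≤ √(1 + u) by
    have := (div_le_one (Real.sqrt_pos.2 hu1)).2 this
    linarith
  calc _ ≤ Real.exp ((u - b ^ 2) / (2 * (1 + u))) * Real.exp ((b / (1 + u)) ^ 2 / 2) := by
        gcongr
        exact Real.cosh_le_exp_half_sq _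
    _ = Real.exp ((u - b ^ 2) / (2 * (1 + u)) + (b / (1 + u)) ^ 2 / 2) := (Real.exp_add _ _).symm
    _ ≤ Real.exp (Real.log (1 + u) / 2) := by
        refine Real.exp_le_exp.2 ?_
        have h := Real.one_sub_inv_le_log_of_pos hu1
        refine le_trans ?_ (div_le_div_of_nonneg_right h (by norm_num))
        have : (1 - (1 + u)⁻¹) / 2 - ((u - b ^ 2) / (2 * (1 + u)) + (b / (1 + u)) ^ 2 / 2) =
            u * b ^ 2 / (2 * (1 + u) ^ 2) := by field_simp; ring
        have h0 : 0 ≤ u * b ^ 2 / (2 * (1 + u) ^ 2) := by positivity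
        linarith
    _ = √(1 + u) := by
        rw [Real.sqrt_eq_rpow, Real.rpow_def_of_pos hu1]
        ring_nf

/-- The one-step bound behind self-normalized concentration: the growth factor is dominated by an
affine function of the increment with constant term `1`. -/
theorem selfNormFactor_le_affine {b u y : ℝ} (hu : 0 ≤ u) (hy : |y| ≤ 1) :
    selfNormFactor b u y ≤ 1 + y * selfNormSlope b u := by
  have hu1 : 0 < 1 + u := by linarith
  obtain ⟨hy1, hy2⟩ := abs_le.1 hy
  set q : ℝ → ℝ := fun y => (2 * y * b + y ^ 2 * u - b ^ 2) / (2 * (1 + u)) with hq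
  -- The exponent is a convex quadratic in `y`, hence below its chord on [−1, 1]; convexity of exp
  -- then carries the chord bound over to the factor.
  have h1 : q y ≤ (1 + y) / 2 * q 1 + (1 - y) / 2 * q (-1) := by
    have : (1 + y) / 2 * q 1 + (1 - y) / 2 * q (-1) - q y =
        (1 - y ^ 2) * u / (2 * (1 + u)) := by
      simp only [hq]; field_simp; ring
    have h0 : 0 ≤ (1 - y ^ 2) * u / (2 * (1 + u)) := by
      have : 0 ≤ 1 - y ^ 2 := by nlinarith
      positivity
    linarith
  have h2 : Real.exp (q y) ≤ (1 + y) / 2 * Real.exp (q 1) + (1 - y) / 2 * Real.exp (q (-1)) := by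
    refine (Real.exp_le_exp.2 h1).trans ?_
    have := convexOn_exp.2 (Set.mem_univ (q 1)) (Set.mem_univ (q (-1)))
      (by linarith : 0 ≤ (1 + y) / 2) (by linarith : 0 ≤ (1 - y) / 2) (by ring)
    simpa using this
  have h3 : selfNormFactor b u y ≤
      (1 + y) / 2 * selfNormFactor b u 1 + (1 - y) / 2 * selfNormFactor b u (-1) := by
    have := div_le_div_of_nonneg_right h2 (Real.sqrt_nonneg (1 + u))
    refine this.trans (le_of_eq ?_)
    simp only [selfNormFactor, hq]
    ring
  have h4 := selfNormFactor_add_neg_le hu b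
  rw [selfNormSlope]
  linarith

/-! ### The self-normalized process of a vector-valued sum -/

section

variable {n : Type*} [Fintype n] [DecidableEq n] {lam : ℝ} (f : ℕ → n → ℝ) (y : ℕ → ℝ) (k : ℕ)

/-- The linear coefficient `f_kᵀ Λ_k⁻¹ ∑_{τ < k} y_τ f_τ`. -/
def selfNormCoef (lam : ℝ) (f : ℕ → n → ℝ) (y : ℕ → ℝ) (k : ℕ) : ℝ :=
  f k ⬝ᵥ (regCov lam f k)⁻¹ *ᵥ ∑ τ ∈ Finset.range k, y τ • f τ

/-- The self-normalized process. -/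
def selfNormProc (lam : ℝ) (f : ℕ → n → ℝ) (y : ℕ → ℝ) (k : ℕ) : ℝ :=
  ∏ τ ∈ Finset.range k,
    selfNormFactor (selfNormCoef lam f y τ) (wnorm (regCov lam f τ)⁻¹ (f τ) ^ 2) (y τ)

/-- Sherman–Morrison updates the quadratic form and the matrix determinant lemma the denominator;
together one step contributes exactly one `selfNormFactor`. -/
theorem selfNormProc_eq (hlam : 0 < lam) :
    selfNormProc lam f y k =
      Real.exp (wnorm (regCov lam f k)⁻¹ (∑ τ ∈ Finset.range k, y τ • f τ) ^ 2 / 2) /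
        √((regCov lam f k).det / (regCov lam f 0).det) := by
  induction k with
  | zero => simp [selfNormProc, wnorm_zero, (posDef_regCov f 0 hlam).det_pos.ne']
  | succ k ih =>
    have hB := posDef_regCov f k hlam
    have hB' := posDef_regCov f (k + 1) hlam
    set S := ∑ τ ∈ Finset.range k, y τ • f τ with hS
    set u := wnorm (regCov lam f k)⁻¹ (f k) ^ 2 with hu
    have hu0 : 0 ≤ u := sq_nonneg _
    have hu' : f k ⬝ᵥ (regCov lam f k)⁻¹ *ᵥ f k = u := (wnorm_sq hB.inv.posSemidef _).symm
    set b := selfNormCoef lam f y k with hb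
    have hb' : f k ⬝ᵥ (regCov lam f k)⁻¹ *ᵥ S = b := rfl
    have hdet : (regCov lam f (k + 1)).det / (regCov lam f 0).det =
        (regCov lam f k).det / (regCov lam f 0).det * (1 + u) := by
      rw [regCov_succ, det_add_vecMulVec hB, hu']; ring
    have hq : wnorm (regCov lam f (k + 1))⁻¹ (S + y k • f k) ^ 2 =
        wnorm (regCov lam f k)⁻¹ S ^ 2 + (2 * y k * b + y k ^ 2 * u - b ^ 2) / (1 + u) := by
      rw [wnorm_sq hB'.inv.posSemidef, wnorm_sq hB.inv.posSemidef, regCov_succ,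
        dotProduct_inv_add_vecMulVec hB, hu']
      simp only [mulVec_add, mulVec_smul, dotProduct_add, add_dotProduct, dotProduct_smul,
        smul_dotProduct, smul_eq_mul, hu', hb',
        dotProduct_mulVec_comm_of_isHermitian hB.inv.isHermitian S (f k)]
      field_simp
      ring
    have hr : 0 ≤ (regCov lam f k).det / (regCov lam f 0).det :=
      (div_pos hB.det_pos (posDef_regCov f 0 hlam).det_pos).le
    rw [selfNormProc, Finset.prod_range_succ, ← selfNormProc, ih, Finset.sum_range_succ, ← hS, hq,
      hdet, Real.sqrt_mul hr, add_div, Real.exp_add, selfNormFactor, ← hb, ← hu, div_div,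
      mul_comm (1 + u) 2]
    ring

theorem selfNormProc_pos : 0 < selfNormProc lam f y k :=
  Finset.prod_pos fun _ _ => selfNormFactor_pos (sq_nonneg _) _ _

/-- A crude deterministic bound, serving only integrability and the pulling of bounded factors out
of conditional expectations. -/
theorem selfNormProc_le (hy : ∀ τ < k, |y τ| ≤ 1) :
    selfNormProc lam f y k ≤ Real.exp (1 / 2) ^ k := by
  calc _ ≤ ∏ τ ∈ Finset.range k, Real.exp (1 / 2) :=
        Finset.prod_le_prod (fun _ _ => (selfNormFactor_pos (sq_nonneg _) _ _).le)
          fun τ h => selfNormFactor_le (sq_nonneg _) (hy τ (Finset.mem_range.1 h))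
    _ = _ := by simp

/-- When the self-normalized process is small, so is the weighted norm of the sum. -/
theorem wnorm_sq_le_of_selfNormProc_le [Nonempty n] (hlam : 0 < lam) {L M : ℝ}
    (hL : ∀ τ < k, f τ ⬝ᵥ f τ ≤ L) (hM : selfNormProc lam f y k ≤ M) :
    wnorm (regCov lam f k)⁻¹ (∑ τ ∈ Finset.range k, y τ • f τ) ^ 2 ≤
      2 * Real.log M + Fintype.card n * Real.log (1 + k * L / (lam * Fintype.card n)) := by
  have h1 := Real.log_le_log (selfNormProc_pos (lam := lam) f y k) hM
  have hr : 0 < (regCov lam f k).det / (regCov lam f 0).det :=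
    div_pos (posDef_regCov f k hlam).det_pos (posDef_regCov f 0 hlam).det_pos
  rw [selfNormProc_eq f y k hlam, Real.log_div (Real.exp_pos _).ne' (Real.sqrt_pos.2 hr).ne',
    Real.log_exp, Real.log_sqrt hr.le] at h1
  have h2 := log_det_regCov_le f k hlam hL
  linarith

end

/-! ### Expectations over trajectories -/

section Trajectories

variable {X A : Type*} [Fintype X] [Fintype A] {H : ℕ}

theorem trajProb_nonneg (M : MDP X A H) (π : Policy X A H) (ι : Traj X A H) :
    0 ≤ M.trajProb π ι := by
  refine Finset.prod_nonneg fun h _ => mul_nonneg ?_ ((π.2 h _).1 _)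
  unfold MDP.arriveProb
  split_ifs
  · norm_num
  · norm_num
  · exact (M.P_mem _ _ _).1 _

theorem expect_mono_of_support (M : MDP X A H) (π : Policy X A H) {f g : Traj X A H → ℝ}
    (h : ∀ ι, M.trajProb π ι ≠ 0 → f ι ≤ g ι) : M.expect π f ≤ M.expect π g := by
  refine Finset.sum_le_sum fun ι _ => ?_
  by_cases h0 : M.trajProb π ι = 0
  · simp [h0]
  · exact mul_le_mul_of_nonneg_left (h ι h0) (trajProb_nonneg M π ι)

theorem expect_mono (M : MDP X A H) (π : Policy X A H) {f g : Traj X A H → ℝ}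
    (h : ∀ ι, f ι ≤ g ι) : M.expect π f ≤ M.expect π g :=
  expect_mono_of_support M π fun ι _ => h ι

theorem expect_congr_of_support (M : MDP X A H) (π : Policy X A H) {f g : Traj X A H → ℝ}
    (h : ∀ ι, M.trajProb π ι ≠ 0 → f ι = g ι) : M.expect π f = M.expect π g :=
  le_antisymm (expect_mono_of_support M π fun ι h0 => (h ι h0).le)
    (expect_mono_of_support M π fun ι h0 => (h ι h0).ge)

theorem expect_add (M : MDP X A H) (π : Policy X A H) (f g : Traj X A H → ℝ) :
    M.expect π (fun ι => f ι + g ι) = M.expect π f + M.expect π g := by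
  simp [MDP.expect, mul_add, Finset.sum_add_distrib]

theorem expect_sub (M : MDP X A H) (π : Policy X A H) (f g : Traj X A H → ℝ) :
    M.expect π (fun ι => f ι - g ι) = M.expect π f - M.expect π g := by
  simp [MDP.expect, mul_sub, Finset.sum_sub_distrib]

theorem expect_const_mul (M : MDP X A H) (π : Policy X A H) (c : ℝ) (f : Traj X A H → ℝ) :
    M.expect π (fun ι => c * f ι) = c * M.expect π f := by
  simp [MDP.expect, mul_left_comm, Finset.mul_sum]

theorem expect_sum (M : MDP X A H) (π : Policy X A H) {α : Type*} (s : Finset α)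
    (f : α → Traj X A H → ℝ) :
    M.expect π (fun ι => ∑ i ∈ s, f i ι) = ∑ i ∈ s, M.expect π (f i) := by
  simp only [MDP.expect, Finset.mul_sum]
  exact Finset.sum_comm

theorem fst_eq_init_of_trajProb_ne_zero {M : MDP X A H} {π : Policy X A H} {ι : Traj X A H}
    (h0 : M.trajProb π ι ≠ 0) (hH : 0 < H) : (ι ⟨0, hH⟩).1 = M.init := by
  by_contra hne
  refine h0 (Finset.prod_eq_zero (Finset.mem_univ ⟨0, hH⟩) ?_)
  simp [MDP.arriveProb, hne]

theorem action_eq_of_trajProb_ne_zero {M : MDP X A H} {π : Fin H → X → A} {ι : Traj X A H}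
    (h0 : M.trajProb (Policy.det π) ι ≠ 0) (h : Fin H) : (ι h).2 = π h (ι h).1 := by
  by_contra hne
  refine h0 (Finset.prod_eq_zero (Finset.mem_univ h) ?_)
  simp [Policy.det, hne]

variable [Nonempty A]

-- Exchanging coordinate `n` of the trajectory with the free pair `y` is an involution, so every
-- trajectory is hit equally often.
open Classical in
theorem sum_traj_update (G : Traj X A H → ℝ) (n : Fin H) :
    ∑ ι : Traj X A H, ∑ y : X × A, G (Function.update ι n y) =
      Fintype.card (X × A) * ∑ ι : Traj X A H, G ι := by
  rw [← Fintype.sum_prod_type' (f := fun (ι : Traj X A H) y => G (Function.update ι n y))]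
  have h : ∑ p : Traj X A H × (X × A), G (Function.update p.1 n p.2) =
      ∑ p : Traj X A H × (X × A), G p.1 := by
    refine Fintype.sum_bijective (fun p => (Function.update p.1 n p.2, p.1 n)) ?_ _ _ fun p => rfl
    refine Function.Involutive.bijective fun p => ?_
    simp
  rw [h, Fintype.sum_prod_type, Finset.mul_sum]
  simp

/-- The contribution of step `h` to the probability of a trajectory. -/
def stepProb (M : MDP X A H) (π : Policy X A H) (ι : Traj X A H) (h : Fin H) : ℝ :=
  M.arriveProb ι h * π.1 h (ι h).1 (ι h).2

/-- The expectation under the law that follows the MDP for `j` steps and is uniform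
afterwards. -/
def expectUpto (M : MDP X A H) (π : Policy X A H) (j : ℕ) (f : Traj X A H → ℝ) : ℝ :=
  ((Fintype.card (X × A) : ℝ) ^ (H - j))⁻¹ *
    ∑ ι : Traj X A H, (∏ h with h.val < j, stepProb M π ι h) * f ι

theorem expectUpto_self (M : MDP X A H) (π : Policy X A H) (f : Traj X A H → ℝ) :
    expectUpto M π H f = M.expect π f := by
  simp [expectUpto, MDP.expect, MDP.trajProb, stepProb]

open Classical in
theorem stepProb_update_of_lt (M : MDP X A H) (π : Policy X A H) (ι : Traj X A H) {n h : Fin H}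
    (hn : h < n) (y : X × A) :
    stepProb M π (Function.update ι n y) h = stepProb M π ι h := by
  have h1 : ∀ m : Fin H, m ≤ h → Function.update ι n y m = ι m := fun m hm =>
    Function.update_of_ne (hm.trans_lt hn).ne _ _
  have h2 : Function.update ι n y ⟨h.val - 1, lt_of_le_of_lt (Nat.sub_le _ _) h.isLt⟩ =
      ι ⟨h.val - 1, lt_of_le_of_lt (Nat.sub_le _ _) h.isLt⟩ :=
    h1 _ (by rw [Fin.le_def]; exact Nat.sub_le _ _)
  simp only [stepProb, MDP.arriveProb, h1 h le_rfl, h2]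

open Classical in
theorem expectUpto_succ (M : MDP X A H) (π : Policy X A H) (n : Fin H) (f : Traj X A H → ℝ) :
    expectUpto M π (n.val + 1) f = expectUpto M π n.val fun ι =>
      ∑ y, stepProb M π (Function.update ι n y) n * f (Function.update ι n y) := by
  have : Nonempty X := ⟨M.init⟩
  have hc : (Fintype.card (X × A) : ℝ) ≠ 0 := by exact_mod_cast Fintype.card_ne_zero
  have hp : ∀ ι : Traj X A H, ∏ h with h.val < n.val + 1, stepProb M π ι h =
      stepProb M π ι n * ∏ h with h.val < n.val, stepProb M π ι h := fun ι => by
    have : (Finset.univ.filter fun h : Fin H => h.val < n.val + 1) =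
        insert n (Finset.univ.filter fun h : Fin H => h.val < n.val) := by
      ext h; simp [Fin.ext_iff]; omega
    rw [this, Finset.prod_insert (by simp)]
  have hexp : H - n.val = (H - (n.val + 1)) + 1 := by omega
  simp only [expectUpto]
  rw [hexp, pow_succ, mul_inv, mul_assoc]
  congr 1
  -- Averaging over a resampled coordinate `n` changes nothing in the full sum; afterwards the
  -- factor of step `n` is the only one depending on the new value.
  rw [eq_inv_mul_iff_mul_eq₀ hc, ← sum_traj_update _ n]
  refine Finset.sum_congr rfl fun ι _ => ?_
  rw [Finset.mul_sum]
  refine Finset.sum_congr rfl fun y _ => ?_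
  have : ∏ h with h.val < n.val, stepProb M π (Function.update ι n y) h =
      ∏ h with h.val < n.val, stepProb M π ι h :=
    Finset.prod_congr rfl fun h hh =>
      stepProb_update_of_lt M π ι (Fin.lt_def.2 (Finset.mem_filter.1 hh).2) y
  rw [hp, this]
  ring

/-- The law of the state of step `h` given the previous steps of the trajectory. -/
def arriveLaw (M : MDP X A H) (ι : Traj X A H) (n : Fin H) (x : X) : ℝ :=
  open Classical in
  M.arriveProb (Function.update ι n (x, Classical.arbitrary A)) n

-- The arrival probability at step `n` does not see the action of step `n`, so summing over actions
-- only uses that the policy is a probability vector.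
open Classical in
theorem sum_stepProb_update (M : MDP X A H) (π : Policy X A H) (ι : Traj X A H) (n : Fin H)
    (F : X → ℝ) :
    ∑ y : X × A, stepProb M π (Function.update ι n y) n * F y.1 =
      ∑ x, arriveLaw M ι n x * F x := by
  rw [Fintype.sum_prod_type]
  refine Finset.sum_congr rfl fun x _ => ?_
  have h1 : ∀ a : A, M.arriveProb (Function.update ι n (x, a)) n = arriveLaw M ι n x := fun a => by
    unfold arriveLaw MDP.arriveProb
    split_ifs with h0 h1 h2 h2
    · rfl
    · simp at h1 h2; exact absurd h1 h2
    · simp at h1 h2; exact absurd h2 h1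
    · rfl
    · have hne : (⟨n.val - 1, lt_of_le_of_lt (Nat.sub_le _ _) n.isLt⟩ : Fin H) ≠ n := by
        intro h; have := congrArg Fin.val h; simp at this; omega
      simp [Function.update_of_ne hne]
  simp only [stepProb, h1, Function.update_self]
  have h2 := (π.2 n x).2
  calc _ = arriveLaw M ι n x * F x * ∑ a, π.1 n x a := by
        rw [Finset.mul_sum]; exact Finset.sum_congr rfl fun a _ => by ring
    _ = _ := by rw [h2, mul_one]

open Classical in
theorem arriveLaw_succ (M : MDP X A H) (ι : Traj X A H) {h : ℕ} (hh : h + 1 < H) (x : X) :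
    arriveLaw M ι ⟨h + 1, hh⟩ x =
      M.P ⟨h, by omega⟩ (ι ⟨h, by omega⟩).1 (ι ⟨h, by omega⟩).2 x := by
  unfold arriveLaw MDP.arriveProb
  simp

theorem sum_arriveLaw (M : MDP X A H) (ι : Traj X A H) (n : Fin H) :
    ∑ x, arriveLaw M ι n x = 1 := by
  classical
  obtain ⟨n, hn⟩ := n
  cases n with
  | zero => simp [arriveLaw, MDP.arriveProb]
  | succ n =>
    simp only [arriveLaw_succ M ι hn]
    exact (M.P_mem _ _ _).2

open Classical in
/-- Functions of the first `j` steps have the same expectation however the later steps are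
generated. -/
theorem expect_eq_expectUpto (M : MDP X A H) (π : Policy X A H) {j : ℕ} (hj : j ≤ H)
    {f : Traj X A H → ℝ}
    (hf : ∀ ι (n : Fin H) y, j ≤ n.val → f (Function.update ι n y) = f ι) :
    M.expect π f = expectUpto M π j f := by
  induction hi : H - j generalizing j with
  | zero => rw [show j = H by omega, expectUpto_self]
  | succ i ih =>
    have hjH : j < H := by omega
    rw [ih (j := j + 1) (by omega) (fun ι n y hn => hf ι n y (by omega)) (by omega)]
    rw [show j + 1 = (⟨j, hjH⟩ : Fin H).val + 1 from rfl, expectUpto_succ]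
    congr 1
    ext ι
    have h1 : ∀ y, f (Function.update ι ⟨j, hjH⟩ y) = f ι := fun y => hf _ _ _ le_rfl
    simp only [h1]
    have := sum_stepProb_update M π ι ⟨j, hjH⟩ fun _ => f ι
    rw [this, ← Finset.sum_mul, sum_arriveLaw, one_mul]

theorem expect_const (M : MDP X A H) (π : Policy X A H) (c : ℝ) :
    M.expect π (fun _ => c) = c := by
  classical
  have : Nonempty X := ⟨M.init⟩
  have hc : (Fintype.card (X × A) : ℝ) ≠ 0 := by exact_mod_cast Fintype.card_ne_zero
  rw [expect_eq_expectUpto M π (Nat.zero_le H) (fun _ _ _ _ => rfl)]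
  have hT : Fintype.card (Traj X A H) = Fintype.card (X × A) ^ H := by simp [Traj]
  simp only [expectUpto, Nat.not_lt_zero, Finset.filter_false, Finset.prod_empty, one_mul,
    Finset.sum_const, Finset.card_univ, hT, nsmul_eq_mul, Nat.sub_zero, Nat.cast_pow]
  field_simp

/-- The **Markov property** in expectation form. -/
theorem expect_next (M : MDP X A H) (π : Policy X A H) {h : ℕ} (hh : h + 1 < H)
    (F : X → A → X → ℝ) :
    M.expect π (fun ι => F (ι ⟨h, by omega⟩).1 (ι ⟨h, by omega⟩).2 (ι ⟨h + 1, hh⟩).1) =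
      M.expect π (fun ι => ∑ x', M.P ⟨h, by omega⟩ (ι ⟨h, by omega⟩).1 (ι ⟨h, by omega⟩).2 x' *
        F (ι ⟨h, by omega⟩).1 (ι ⟨h, by omega⟩).2 x') := by
  classical
  have hup : ∀ (ι : Traj X A H) (n : Fin H) y (m : Fin H), m.val < n.val →
      Function.update ι n y m = ι m := fun ι n y m hm =>
    Function.update_of_ne (Fin.ne_of_val_ne (by omega)) _ _
  -- The left integrand depends on the first `h + 2` steps and the right one on the first `h + 1`,
  -- so the two truncated expectations differ by a single application of `expectUpto_succ`.
  rw [expect_eq_expectUpto M π (j := h + 1 + 1) (by omega) ?_,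
    expect_eq_expectUpto M π (j := h + 1) (by omega) ?_]
  · rw [show h + 1 + 1 = (⟨h + 1, hh⟩ : Fin H).val + 1 from rfl, expectUpto_succ]
    congr 1
    ext ι
    have h1 : ∀ y, Function.update ι ⟨h + 1, hh⟩ y ⟨h, by omega⟩ = ι ⟨h, by omega⟩ := fun y =>
      hup _ _ _ _ (by simp)
    simp only [h1, Function.update_self]
    rw [sum_stepProb_update M π ι ⟨h + 1, hh⟩ (F _ _)]
    simp only [arriveLaw_succ]
  · intro ι n y hn
    simp only [hup ι n y ⟨h, by omega⟩ (by simp; omega)]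
  · intro ι n y hn
    simp only [hup ι n y ⟨h, by omega⟩ (by simp; omega),
      hup ι n y ⟨h + 1, by omega⟩ (by simp; omega)]

/-- One-step backup of a function of the next state. -/
def MDP.next (M : MDP X A H) (h : Fin H) (V : X → ℝ) (x : X) (a : A) : ℝ :=
  ∑ x', M.P h x a x' * V x'

/-- Telescoping decomposition of an initial value along trajectories. -/
theorem expect_sum_sub_next (M : MDP X A H) (π : Policy X A H) (hH : 0 < H) (V : ℕ → X → ℝ)
    (hV : V H = 0) :
    M.expect π (fun ι => ∑ h : Fin H, (V h (ι h).1 - M.next h (V (h + 1)) (ι h).1 (ι h).2)) =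
      V 0 M.init := by
  -- The value 0 beyond the horizon agrees with `V H = 0`, so the last step telescopes like the
  -- others.
  set a : ℕ → ℝ := fun j => if hj : j < H then M.expect π (fun ι => V j (ι ⟨j, hj⟩).1) else 0
    with ha
  have h1 : ∀ h : Fin H, M.expect π
      (fun ι => V h (ι h).1 - M.next h (V (h + 1)) (ι h).1 (ι h).2) = a h - a (h + 1) := by
    rintro ⟨h, hh⟩
    rw [expect_sub]
    congr 1
    · simp [ha, hh]
    · by_cases h2 : h + 1 < H
      · simp only [ha, h2, dif_pos]
        exact (expect_next M π h2 fun _ _ x' => V (h + 1) x').symm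
      · have h3 : h + 1 = H := by omega
        simp only [ha, h2, dif_neg, not_false_iff, MDP.next]
        simp [h3, hV, MDP.expect]
  rw [expect_sum]
  simp only [h1]
  rw [Fin.sum_univ_eq_sum_range (fun j => a j - a (j + 1)), Finset.sum_range_sub']
  simp only [ha, hH, dif_pos, lt_irrefl, dif_neg, not_false_iff, sub_zero]
  rw [expect_congr_of_support M π (g := fun _ => V 0 M.init), expect_const]
  intro ι h0
  rw [fst_eq_init_of_trajProb_ne_zero h0 hH]

/-- An optimal stochastic Markov policy exists. -/
theorem exists_value_eq_optValue (M : MDP X A H) :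
    ∃ π : Policy X A H, M.value π = M.optValue ∧ ∀ π', M.value π' ≤ M.value π := by
  classical
  -- Policies form a compact product of simplices on which the value is a polynomial, so the
  -- supremum is attained without Bellman's optimality equations. Attainment is what provides one
  -- fixed direction for optimism.
  set S : Set (Fin H → X → A → ℝ) := Set.pi Set.univ fun _ => Set.pi Set.univ fun _ => stdSimplex ℝ A
    with hS
  have hSc : IsCompact S :=
    isCompact_univ_pi fun _ => isCompact_univ_pi fun _ => isCompact_stdSimplex ℝ A
  have hmem : ∀ π, π ∈ S ↔ ∀ h x, π h x ∈ stdSimplex ℝ A := fun π => by simp [hS, Set.mem_pi]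
  set F : (Fin H → X → A → ℝ) → ℝ := fun π =>
    ∑ ι : Traj X A H, (∏ h, M.arriveProb ι h * π h (ι h).1 (ι h).2) *
      ∑ h, M.r h (ι h).1 (ι h).2 with hF
  have hFc : Continuous F := by fun_prop
  have hne : S.Nonempty :=
    ⟨(Policy.det fun _ _ => Classical.arbitrary A : Policy X A H).1, (hmem _).2 (Policy.det _).2⟩
  obtain ⟨p, hp, hmax⟩ := hSc.exists_isMaxOn hne hFc.continuousOn
  have hle : ∀ π' : Policy X A H, M.value π' ≤ M.value ⟨p, (hmem p).1 hp⟩ := fun π' =>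
    hmax ((hmem _).2 π'.2)
  refine ⟨⟨p, (hmem p).1 hp⟩, ?_, hle⟩
  have : Nonempty (Policy X A H) := ⟨⟨p, (hmem p).1 hp⟩⟩
  exact le_antisymm (le_ciSup (f := fun π => M.value π) ⟨_, Set.forall_mem_range.2 hle⟩ _)
    (ciSup_le hle)

/-- Expected growth of the self-normalized process over a transition. -/
theorem expect_selfNormFactor_le (M : MDP X A H) (π : Policy X A H) {h : ℕ} (hh : h + 1 < H)
    (b u : X → A → ℝ) (hu : ∀ x a, 0 ≤ u x a) (Y : X → A → X → ℝ) (hY : ∀ x a x', |Y x a x'| ≤ 1)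
    (hmean : ∀ x a, ∑ x', M.P ⟨h, by omega⟩ x a x' * Y x a x' = 0) :
    M.expect π (fun ι => selfNormFactor (b (ι ⟨h, by omega⟩).1 (ι ⟨h, by omega⟩).2)
      (u (ι ⟨h, by omega⟩).1 (ι ⟨h, by omega⟩).2)
      (Y (ι ⟨h, by omega⟩).1 (ι ⟨h, by omega⟩).2 (ι ⟨h + 1, hh⟩).1)) ≤ 1 := by
  refine (expect_mono M π fun ι => selfNormFactor_le_affine (hu _ _) (hY _ _ _)).trans ?_
  rw [expect_add, expect_const,
    expect_next M π hh fun x a x' => Y x a x' * selfNormSlope (b x a) (u x a)]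
  simp only [← mul_assoc, ← Finset.sum_mul, hmean, zero_mul, expect_const, add_zero, le_refl]

/-- The chord of the exponential over [−1, 1]. Being affine in `y`, it integrates to `cosh s` for
centred variables. -/
theorem exp_mul_le_cosh_add {y : ℝ} (s : ℝ) (hy : |y| ≤ 1) :
    Real.exp (s * y) ≤ Real.cosh s + y * Real.sinh s := by
  obtain ⟨hy1, hy2⟩ := abs_le.1 hy
  have := convexOn_exp.2 (Set.mem_univ s) (Set.mem_univ (-s))
    (by linarith : 0 ≤ (1 + y) / 2) (by linarith : 0 ≤ (1 - y) / 2) (by ring)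
  simp only [smul_eq_mul] at this
  rw [show (1 + y) / 2 * s + (1 - y) / 2 * -s = s * y by ring] at this
  rw [Real.cosh_eq, Real.sinh_eq]
  linarith

/-- **Hoeffding's lemma** for a function of the trajectory. -/
theorem expect_exp_le (M : MDP X A H) (π : Policy X A H) {f : Traj X A H → ℝ}
    (h0 : ∀ ι, 0 ≤ f ι) (h1 : ∀ ι, f ι ≤ 1) (s : ℝ) :
    M.expect π (fun ι => Real.exp (s * (M.expect π f - f ι))) ≤ Real.exp (s ^ 2 / 2) := by
  have e0 : 0 ≤ M.expect π f := by
    rw [← expect_const M π 0]; exact expect_mono M π h0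
  have e1 : M.expect π f ≤ 1 := by
    rw [← expect_const M π 1]; exact expect_mono M π h1
  refine (expect_mono M π fun ι => exp_mul_le_cosh_add s ?_).trans ?_
  · rw [abs_le]; constructor <;> linarith [h0 ι, h1 ι]
  · have : M.expect π (fun ι => Real.cosh s + (M.expect π f - f ι) * Real.sinh s) =
        Real.cosh s := by
      simp only [mul_comm _ (Real.sinh s)]
      rw [expect_add, expect_const, expect_const_mul, expect_sub, expect_const, sub_self]
      simp
    rw [this]
    exact Real.cosh_le_exp_half_sq s

end Trajectories

/-! ### Discrete random variables -/

section Discrete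

variable {Ω : Type*}

theorem measurable_top_of_singleton {β : Type*} [Countable β] {m : MeasurableSpace Ω} {f : Ω → β}
    (h : ∀ b, MeasurableSet[m] (f ⁻¹' {b})) : Measurable[m, ⊤] f := by
  intro s _
  have : f ⁻¹' s = ⋃ b ∈ s, f ⁻¹' {b} := by ext; simp
  rw [this]
  exact MeasurableSet.biUnion (Set.to_countable s) fun b _ => h b

theorem measurable_top_comp {β γ : Type*} {m : MeasurableSpace Ω} {mγ : MeasurableSpace γ}
    {f : Ω → β} (hf : Measurable[m, ⊤] f) (g : β → γ) : Measurable[m, mγ] fun ω => g (f ω) :=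
  fun s _ => hf (t := g ⁻¹' s) trivial

theorem measurable_top_prodMk {β γ : Type*} [Countable β] [Countable γ] {m : MeasurableSpace Ω}
    {f : Ω → β} {g : Ω → γ} (hf : Measurable[m, ⊤] f) (hg : Measurable[m, ⊤] g) :
    Measurable[m, ⊤] fun ω => (f ω, g ω) := by
  refine measurable_top_of_singleton fun b => ?_
  have : (fun ω => (f ω, g ω)) ⁻¹' {b} = f ⁻¹' {b.1} ∩ g ⁻¹' {b.2} := by
    ext; simp [Prod.ext_iff]
  rw [this]
  exact MeasurableSet.inter (hf trivial) (hg trivial)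

/-- A function of the first `k` members of a sequence of discrete random variables is
measurable. -/
theorem measurable_of_discrete_prefix {β γ : Type*} [Finite β] {m : MeasurableSpace Ω}
    {mγ : MeasurableSpace γ} {k : ℕ} {T : ℕ → Ω → β} (hT : ∀ τ < k, Measurable[m, ⊤] (T τ))
    {Φ : (ℕ → β) → γ} (hΦ : ∀ s t, (∀ τ < k, s τ = t τ) → Φ s = Φ t) :
    Measurable[m, mγ] fun ω => Φ fun τ => T τ ω := by
  rcases isEmpty_or_nonempty Ω with h | ⟨⟨ω₀⟩⟩
  · exact fun s _ => by
      have : (fun ω => Φ fun τ => T τ ω) ⁻¹' s = ∅ := Set.eq_empty_of_isEmpty _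
      rw [this]; exact MeasurableSet.empty
  · have h1 : Measurable[m, ⊤] fun ω => fun τ : Fin k => T τ ω := by
      refine measurable_top_of_singleton fun b => ?_
      have : (fun ω => fun τ : Fin k => T τ ω) ⁻¹' {b} = ⋂ τ : Fin k, T τ ⁻¹' {b τ} := by
        ext; simp [funext_iff]
      rw [this]
      exact MeasurableSet.iInter fun τ => hT τ τ.2 trivial
    -- Entries from `k` on are frozen at the values of an arbitrary `ω₀`; by `hΦ` they do not
    -- matter, and a function of finitely many discrete variables is left.
    have h2 : (fun ω => Φ fun τ => T τ ω) = fun ω =>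
        (fun t : Fin k → β => Φ fun τ => if h : τ < k then t ⟨τ, h⟩ else T τ ω₀)
          (fun τ : Fin k => T τ ω) := by
      ext ω
      exact hΦ _ _ fun τ h => by simp [h]
    rw [h2]
    exact measurable_top_comp h1
      (fun t : Fin k → β => Φ fun τ => if h : τ < k then t ⟨τ, h⟩ else T τ ω₀)

end Discrete

/-! ### Conditional expectations -/

section CondExp

variable {Ω : Type*} {m m0 : MeasurableSpace Ω} {μ : Measure Ω} [IsProbabilityMeasure μ]

theorem integrable_of_abs_le {f : Ω → ℝ} (hf : Measurable f) {c : ℝ} (hc : ∀ ω, |f ω| ≤ c) :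
    Integrable f μ :=
  Integrable.of_bound hf.aestronglyMeasurable c (ae_of_all _ hc)

theorem integral_mul_eq_integral_mul_condExp (hm : m ≤ m0) {f g : Ω → ℝ} (hf : Measurable[m] f)
    {c : ℝ} (hc : ∀ ω, |f ω| ≤ c) (hg : Integrable g μ) :
    ∫ ω, f ω * g ω ∂μ = ∫ ω, f ω * (μ[g | m]) ω ∂μ := by
  have h := condExp_stronglyMeasurable_mul_of_bound hm hf.stronglyMeasurable hg c
    (ae_of_all _ hc)
  rw [← integral_condExp hm (f := fun ω => f ω * g ω)]
  exact integral_congr_ae h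

/-- One step of the self-normalized supermartingale with a conditionally centred increment. -/
theorem integral_mul_selfNormFactor_le (hm : m ≤ m0) {W b u η : Ω → ℝ} (hW : Measurable[m] W)
    (hb : Measurable[m] b) (hu : Measurable[m] u) (hη : Measurable η) {c : ℝ}
    (hW0 : ∀ ω, 0 ≤ W ω) (hWc : ∀ ω, W ω ≤ c) (hu0 : ∀ ω, 0 ≤ u ω) (hη1 : ∀ ω, |η ω| ≤ 1)
    (hmean : μ[η | m] =ᵐ[μ] 0) :
    ∫ ω, W ω * selfNormFactor (b ω) (u ω) (η ω) ∂μ ≤ ∫ ω, W ω ∂μ := by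
  have hgm : Measurable fun ω => selfNormFactor (b ω) (u ω) (η ω) := by
    have := hb.mono hm le_rfl
    have := hu.mono hm le_rfl
    unfold selfNormFactor; fun_prop
  have hsm : Measurable[m] fun ω => selfNormSlope (b ω) (u ω) := by
    unfold selfNormSlope selfNormFactor; fun_prop
  have hWm := hW.mono hm le_rfl
  have hsm' := hsm.mono hm le_rfl
  have hc : 0 ≤ c := by
    have : Nonempty Ω := nonempty_of_isProbabilityMeasure μ
    exact (hW0 (Classical.arbitrary Ω)).trans (hWc _)
  have hWabs : ∀ ω, |W ω| ≤ c := fun ω => by rw [abs_of_nonneg (hW0 ω)]; exact hWc ω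
  have hWs : ∀ ω, |W ω * selfNormSlope (b ω) (u ω)| ≤ c * Real.exp (1 / 2) := fun ω => by
    rw [abs_mul]
    exact mul_le_mul (hWabs ω) (abs_selfNormSlope_le (hu0 ω) _) (abs_nonneg _) hc
  have hηi : Integrable η μ := integrable_of_abs_le hη hη1
  have hWi : Integrable W μ := integrable_of_abs_le hWm hWabs
  have hi2 : Integrable (fun ω => W ω * selfNormSlope (b ω) (u ω) * η ω) μ := by
    refine integrable_of_abs_le (by fun_prop) (c := c * Real.exp (1 / 2) * 1) fun ω => ?_
    rw [abs_mul]
    exact mul_le_mul (hWs ω) (hη1 ω) (abs_nonneg _) (by positivity)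
  -- The linear term of the affine bound disappears: its coefficient is bounded and measurable
  -- before the increment, whose conditional mean is 0.
  have h0 : ∫ ω, W ω * selfNormSlope (b ω) (u ω) * η ω ∂μ = 0 := by
    rw [integral_mul_eq_integral_mul_condExp (f := fun ω => W ω * selfNormSlope (b ω) (u ω)) hm
      (hW.mul hsm) hWs hηi, integral_congr_ae (g := fun _ => (0 : ℝ)), integral_zero]
    filter_upwards [hmean] with ω h
    rw [h]; simp
  calc _ ≤ ∫ ω, (W ω + W ω * selfNormSlope (b ω) (u ω) * η ω) ∂μ := by
        refine integral_mono ?_ (hWi.add hi2) fun ω => ?_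
        · refine integrable_of_abs_le (hWm.mul hgm) (c := c * Real.exp (1 / 2)) fun ω => ?_
          rw [abs_mul, abs_of_pos (selfNormFactor_pos (hu0 ω) _ _)]
          exact mul_le_mul (hWabs ω) (selfNormFactor_le (hu0 ω) (hη1 ω))
            (selfNormFactor_pos (hu0 ω) _ _).le hc
        · have := mul_le_mul_of_nonneg_left
            (selfNormFactor_le_affine (b := b ω) (hu0 ω) (hη1 ω)) (hW0 ω)
          simp only
          linarith
    _ = _ := by rw [integral_add hWi hi2, h0, add_zero]

/-- Integration of a function of a discrete random variable against its conditional law. -/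
theorem integral_le_of_condLaw {β : Type*} [Fintype β] (hm : m ≤ m0) {T : Ω → β}
    (hT : Measurable[m0, ⊤] T) {p : Ω → β → ℝ}
    (hp : ∀ i, μ⟦T ⁻¹' {i} | m⟧ =ᵐ[μ] fun ω => p ω i) {F : β → Ω → ℝ}
    (hF : ∀ i, Measurable[m] (F i)) {c : ℝ} (hFc : ∀ i ω, |F i ω| ≤ c) {G : Ω → ℝ}
    (hG : Integrable G μ) (hFG : ∀ ω, ∑ i, p ω i * F i ω ≤ G ω) :
    ∫ ω, F (T ω) ω ∂μ ≤ ∫ ω, G ω ∂μ := by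
  classical
  have hTi : ∀ i, MeasurableSet[m0] (T ⁻¹' {i}) := fun i => hT trivial
  have h1 : ∀ ω, F (T ω) ω = ∑ i, F i ω * (T ⁻¹' {i}).indicator (fun _ => (1 : ℝ)) ω := fun ω => by
    rw [Finset.sum_eq_single (T ω)]
    · simp
    · intro b _ hb; simp [hb.symm]
    · simp
  have hind : ∀ i, Integrable ((T ⁻¹' {i}).indicator fun _ => (1 : ℝ)) μ := fun i =>
    (integrable_const _).indicator (hTi i)
  have hFi : ∀ i, Integrable (fun ω => F i ω * (T ⁻¹' {i}).indicator (fun _ => (1 : ℝ)) ω) μ :=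
    fun i => (hind i).bdd_mul ((hF i).mono hm le_rfl).aestronglyMeasurable
      (ae_of_all _ fun ω => hFc i ω)
  have hpi : ∀ i, Integrable (fun ω => p ω i * F i ω) μ := fun i => by
    have : Integrable (fun ω => p ω i) μ := integrable_condExp.congr (hp i)
    simp only [mul_comm (p _ i)]
    exact this.bdd_mul ((hF i).mono hm le_rfl).aestronglyMeasurable
      (ae_of_all _ fun ω => hFc i ω)
  simp only [h1]
  rw [integral_finsetSum _ fun i _ => hFi i]
  calc _ = ∑ i, ∫ ω, p ω i * F i ω ∂μ := by
        refine Finset.sum_congr rfl fun i _ => ?_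
        rw [integral_mul_eq_integral_mul_condExp hm (hF i) (hFc i) (hind i)]
        refine integral_congr_ae ?_
        filter_upwards [hp i] with ω h
        rw [h, mul_comm]
    _ = ∫ ω, ∑ i, p ω i * F i ω ∂μ := (integral_finsetSum _ fun i _ => hpi i).symm
    _ ≤ _ := integral_mono (integrable_finsetSum _ fun i _ => hpi i) hG hFG

/-- A bound on conditional probabilities of discretely parametrized events. -/
theorem measureReal_le_of_hasCondLaw {β E : Type*} [Finite β] [MeasurableSpace E] (hm : m ≤ m0)
    {Z : Ω → E} {ν : Ω → Measure E} (hZm : Measurable Z) (hZ : HasCondLaw μ m Z ν) {T : Ω → β}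
    (hT : Measurable[m, ⊤] T) {B : β → Set E} (hB : ∀ i, MeasurableSet (B i)) {p : ℝ}
    (hp : ∀ ω, (ν ω).real (B (T ω)) ≤ p) :
    μ.real {ω | Z ω ∈ B (T ω)} ≤ p := by
  classical
  have := Fintype.ofFinite β
  have hTi : ∀ i, MeasurableSet[m] (T ⁻¹' {i}) := fun i => hT trivial
  have hZi : ∀ i, MeasurableSet (Z ⁻¹' B i) := fun i => hZm (hB i)
  -- The history enters only through the finitely many values of `T`. On each cell `T = i` the event
  -- is frozen, so the conditional law can be applied to a fixed set.
  have h1 : {ω | Z ω ∈ B (T ω)} = ⋃ i ∈ Finset.univ, (T ⁻¹' {i} ∩ Z ⁻¹' B i) := by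
    ext ω; simp
  rw [h1, measureReal_biUnion_finset]
  · calc _ ≤ ∑ i, ∫ ω in T ⁻¹' {i}, p ∂μ := by
          refine Finset.sum_le_sum fun i _ => ?_
          have h2 : μ.real (T ⁻¹' {i} ∩ Z ⁻¹' B i) =
              ∫ ω in T ⁻¹' {i}, (Z ⁻¹' B i).indicator (fun _ => (1 : ℝ)) ω ∂μ := by
            rw [setIntegral_indicator (hZi i)]; simp
          rw [h2, ← setIntegral_condExp hm ((integrable_const _).indicator (hZi i)) (hTi i)]
          refine setIntegral_mono_on_ae integrable_condExp.integrableOn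
            (integrable_const _).integrableOn (hm _ (hTi i)) ?_
          filter_upwards [hZ (B i) (hB i)] with ω h hω
          rw [h, ← show T ω = i from hω]
          exact hp ω
      _ = ∫ ω in ⋃ i ∈ Finset.univ, T ⁻¹' {i}, p ∂μ := by
          rw [integral_biUnion_finset _ (fun i _ => hm _ (hTi i))]
          · intro i _ j _ hij
            exact Disjoint.preimage _ (by simpa using hij)
          · exact fun i _ => (integrable_const _).integrableOn
      _ = p := by
          have : (⋃ i ∈ (Finset.univ : Finset β), T ⁻¹' {i}) = Set.univ := by ext; simp
          rw [this]; simp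
  · intro i _ j _ hij
    exact (Disjoint.preimage _ (by simpa using hij)).mono Set.inter_subset_left
      Set.inter_subset_left
  · exact fun i _ => (hm _ (hTi i)).inter (hZi i)

theorem measureReal_gt_le_of_integral_le_one {W : Ω → ℝ} (hW0 : ∀ ω, 0 ≤ W ω)
    (hWi : Integrable W μ) (h1 : ∫ ω, W ω ∂μ ≤ 1) {p : ℝ} (hp : 0 < p) :
    μ.real {ω | p⁻¹ < W ω} ≤ p := by
  have h := mul_meas_ge_le_integral_of_nonneg (ae_of_all μ hW0) hWi p⁻¹
  have h2 : μ.real {ω | p⁻¹ < W ω} ≤ μ.real {ω | p⁻¹ ≤ W ω} :=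
    measureReal_mono fun ω (hω : p⁻¹ < W ω) => hω.le
  have h3 : p⁻¹ * μ.real {ω | p⁻¹ ≤ W ω} ≤ 1 := h.trans h1
  rw [inv_mul_le_iff₀ hp, mul_one] at h3
  exact h2.trans h3

end CondExp

/-! ### Gaussian tail bounds -/

theorem exp_nine_eighths_lt : Real.exp (9 / 8) < 3.1 := by
  have h := Real.exp_one_lt_d9
  have h2 : Real.exp (9 / 8) ^ 8 = Real.exp 1 ^ 9 := by
    rw [← Real.exp_nat_mul, ← Real.exp_nat_mul]; norm_num
  refine lt_of_pow_lt_pow_left₀ 8 (by norm_num) ?_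
  rw [h2]
  calc Real.exp 1 ^ 9 < 2.7182818286 ^ 9 := by gcongr
    _ < _ := by norm_num

/-- The standard Gaussian exceeds one standard deviation with probability at least `1 / 9`. -/
theorem one_ninth_le_gaussianReal_Ici : 1 / 9 ≤ (gaussianReal 0 1).real (Set.Ici 1) := by
  have h1 : (gaussianReal 0 1).real (Set.Ici 1) = ∫ x in Set.Ici 1, gaussianPDFReal 0 1 x := by
    rw [measureReal_def, gaussianReal_apply_eq_integral 0 one_ne_zero,
      ENNReal.toReal_ofReal (integral_nonneg fun _ => gaussianPDFReal_nonneg _ _ _)]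
  have h2 : ∫ x in (1 : ℝ)..2, gaussianPDFReal 0 1 x ≤ ∫ x in Set.Ici 1, gaussianPDFReal 0 1 x := by
    rw [intervalIntegral.integral_of_le (by norm_num)]
    exact setIntegral_mono_set (integrable_gaussianPDFReal 0 1).integrableOn
      (ae_of_all _ fun _ => gaussianPDFReal_nonneg _ _ _)
      (ae_of_all _ fun x (hx : x ∈ Set.Ioc 1 2) => hx.1.le)
  have hpi : 0 < √(2 * Real.pi) := Real.sqrt_pos.2 (by positivity)
  set c : ℝ := (√(2 * Real.pi))⁻¹ * Real.exp (-(9 / 8)) with hc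
  have hc0 : 0 ≤ c := by positivity
  -- On [1, 2] the exponential is replaced by its tangent in the variable x² at x² = 9/4, giving the
  -- factor e^{−9/8} and the integral 23/24.
  have h3 : ∫ x in (1 : ℝ)..2, c * (1 - (x ^ 2 - 9 / 4) / 2) ≤
      ∫ x in (1 : ℝ)..2, gaussianPDFReal 0 1 x := by
    refine intervalIntegral.integral_mono_on (by norm_num)
      (Continuous.intervalIntegrable (by fun_prop) _ _)
      (integrable_gaussianPDFReal 0 1).intervalIntegrable fun x _ => ?_
    have he := Real.add_one_le_exp (-(x ^ 2 - 9 / 4) / 2)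
    have : gaussianPDFReal 0 1 x = c * Real.exp (-(x ^ 2 - 9 / 4) / 2) := by
      rw [hc, mul_assoc, ← Real.exp_add, gaussianPDFReal]
      simp only [NNReal.coe_one, mul_one, sub_zero]
      congr 2
      ring
    rw [this]
    exact mul_le_mul_of_nonneg_left (by linarith) hc0
  have h4 : ∫ x in (1 : ℝ)..2, c * (1 - (x ^ 2 - 9 / 4) / 2) = c * (23 / 24) := by
    rw [intervalIntegral.integral_const_mul]
    congr 1
    have : (fun x : ℝ => 1 - (x ^ 2 - 9 / 4) / 2) = fun x => 17 / 8 - 1 / 2 * x ^ 2 := by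
      ext; ring
    rw [this, intervalIntegral.integral_sub (by simp)
      (Continuous.intervalIntegrable (by fun_prop) _ _), intervalIntegral.integral_const_mul,
      integral_pow]
    norm_num
  -- Numerically √(2π) ≤ 2.6 and e^{9/8} < 3.1, and 23/(24 · 2.6 · 3.1) is about 0.119.
  have h5 : 1 / 9 ≤ c * (23 / 24) := by
    have hs : √(2 * Real.pi) ≤ 2.6 := by
      rw [Real.sqrt_le_left (by norm_num)]
      nlinarith [Real.pi_lt_d2]
    have : c = 1 / (√(2 * Real.pi) * Real.exp (9 / 8)) := by
      rw [hc, Real.exp_neg]; field_simp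
    rw [this, div_mul_eq_mul_div, div_le_div_iff₀ (by norm_num) (by positivity)]
    have := mul_le_mul hs exp_nine_eighths_lt.le (Real.exp_pos _).le (by norm_num)
    linarith
  linarith

/-- The strict inequality matters: for variance 0 the law is a point mass at 0 and the event is
null, so degenerate directions such as `u = 0` need no exception. -/
theorem gaussianReal_real_lt_sqrt_le (v : NNReal) :
    (gaussianReal 0 v).real (Set.Iio √(v : ℝ)) ≤ 8 / 9 := by
  rcases eq_or_ne v 0 with rfl | hv
  · simp [gaussianReal_zero_var, measureReal_def]; norm_num
  · have hs : 0 < √(v : ℝ) := Real.sqrt_pos.2 (by positivity)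
    have h := gaussianReal_map_const_mul (μ := 0) (v := 1) √(v : ℝ)
    have hv' : NNReal.mk (√(v : ℝ) ^ 2) (sq_nonneg _) * 1 = v := by
      ext; simp
    rw [mul_zero, hv'] at h
    rw [← h, map_measureReal_apply (by fun_prop) measurableSet_Iio]
    have h2 : (fun x => √(v : ℝ) * x) ⁻¹' Set.Iio √(v : ℝ) = (Set.Ici 1)ᶜ := by
      ext x
      simp only [Set.mem_preimage, Set.mem_Iio, Set.mem_compl_iff, Set.mem_Ici, not_le]
      exact mul_lt_iff_lt_one_right hs
    rw [h2, probReal_compl_eq_one_sub measurableSet_Ici]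
    linarith [one_ninth_le_gaussianReal_Ici]

/-- The weight exp(x²/4) halves the quadratic in the Gaussian density, leaving total mass √2. This
is the source of the tail √2^n e^{−t/4}. -/
theorem exp_sq_div_four_gaussian :
    Integrable (fun x : ℝ => Real.exp (x ^ 2 / 4)) (gaussianReal 0 1) ∧
      ∫ x, Real.exp (x ^ 2 / 4) ∂(gaussianReal 0 1) = √2 := by
  have he : (fun x : ℝ => gaussianPDFReal 0 1 x • Real.exp (x ^ 2 / 4)) =
      fun x => (√(2 * Real.pi))⁻¹ * Real.exp (-(1 / 4) * x ^ 2) := by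
    ext x
    rw [gaussianPDFReal, smul_eq_mul, mul_assoc, ← Real.exp_add]
    simp only [NNReal.coe_one, mul_one, sub_zero]
    congr 2
    ring
  constructor
  · rw [gaussianReal_of_var_ne_zero 0 one_ne_zero]
    rw [integrable_withDensity_iff_integrable_smul' (by fun_prop)
      (ae_of_all _ fun _ => gaussianPDF_lt_top)]
    simp only [toReal_gaussianPDF]
    rw [he]
    exact (integrable_exp_neg_mul_sq (by norm_num)).const_mul _
  · rw [integral_gaussianReal_eq_integral_smul one_ne_zero, he, integral_const_mul,
      integral_gaussian, ← Real.sqrt_inv, ← Real.sqrt_mul (by positivity)]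
    congr 1
    field_simp
    norm_num

/-! ### Gaussian vectors and ensembles of them -/

section

variable {n : Type*} [Fintype n]

theorem stdGaussian_real_norm_sq_gt_le (t : ℝ) :
    (stdGaussian (EuclideanSpace ℝ n)).real {g | t < ‖g‖ ^ 2} ≤
      √2 ^ Fintype.card n * Real.exp (-(t / 4)) := by
  have hset : MeasurableSet {g : EuclideanSpace ℝ n | t < ‖g‖ ^ 2} :=
    measurableSet_lt measurable_const (by fun_prop)
  have htl : Measurable (WithLp.toLp 2 : (n → ℝ) → EuclideanSpace ℝ n) := by fun_prop
  rw [← map_pi_eq_stdGaussian, map_measureReal_apply htl hset]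
  set ν := Measure.pi fun _ : n => gaussianReal 0 1
  have hprod : ∀ x : n → ℝ, Real.exp (‖WithLp.toLp 2 x‖ ^ 2 / 4) = ∏ i, Real.exp (x i ^ 2 / 4) :=
    fun x => by
      rw [← Real.exp_sum, norm_toLp_sq, dotProduct, Finset.sum_div]
      simp [sq]
  have hint : Integrable (fun x : n → ℝ => ∏ i, Real.exp (x i ^ 2 / 4)) ν :=
    Integrable.fintype_prod (f := fun _ (x : ℝ) => Real.exp (x ^ 2 / 4))
      fun _ => exp_sq_div_four_gaussian.1
  have h := mul_meas_ge_le_integral_of_nonneg (ae_of_all ν fun x : n → ℝ =>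
    (Finset.prod_nonneg fun i _ => (Real.exp_pos (x i ^ 2 / 4)).le)) hint (Real.exp (t / 4))
  rw [integral_fintype_prod_eq_pow fun x : ℝ => Real.exp (x ^ 2 / 4),
    exp_sq_div_four_gaussian.2] at h
  have h2 : ν.real ((WithLp.toLp 2) ⁻¹' {g : EuclideanSpace ℝ n | t < ‖g‖ ^ 2}) ≤
      ν.real {x | Real.exp (t / 4) ≤ ∏ i, Real.exp (x i ^ 2 / 4)} := by
    refine measureReal_mono fun x (hx : t < ‖WithLp.toLp 2 x‖ ^ 2) => ?_
    rw [Set.mem_ofPred_eq, ← hprod]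
    exact Real.exp_le_exp.2 (by linarith)
  rw [Real.exp_neg, ← div_eq_mul_inv, le_div_iff₀ (Real.exp_pos _), mul_comm]
  exact (mul_le_mul_of_nonneg_left h2 (Real.exp_pos _).le).trans h

variable [DecidableEq n]

-- Writing z = S^{1/2} g with g standard turns zᵀS⁻¹z into ‖g‖².
open scoped MatrixOrder in
theorem multivariateGaussian_real_inv_gt {S : Matrix n n ℝ} (hS : S.PosDef) (t : ℝ) :
    (multivariateGaussian 0 S).real {z | t < z ⬝ᵥ S⁻¹ *ᵥ z} ≤
      √2 ^ Fintype.card n * Real.exp (-(t / 4)) := by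
  obtain ⟨R, hR, hRT, hRR⟩ := exists_sqrt_posSemidef hS.posSemidef
  have hdet : IsUnit R.det := by
    have : R.det * R.det = S.det := by rw [← det_mul, hRR]
    refine isUnit_iff_ne_zero.2 fun h => hS.det_pos.ne' ?_
    rw [← this, h, zero_mul]
  have hset : MeasurableSet {z : EuclideanSpace ℝ n | t < z ⬝ᵥ S⁻¹ *ᵥ z} := by
    refine measurableSet_lt measurable_const (Continuous.measurable ?_)
    simp only [dotProduct, mulVec]
    fun_prop
  rw [multivariateGaussian, map_measureReal_apply (by fun_prop) hset]
  refine le_of_eq_of_le (congrArg _ ?_) (stdGaussian_real_norm_sq_gt_le t)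
  ext g
  have h1 : ((0 : EuclideanSpace ℝ n) + toEuclideanCLM (𝕜 := ℝ) (CFC.sqrt S) g).ofLp =
      R *ᵥ g.ofLp := by
    rw [zero_add, ← hR, ofLp_toEuclideanCLM]
  have h2 : S⁻¹ *ᵥ R *ᵥ g.ofLp = R⁻¹ *ᵥ g.ofLp := by
    rw [← hRR, Matrix.mul_inv_rev, mulVec_mulVec, Matrix.mul_assoc, nonsing_inv_mul _ hdet,
      Matrix.mul_one]
  simp only [Set.mem_preimage, Set.mem_ofPred_eq]
  rw [h1, h2, dotProduct_comm, dotProduct_mulVec, ← mulVec_transpose, hRT, mulVec_mulVec,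
    mul_nonsing_inv _ hdet, one_mulVec, norm_euclidean_sq]

theorem map_dotProduct_multivariateGaussian {S : Matrix n n ℝ} (hS : S.PosSemidef) (u : n → ℝ) :
    (multivariateGaussian 0 S).map (fun z : EuclideanSpace ℝ n => u ⬝ᵥ z) =
      gaussianReal 0 (u ⬝ᵥ S *ᵥ u).toNNReal := by
  have h0 : (fun z : EuclideanSpace ℝ n => u ⬝ᵥ z) = innerSL ℝ (WithLp.toLp 2 u) := by
    ext z
    simp [EuclideanSpace.inner_eq_star_dotProduct, dotProduct_comm]
  rw [h0, IsGaussian.map_eq_gaussianReal, ContinuousLinearMap.integral_comp_id_comm,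
    integral_id_multivariateGaussian, map_zero]
  · congr 2
    have := covarianceBilin_multivariateGaussian (μ := 0) hS (WithLp.toLp 2 u) (WithLp.toLp 2 u)
    rw [covarianceBilin_self IsGaussian.memLp_two_id] at this
    exact this
  · exact IsGaussian.integrable_id

theorem multivariateGaussian_real_dotProduct_lt_le {S : Matrix n n ℝ} (hS : S.PosSemidef)
    (u : n → ℝ) : (multivariateGaussian 0 S).real {z | u ⬝ᵥ z < √(u ⬝ᵥ S *ᵥ u)} ≤ 8 / 9 := by
  have h := gaussianReal_real_lt_sqrt_le (u ⬝ᵥ S *ᵥ u).toNNReal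
  have hn : 0 ≤ u ⬝ᵥ S *ᵥ u := by simpa using hS.dotProduct_mulVec_nonneg u
  rw [← map_dotProduct_multivariateGaussian hS, map_measureReal_apply ?_ measurableSet_Iio,
    Real.coe_toNNReal _ hn] at h
  · exact h
  · refine Continuous.measurable ?_
    simp only [dotProduct]
    fun_prop

/-- Some member of an ensemble of Gaussian vectors has a large weighted norm. -/
theorem pi_multivariateGaussian_exists_gt_le {S : Matrix n n ℝ} (hS : S.PosDef) (m : ℕ) (t : ℝ) :
    (Measure.pi fun _ : Fin m => multivariateGaussian 0 S).real
      {z | ∃ i, t < z i ⬝ᵥ S⁻¹ *ᵥ z i} ≤ m * (√2 ^ Fintype.card n * Real.exp (-(t / 4))) := by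
  have hset : MeasurableSet {z : EuclideanSpace ℝ n | t < z ⬝ᵥ S⁻¹ *ᵥ z} := by
    refine measurableSet_lt measurable_const (Continuous.measurable ?_)
    simp only [dotProduct, mulVec]
    fun_prop
  have h1 : {z : Fin m → EuclideanSpace ℝ n | ∃ i, t < z i ⬝ᵥ S⁻¹ *ᵥ z i} =
      ⋃ i, Function.eval i ⁻¹' {z : EuclideanSpace ℝ n | t < z ⬝ᵥ S⁻¹ *ᵥ z} := by ext; simp
  rw [h1]
  refine (measureReal_iUnion_fintype_le _).trans ?_
  calc _ ≤ ∑ _i : Fin m, √2 ^ Fintype.card n * Real.exp (-(t / 4)) := by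
        refine Finset.sum_le_sum fun i _ => ?_
        rw [(measurePreserving_eval (fun _ : Fin m => multivariateGaussian 0 S) i).measureReal_preimage
          hset.nullMeasurableSet]
        exact multivariateGaussian_real_inv_gt hS t
    _ = _ := by simp

/-- No member of an ensemble of Gaussian vectors exceeds one standard deviation in a given
direction. -/
theorem pi_multivariateGaussian_forall_lt_le {S : Matrix n n ℝ} (hS : S.PosSemidef) (m : ℕ)
    (u : n → ℝ) :
    (Measure.pi fun _ : Fin m => multivariateGaussian 0 S).real
      {z | ∀ i, u ⬝ᵥ z i < √(u ⬝ᵥ S *ᵥ u)} ≤ (8 / 9) ^ m := by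
  have h1 : {z : Fin m → EuclideanSpace ℝ n | ∀ i, u ⬝ᵥ z i < √(u ⬝ᵥ S *ᵥ u)} =
      Set.univ.pi fun _ => {z : EuclideanSpace ℝ n | u ⬝ᵥ z < √(u ⬝ᵥ S *ᵥ u)} := by ext; simp
  rw [h1, measureReal_def, Measure.pi_pi, ENNReal.toReal_prod]
  refine (Finset.prod_le_prod (fun _ _ => ENNReal.toReal_nonneg) fun i _ =>
    multivariateGaussian_real_dotProduct_lt_le hS u).trans ?_
  simp [div_pow]

end

/-! ### The filtration of a run -/

section Run

variable {Ω X A : Type*} [mΩ : MeasurableSpace Ω] [Fintype X] [Fintype A] [Nonempty A] {H d : ℕ}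
  {μ : Measure Ω} {M : MDP X A H} {φ : X → A → EuclideanSpace ℝ (Fin d)} {prm : Params} {K : ℕ}
  {R : Interaction Ω X A H d prm.m}

theorem IsRELSVIRun.planInfo_le (hR : IsRELSVIRun μ M φ prm K R) {k : ℕ} (hk : k < K) :
    R.planInfo k ≤ mΩ :=
  sup_le (sup_le (hR.noise_meas k hk).comap_le (hR.policy_meas k hk).comap_le)
    (hR.leader_meas k hk).comap_le

theorem IsRELSVIRun.before_le (hR : IsRELSVIRun μ M φ prm K R) {k : ℕ} (hk : k ≤ K) :
    R.before k ≤ mΩ :=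
  iSup₂_le fun τ hτ => by
    have hτK : τ < K := (Finset.mem_range.1 hτ).trans_le hk
    exact sup_le (sup_le (hR.planInfo_le hτK) (hR.traj_meas τ hτK).comap_le)
      (hR.reward_meas τ hτK).comap_le

theorem IsRELSVIRun.planned_le (hR : IsRELSVIRun μ M φ prm K R) {k : ℕ} (hk : k < K) :
    R.planned k ≤ mΩ :=
  sup_le (hR.before_le hk.le) (hR.planInfo_le hk)

theorem IsRELSVIRun.observed_le (hR : IsRELSVIRun μ M φ prm K R) {k : ℕ} (hk : k < K) :
    R.observed k ≤ mΩ :=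
  sup_le (hR.planned_le hk) (hR.traj_meas k hk).comap_le

theorem le_before (R : Interaction Ω X A H d prm.m) {τ k : ℕ} (h : τ < k) :
    R.planInfo τ ⊔ MeasurableSpace.comap (R.traj τ) ⊤ ⊔
      MeasurableSpace.comap (R.reward τ) inferInstance ≤ R.before k :=
  le_iSup₂_of_le τ (Finset.mem_range.2 h) le_rfl

theorem measurable_traj_before (R : Interaction Ω X A H d prm.m) {τ k : ℕ} (h : τ < k) :
    Measurable[R.before k, ⊤] (R.traj τ) :=
  measurable_iff_comap_le.2 ((le_sup_right.trans le_sup_left).trans (le_before R h))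

theorem measurable_reward_before (R : Interaction Ω X A H d prm.m) {τ k : ℕ} (h : τ < k) :
    Measurable[R.before k] (R.reward τ) :=
  measurable_iff_comap_le.2 (le_sup_right.trans (le_before R h))

theorem measurable_aggReward_before (R : Interaction Ω X A H d prm.m) {τ k : ℕ} (h : τ < k) :
    Measurable[R.before k] (R.aggReward τ) := by
  have := measurable_reward_before R h
  unfold Interaction.aggReward
  fun_prop

theorem measurable_played_of_planInfo_le (R : Interaction Ω X A H d prm.m) {k : ℕ}
    {m : MeasurableSpace Ω} (h : R.planInfo k ≤ m) : Measurable[m, ⊤] (R.played k) := by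
  have h1 : Measurable[m, ⊤] (R.policy k) :=
    measurable_iff_comap_le.2 ((le_sup_right.trans le_sup_left).trans h)
  have h2 : Measurable[m, ⊤] (R.leader k) := measurable_iff_comap_le.2 (le_sup_right.trans h)
  exact measurable_top_comp (measurable_top_prodMk h1 h2)
    fun p : (Fin prm.m → Fin H → X → A) × Fin prm.m => p.1 p.2

theorem measurable_played_before (R : Interaction Ω X A H d prm.m) {τ k : ℕ} (h : τ < k) :
    Measurable[R.before k, ⊤] (R.played τ) :=
  measurable_played_of_planInfo_le R ((le_sup_left.trans le_sup_left).trans (le_before R h))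

theorem measurable_played_planned (R : Interaction Ω X A H d prm.m) (k : ℕ) :
    Measurable[R.planned k, ⊤] (R.played k) :=
  measurable_played_of_planInfo_le R le_sup_right

theorem measurable_traj_observed (R : Interaction Ω X A H d prm.m) {τ k : ℕ} (h : τ ≤ k) :
    Measurable[R.observed k, ⊤] (R.traj τ) := by
  rcases h.lt_or_eq with h | rfl
  · exact (measurable_traj_before R h).mono (le_sup_left.trans le_sup_left) le_rfl
  · exact measurable_iff_comap_le.2 le_sup_right

variable [IsProbabilityMeasure μ]

/-! ### Concentration of the aggregate rewards -/

/-- The normalized noise of the aggregate reward of episode `k`. -/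
def rewardNoise (M : MDP X A H) (R : Interaction Ω X A H d prm.m) (k : ℕ) (ω : Ω) : ℝ :=
  (R.aggReward k ω - ∑ h, M.r h (R.traj k ω h).1 (R.traj k ω h).2) / H

theorem IsRELSVIRun.abs_rewardNoise_le (hR : IsRELSVIRun μ M φ prm K R) (hH : 1 ≤ H) {k : ℕ}
    (hk : k < K) (ω : Ω) : |rewardNoise M R k ω| ≤ 1 := by
  have hH' : (0 : ℝ) < H := by exact_mod_cast hH
  rw [rewardNoise, abs_div, abs_of_pos hH', div_le_one hH', Interaction.aggReward,
    ← Finset.sum_sub_distrib]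
  refine (Finset.abs_sum_le_sum_abs _ _).trans ?_
  calc _ ≤ ∑ _h : Fin H, (1 : ℝ) := Finset.sum_le_sum fun h _ => by
        have h1 := hR.reward_mem k hk ω h
        have h2 := M.r_mem h (R.traj k ω h).1 (R.traj k ω h).2
        rw [abs_le]
        constructor <;> linarith [h1.1, h1.2, h2.1, h2.2]
    _ = H := by simp

theorem IsRELSVIRun.measurable_rewardNoise (_hR : IsRELSVIRun μ M φ prm K R) {τ k : ℕ}
    (h : τ < k) : Measurable[R.before k] (rewardNoise M R τ) := by
  have h1 := measurable_aggReward_before R h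
  have h2 : Measurable[R.before k] fun ω => ∑ h, M.r h (R.traj τ ω h).1 (R.traj τ ω h).2 :=
    measurable_top_comp (measurable_traj_before R h) fun ι => ∑ h, M.r h (ι h).1 (ι h).2
  exact (h1.sub h2).div_const _

theorem IsRELSVIRun.condExp_rewardNoise (hR : IsRELSVIRun μ M φ prm K R) {k : ℕ} (hk : k < K) :
    μ[rewardNoise M R k | R.observed k] =ᵐ[μ] 0 := by
  have hm := hR.observed_le hk
  have hri : ∀ h, Integrable (fun ω => R.reward k ω h) μ := fun h =>
    integrable_of_abs_le ((measurable_pi_apply h).comp (hR.reward_meas k hk)) (c := 1) fun ω => by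
      have := hR.reward_mem k hk ω h
      rw [abs_le]; constructor <;> linarith [this.1, this.2]
  have hMm : ∀ h, Measurable[R.observed k] fun ω => M.r h (R.traj k ω h).1 (R.traj k ω h).2 :=
    fun h => measurable_top_comp (measurable_traj_observed R le_rfl)
      fun ι => M.r h (ι h).1 (ι h).2
  have hMi : ∀ h, Integrable (fun ω => M.r h (R.traj k ω h).1 (R.traj k ω h).2) μ := fun h =>
    integrable_of_abs_le ((hMm h).mono hm le_rfl) (c := 1) fun ω => by
      have := M.r_mem h (R.traj k ω h).1 (R.traj k ω h).2
      rw [abs_le]; constructor <;> linarith [this.1, this.2]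
  have he : rewardNoise M R k = (H : ℝ)⁻¹ •
      ∑ h, ((fun ω => R.reward k ω h) - fun ω => M.r h (R.traj k ω h).1 (R.traj k ω h).2) := by
    ext ω
    simp only [rewardNoise, Interaction.aggReward, Pi.smul_apply, Finset.sum_apply, Pi.sub_apply,
      Finset.sum_sub_distrib, smul_eq_mul]
    ring
  rw [he]
  refine (condExp_smul _ _ _).trans ?_
  have h1 := condExp_finsetSum (μ := μ) (s := Finset.univ) (m := R.observed k)
    (fun h _ => (hri h).sub (hMi h))
  have h2 : ∀ h, μ[(fun ω => R.reward k ω h) -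
      fun ω => M.r h (R.traj k ω h).1 (R.traj k ω h).2 | R.observed k] =ᵐ[μ] 0 := fun h => by
    refine (condExp_sub (hri h) (hMi h) _).trans ?_
    have h3 := condExp_of_stronglyMeasurable hm (hMm h).stronglyMeasurable (hMi h)
    filter_upwards [hR.reward_mean k hk h] with ω h4
    rw [Pi.sub_apply, h3, h4]
    simp
  have h5 : ∀ᵐ ω ∂μ, ∀ h, μ[(fun ω => R.reward k ω h) -
      fun ω => M.r h (R.traj k ω h).1 (R.traj k ω h).2 | R.observed k] ω = 0 :=
    ae_all_iff.2 h2
  filter_upwards [h1, h5] with ω h6 h7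
  rw [Pi.smul_apply, h6, Finset.sum_apply]
  simp [h7]

theorem aggCov_eq (φ : X → A → EuclideanSpace ℝ (Fin d)) (lam : ℝ) (ι : ℕ → Traj X A H) (k : ℕ) :
    aggCov φ lam ι k = regCov lam (fun τ => aggFeat φ (ι τ)) k := rfl

theorem regCov_congr {n : Type*} [DecidableEq n] {lam : ℝ} {f g : ℕ → n → ℝ} {k : ℕ}
    (h : ∀ τ < k, f τ = g τ) : regCov lam f k = regCov lam g k := by
  rw [regCov, regCov]
  congr 1
  exact Finset.sum_congr rfl fun τ hτ => by rw [h τ (Finset.mem_range.1 hτ)]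

/-- The self-normalized process of the aggregate rewards. -/
def rewardProc (M : MDP X A H) (φ : X → A → EuclideanSpace ℝ (Fin d)) (lam : ℝ)
    (R : Interaction Ω X A H d prm.m) (k : ℕ) (ω : Ω) : ℝ :=
  selfNormProc lam (fun τ => aggFeat φ (R.traj τ ω)) (fun τ => rewardNoise M R τ ω) k

/-- Past rewards are not discrete, so `measurable_of_discrete_prefix` cannot be applied to the whole
coefficient. It is linear in the reward noises, with weights depending only on trajectories, and
those are discrete. -/
theorem IsRELSVIRun.measurable_reward_coef (hR : IsRELSVIRun μ M φ prm K R) (lam : ℝ) {k : ℕ}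
    (_hk : k < K) : Measurable[R.observed k] fun ω => selfNormCoef lam
      (fun τ => aggFeat φ (R.traj τ ω)) (fun τ => rewardNoise M R τ ω) k := by
  have h0 : ∀ ω, selfNormCoef lam (fun τ => aggFeat φ (R.traj τ ω))
      (fun τ => rewardNoise M R τ ω) k = ∑ τ ∈ Finset.range k, rewardNoise M R τ ω *
        (aggFeat φ (R.traj k ω) ⬝ᵥ (regCov lam (fun τ => aggFeat φ (R.traj τ ω)) k)⁻¹ *ᵥ
          aggFeat φ (R.traj τ ω)) := fun ω => by
    rw [selfNormCoef, mulVec_sum, dotProduct_sum]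
    exact Finset.sum_congr rfl fun τ _ => by rw [mulVec_smul, dotProduct_smul, smul_eq_mul]
  simp only [h0]
  refine Finset.measurable_sum _ fun τ hτ => Measurable.mul ?_ ?_
  · exact (hR.measurable_rewardNoise (Finset.mem_range.1 hτ)).mono
      (le_sup_left.trans le_sup_left) le_rfl
  · refine measurable_of_discrete_prefix (k := k + 1) (T := R.traj)
      (Φ := fun s => aggFeat φ (s k) ⬝ᵥ (regCov lam (fun τ => aggFeat φ (s τ)) k)⁻¹ *ᵥ
          aggFeat φ (s τ)) (fun τ hτ => measurable_traj_observed R (Nat.lt_succ_iff.1 hτ)) ?_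
    intro s t hst
    rw [hst k (Nat.lt_succ_self k), hst τ ((Finset.mem_range.1 hτ).trans (Nat.lt_succ_self k)),
      regCov_congr fun τ' hτ' => by rw [hst τ' (hτ'.trans (Nat.lt_succ_self k))]]

theorem IsRELSVIRun.measurable_reward_norm (_hR : IsRELSVIRun μ M φ prm K R) (lam : ℝ) (k : ℕ) :
    Measurable[R.observed k] fun ω => wnorm (regCov lam (fun τ => aggFeat φ (R.traj τ ω)) k)⁻¹
      (aggFeat φ (R.traj k ω)) ^ 2 := by
  refine measurable_of_discrete_prefix (k := k + 1) (T := R.traj)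
    (Φ := fun s => wnorm (regCov lam (fun τ => aggFeat φ (s τ)) k)⁻¹ (aggFeat φ (s k)) ^ 2)
    (fun τ hτ => measurable_traj_observed R (Nat.lt_succ_iff.1 hτ)) ?_
  intro s t hst
  rw [hst k (Nat.lt_succ_self k),
    regCov_congr fun τ' hτ' => by rw [hst τ' (hτ'.trans (Nat.lt_succ_self k))]]

theorem observed_le_before (R : Interaction Ω X A H d prm.m) {τ k : ℕ} (h : τ < k) :
    R.observed τ ≤ R.before k := by
  refine sup_le (sup_le ?_ ((le_sup_left.trans le_sup_left).trans (le_before R h)))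
    ((le_sup_right.trans le_sup_left).trans (le_before R h))
  exact iSup₂_le fun σ hσ => le_before R ((Finset.mem_range.1 hσ).trans h)

theorem IsRELSVIRun.measurable_rewardProc (hR : IsRELSVIRun μ M φ prm K R) (lam : ℝ) {k : ℕ}
    (hk : k ≤ K) : Measurable[R.before k] (rewardProc M φ lam R k) := by
  unfold rewardProc selfNormProc
  refine Finset.measurable_prod _ fun τ hτ => ?_
  have hτ' := Finset.mem_range.1 hτ
  have h1 := (hR.measurable_reward_coef lam (hτ'.trans_le hk)).mono
    (observed_le_before R hτ') le_rfl
  have h2 := (hR.measurable_reward_norm lam τ).mono (observed_le_before R hτ') le_rfl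
  have h3 := hR.measurable_rewardNoise (M := M) hτ'
  simp only [selfNormFactor]
  fun_prop

/-- Conditioning takes place after the trajectory of episode `k` and before its rewards: the
aggregate feature is then known while the noise is still centred. -/
theorem IsRELSVIRun.integral_rewardProc_le (hR : IsRELSVIRun μ M φ prm K R) (hH : 1 ≤ H)
    (lam : ℝ) {k : ℕ} (hk : k ≤ K) : ∫ ω, rewardProc M φ lam R k ω ∂μ ≤ 1 := by
  induction k with
  | zero => simp [rewardProc, selfNormProc]
  | succ k ih =>
    refine le_trans ?_ (ih (by omega))
    have hm := hR.observed_le (show k < K by omega)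
    have h := integral_mul_selfNormFactor_le (μ := μ) hm (W := rewardProc M φ lam R k)
      (b := fun ω => selfNormCoef lam (fun τ => aggFeat φ (R.traj τ ω))
        (fun τ => rewardNoise M R τ ω) k)
      (u := fun ω => wnorm (regCov lam (fun τ => aggFeat φ (R.traj τ ω)) k)⁻¹
        (aggFeat φ (R.traj k ω)) ^ 2) (η := rewardNoise M R k) (c := Real.exp (1 / 2) ^ k)
      ((hR.measurable_rewardProc lam (by omega)).mono (le_sup_left.trans le_sup_left) le_rfl)
      (hR.measurable_reward_coef lam (by omega)) (hR.measurable_reward_norm lam k)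
      ((hR.measurable_rewardNoise (Nat.lt_succ_self k)).mono (hR.before_le hk) le_rfl)
      (fun ω => (selfNormProc_pos _ _ _).le)
      (fun ω => selfNormProc_le _ _ _ fun τ hτ => hR.abs_rewardNoise_le hH (by omega) ω)
      (fun ω => sq_nonneg _) (hR.abs_rewardNoise_le hH (by omega))
      (hR.condExp_rewardNoise (by omega))
    refine le_of_eq_of_le ?_ h
    simp only [rewardProc, selfNormProc, Finset.prod_range_succ]

/-- Markov's inequality at each fixed `k` and a union over the episodes suffice; no maximal
inequality is used, at the price of the factor `K`. -/
theorem IsRELSVIRun.measureReal_rewardProc (hR : IsRELSVIRun μ M φ prm K R) (hH : 1 ≤ H)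
    (lam : ℝ) {p : ℝ} (hp : 0 < p) :
    μ.real {ω | ∃ k < K, p⁻¹ < rewardProc M φ lam R k ω} ≤ K * p := by
  have h1 : {ω | ∃ k < K, p⁻¹ < rewardProc M φ lam R k ω} =
      ⋃ k ∈ Finset.range K, {ω | p⁻¹ < rewardProc M φ lam R k ω} := by ext; simp
  rw [h1]
  refine (measureReal_biUnion_finset_le _ _).trans ?_
  calc _ ≤ ∑ k ∈ Finset.range K, p := Finset.sum_le_sum fun k hk => by
        have hk := (Finset.mem_range.1 hk)
        refine measureReal_gt_le_of_integral_le_one (fun ω => (selfNormProc_pos _ _ _).le)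
          (integrable_of_abs_le ((hR.measurable_rewardProc lam hk.le).mono (hR.before_le hk.le)
            le_rfl) (c := Real.exp (1 / 2) ^ k) fun ω => ?_)
          (hR.integral_rewardProc_le hH lam hk.le) hp
        rw [abs_of_pos (selfNormProc_pos _ _ _)]
        exact selfNormProc_le _ _ _ fun τ hτ => hR.abs_rewardNoise_le hH (by omega) ω
    _ = _ := by simp

/-! ### Concentration of the transitions -/

/-- The normalized deviation of a function of the next state from its mean. -/
def nextNoise (M : MDP X A H) (h : Fin H) (V : X → ℝ) (B : ℝ) (ι : Traj X A H) : ℝ :=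
  (nextVal ι h V - M.next h V (ι h).1 (ι h).2) / (2 * B)

theorem abs_next_le (M : MDP X A H) (h : Fin H) {V : X → ℝ} {B : ℝ} (hV : ∀ x, |V x| ≤ B) (x : X)
    (a : A) : |M.next h V x a| ≤ B := by
  have hP := M.P_mem h x a
  calc _ ≤ ∑ x', |M.P h x a x' * V x'| := Finset.abs_sum_le_sum_abs _ _
    _ ≤ ∑ x', M.P h x a x' * B := Finset.sum_le_sum fun x' _ => by
        rw [abs_mul, abs_of_nonneg (hP.1 x')]
        exact mul_le_mul_of_nonneg_left (hV x') (hP.1 x')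
    _ = B := by rw [← Finset.sum_mul, hP.2, one_mul]

theorem abs_nextVal_le (ι : Traj X A H) (h : Fin H) {V : X → ℝ} {B : ℝ} (hB : 0 ≤ B)
    (hV : ∀ x, |V x| ≤ B) : |nextVal ι h V| ≤ B := by
  unfold nextVal
  split_ifs
  · exact hV _
  · simpa using hB

theorem abs_nextNoise_le (M : MDP X A H) (h : Fin H) {V : X → ℝ} {B : ℝ} (hB : 0 < B)
    (hV : ∀ x, |V x| ≤ B) (ι : Traj X A H) : |nextNoise M h V B ι| ≤ 1 := by
  rw [nextNoise, abs_div, abs_of_pos (by linarith : 0 < 2 * B), div_le_one (by linarith)]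
  have h1 := abs_nextVal_le ι h hB.le hV
  have h2 := abs_next_le M h hV (ι h).1 (ι h).2
  exact (abs_sub _ _).trans (by linarith)

/-- The self-normalized process of the transitions of step `h` for a fixed value function. -/
def nextProc (M : MDP X A H) (φ : X → A → EuclideanSpace ℝ (Fin d)) (lam : ℝ) (h : Fin H)
    (V : X → ℝ) (B : ℝ) (ι : ℕ → Traj X A H) (k : ℕ) : ℝ :=
  selfNormProc lam (fun τ => (φ (ι τ h).1 (ι τ h).2 : Fin d → ℝ))
    (fun τ => nextNoise M h V B (ι τ)) k

theorem selfNormCoef_congr {n : Type*} [Fintype n] [DecidableEq n] {lam : ℝ} {f g : ℕ → n → ℝ}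
    {y z : ℕ → ℝ} {k : ℕ} (h1 : ∀ τ ≤ k, f τ = g τ) (h2 : ∀ τ < k, y τ = z τ) :
    selfNormCoef lam f y k = selfNormCoef lam g z k := by
  rw [selfNormCoef, selfNormCoef, h1 k le_rfl, regCov_congr fun τ hτ => h1 τ hτ.le]
  congr 2
  refine Finset.sum_congr rfl fun τ hτ => ?_
  rw [h1 τ (Finset.mem_range.1 hτ).le, h2 τ (Finset.mem_range.1 hτ)]

theorem selfNormProc_congr {n : Type*} [Fintype n] [DecidableEq n] {lam : ℝ} {f g : ℕ → n → ℝ}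
    {y z : ℕ → ℝ} {k : ℕ} (h1 : ∀ τ < k, f τ = g τ) (h2 : ∀ τ < k, y τ = z τ) :
    selfNormProc lam f y k = selfNormProc lam g z k := by
  refine Finset.prod_congr rfl fun τ hτ => ?_
  have hτ := Finset.mem_range.1 hτ
  rw [selfNormCoef_congr (fun σ hσ => h1 σ (by omega)) (fun σ hσ => h2 σ (by omega)), h1 τ hτ,
    h2 τ hτ, regCov_congr fun σ hσ => h1 σ (by omega)]

theorem nextProc_congr {lam : ℝ} {h : Fin H} {V : X → ℝ} {B : ℝ} {k : ℕ} {s t : ℕ → Traj X A H}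
    (hst : ∀ τ < k, s τ = t τ) : nextProc M φ lam h V B s k = nextProc M φ lam h V B t k :=
  selfNormProc_congr (fun τ hτ => by rw [hst τ hτ]) (fun τ hτ => by rw [hst τ hτ])

/-- The feature of step `h` and the next state belong to the same trajectory, so conditioning stops
at the choice of policy, and the Markov property inside the episode (`expect_selfNormFactor_le`)
centres the noise. It is essential that `V` is a fixed function. -/
theorem IsRELSVIRun.integral_nextProc_le (hR : IsRELSVIRun μ M φ prm K R) (lam : ℝ)
    {h : ℕ} (hh : h + 1 < H) {V : X → ℝ} {B : ℝ} (hB : 0 < B) (hV : ∀ x, |V x| ≤ B) {k : ℕ}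
    (hk : k ≤ K) :
    ∫ ω, nextProc M φ lam ⟨h, by omega⟩ V B (fun τ => R.traj τ ω) k ∂μ ≤ 1 := by
  induction k with
  | zero => simp [nextProc, selfNormProc]
  | succ k ih =>
    refine le_trans ?_ (ih (by omega))
    have hkK : k < K := by omega
    have hm := hR.planned_le hkK
    set hf : Fin H := ⟨h, by omega⟩ with hhf
    let Bk : (ℕ → Traj X A H) → X → A → ℝ := fun s x a => (φ x a : Fin d → ℝ) ⬝ᵥ
      (regCov lam (fun τ => (φ (s τ hf).1 (s τ hf).2 : Fin d → ℝ)) k)⁻¹ *ᵥ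
        ∑ τ ∈ Finset.range k, nextNoise M hf V B (s τ) • (φ (s τ hf).1 (s τ hf).2 : Fin d → ℝ)
    let Uk : (ℕ → Traj X A H) → X → A → ℝ := fun s x a =>
      wnorm (regCov lam (fun τ => (φ (s τ hf).1 (s τ hf).2 : Fin d → ℝ)) k)⁻¹ (φ x a) ^ 2
    let Wk : (ℕ → Traj X A H) → ℝ := fun s => nextProc M φ lam hf V B s k
    -- The new value of the process as a function of the history and of the new trajectory. The
    -- history enters only through its first `k` entries, so it is discrete and measurable at
    -- planning time.
    let Fk : (ℕ → Traj X A H) → Traj X A H → ℝ := fun s ι => Wk s *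
      selfNormFactor (Bk s (ι hf).1 (ι hf).2) (Uk s (ι hf).1 (ι hf).2) (nextNoise M hf V B ι)
    have hcongr : ∀ s t : ℕ → Traj X A H, (∀ τ < k, s τ = t τ) → Fk s = Fk t := by
      intro s t hst
      have e1 : Wk s = Wk t := nextProc_congr hst
      have e2 : Bk s = Bk t := by
        ext x a
        simp only [Bk]
        rw [regCov_congr fun τ hτ => by rw [hst τ hτ]]
        congr 2
        exact Finset.sum_congr rfl fun τ hτ => by rw [hst τ (Finset.mem_range.1 hτ)]
      have e3 : Uk s = Uk t := by
        ext x a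
        simp only [Uk]
        rw [regCov_congr fun τ hτ => by rw [hst τ hτ]]
      simp only [Fk, e1, e2, e3]
    have hW0 : ∀ s, 0 ≤ Wk s := fun s => (selfNormProc_pos _ _ _).le
    have hWc : ∀ s, Wk s ≤ Real.exp (1 / 2) ^ k := fun s =>
      selfNormProc_le _ _ _ fun τ _ => abs_nextNoise_le M hf hB hV _
    have hy : ∀ ι, |nextNoise M hf V B ι| ≤ 1 := abs_nextNoise_le M hf hB hV
    have hWm : Measurable[R.planned k] fun ω => Wk fun τ => R.traj τ ω :=
      (measurable_of_discrete_prefix (k := k) (T := R.traj)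
        (fun τ hτ => measurable_traj_before R hτ) (Φ := Wk)
        fun s t hst => nextProc_congr hst).mono le_sup_left le_rfl
    have key := integral_le_of_condLaw (μ := μ) hm (T := R.traj k) (hR.traj_meas k hkK)
      (p := fun ω ι => M.trajProb (Policy.det (R.played k ω)) ι) (hR.traj_law k hkK)
      (F := fun ι ω => Fk (fun τ => R.traj τ ω) ι) (c := Real.exp (1 / 2) ^ k * Real.exp (1 / 2))
      (G := fun ω => Wk fun τ => R.traj τ ω) ?_ ?_ ?_ ?_
    · refine le_of_eq_of_le ?_ key
      refine integral_congr_ae (ae_of_all _ fun ω => ?_)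
      simp only [Fk, Wk, nextProc, selfNormProc, Finset.prod_range_succ]
      rfl
    · intro ι
      exact (measurable_of_discrete_prefix (k := k) (T := R.traj)
        (fun τ hτ => measurable_traj_before R hτ) (Φ := fun s => Fk s ι)
        fun s t hst => by rw [hcongr s t hst]).mono le_sup_left le_rfl
    · intro ι ω
      simp only [Fk]
      rw [abs_mul, abs_of_nonneg (hW0 _), abs_of_pos (selfNormFactor_pos (sq_nonneg _) _ _)]
      exact mul_le_mul (hWc _) (selfNormFactor_le (sq_nonneg _) (hy ι))
        (selfNormFactor_pos (sq_nonneg _) _ _).le (by positivity)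
    · exact integrable_of_abs_le (hWm.mono hm le_rfl) (c := Real.exp (1 / 2) ^ k) fun ω => by
        rw [abs_of_nonneg (hW0 _)]; exact hWc _
    · intro ω
      have h1 := expect_selfNormFactor_le M (Policy.det (R.played k ω)) hh
        (Bk fun τ => R.traj τ ω) (Uk fun τ => R.traj τ ω) (fun _ _ => sq_nonneg _)
        (fun x a x' => (V x' - M.next hf V x a) / (2 * B)) ?_ ?_
      · calc _ = Wk (fun τ => R.traj τ ω) * M.expect (Policy.det (R.played k ω)) (fun ι =>
              selfNormFactor (Bk (fun τ => R.traj τ ω) (ι hf).1 (ι hf).2)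
                (Uk (fun τ => R.traj τ ω) (ι hf).1 (ι hf).2) (nextNoise M hf V B ι)) := by
              rw [← expect_const_mul]
              rfl
          _ ≤ Wk (fun τ => R.traj τ ω) * 1 := by
              refine mul_le_mul_of_nonneg_left (le_of_eq_of_le ?_ h1) (hW0 _)
              simp only [nextNoise, nextVal, hhf, hh, dif_pos]
          _ = _ := mul_one _
      · intro x a x'
        rw [abs_div, abs_of_pos (by linarith : 0 < 2 * B), div_le_one (by linarith)]
        exact (abs_sub _ _).trans (by linarith [hV x', abs_next_le M hf hV x a])
      · intro x a
        have hP := (M.P_mem hf x a).2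
        simp only [mul_div_assoc', ← Finset.sum_div, mul_sub, Finset.sum_sub_distrib,
          ← Finset.sum_mul]
        rw [← hhf, hP, one_mul, MDP.next, sub_self, zero_div]

theorem IsRELSVIRun.measureReal_nextProc (hR : IsRELSVIRun μ M φ prm K R) (lam : ℝ) {α : Type*}
    (N : Finset α) (V : Fin H → α → X → ℝ) {B : ℝ} (hB : 0 < B)
    (hV : ∀ h i x, |V h i x| ≤ B)
    {p : ℝ} (hp : 0 < p) :
    μ.real {ω | ∃ k < K, ∃ h : Fin H, ∃ i ∈ N, h.val + 1 < H ∧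
      p⁻¹ < nextProc M φ lam h (V h i) B (fun τ => R.traj τ ω) k} ≤ K * (H * (N.card * p)) := by
  classical
  have h1 : {ω | ∃ k < K, ∃ h : Fin H, ∃ i ∈ N, h.val + 1 < H ∧
      p⁻¹ < nextProc M φ lam h (V h i) B (fun τ => R.traj τ ω) k} =
      ⋃ k ∈ Finset.range K, ⋃ h ∈ (Finset.univ : Finset (Fin H)), ⋃ i ∈ N,
        {ω | h.val + 1 < H ∧ p⁻¹ < nextProc M φ lam h (V h i) B (fun τ => R.traj τ ω) k} := by
    ext ω
    simp only [Set.mem_iUnion, Finset.mem_range, Finset.mem_univ, Set.mem_ofPred_eq, exists_prop,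
      true_and]
  rw [h1]
  refine (measureReal_biUnion_finset_le _ _).trans ?_
  calc _ ≤ ∑ k ∈ Finset.range K, ∑ h : Fin H, ∑ i ∈ N, p := by
        refine Finset.sum_le_sum fun k hk => ?_
        refine (measureReal_biUnion_finset_le _ _).trans (Finset.sum_le_sum fun h _ => ?_)
        refine (measureReal_biUnion_finset_le _ _).trans (Finset.sum_le_sum fun i _ => ?_)
        by_cases hh : h.val + 1 < H
        · have hk := (Finset.mem_range.1 hk)
          refine (measureReal_mono fun ω hω => hω.2).trans
            (measureReal_gt_le_of_integral_le_one (fun ω => (selfNormProc_pos _ _ _).le)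
            (integrable_of_abs_le ?_ (c := Real.exp (1 / 2) ^ k) fun ω => ?_)
            (hR.integral_nextProc_le lam hh hB (hV h i) hk.le) hp)
          · exact (measurable_of_discrete_prefix (k := k) (T := R.traj)
              (fun τ hτ => measurable_traj_before R hτ)
              (Φ := fun s => nextProc M φ lam h (V h i) B s k)
              fun s t hst => nextProc_congr hst).mono (hR.before_le hk.le) le_rfl
          · rw [abs_of_pos (selfNormProc_pos _ _ _)]
            exact selfNormProc_le _ _ _ fun τ hτ => abs_nextNoise_le M _ hB (hV h i) _
        · simp [hh, hp.le]
    _ = _ := by simp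

/-! ### Concentration of realized trajectories -/

/-- The sum of the deviations of trajectory functions from their conditional means. -/
def trajDev (M : MDP X A H) (R : Interaction Ω X A H d prm.m)
    (F : ℕ → (ℕ → Traj X A H) → Traj X A H → ℝ) (k : ℕ) (ω : Ω) : ℝ :=
  ∑ τ ∈ Finset.range k, (M.expect (Policy.det (R.played τ ω)) (F τ fun σ => R.traj σ ω) -
    F τ (fun σ => R.traj σ ω) (R.traj τ ω))

theorem measurable_expect_of_prefix {F : ℕ → (ℕ → Traj X A H) → Traj X A H → ℝ}
    (hF : ∀ k s t, (∀ τ < k, s τ = t τ) → F k s = F k t) {m : MeasurableSpace Ω} {k : ℕ}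
    (h1 : R.before k ≤ m) (h2 : Measurable[m, ⊤] (R.played k)) :
    Measurable[m] fun ω => M.expect (Policy.det (R.played k ω)) (F k fun σ => R.traj σ ω) := by
  simp only [MDP.expect]
  refine Finset.measurable_sum _ fun ι _ => Measurable.mul ?_ ?_
  · exact measurable_top_comp h2 fun π => M.trajProb (Policy.det π) ι
  · exact measurable_of_discrete_prefix (k := k) (T := R.traj)
      (fun τ hτ => (measurable_traj_before R hτ).mono h1 le_rfl)
      (Φ := fun s => F k s ι) fun s t hst => by rw [hF k s t hst]

theorem measurable_trajDev {F : ℕ → (ℕ → Traj X A H) → Traj X A H → ℝ}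
    (hF : ∀ k s t, (∀ τ < k, s τ = t τ) → F k s = F k t) (k : ℕ) :
    Measurable[R.before k] (trajDev M R F k) := by
  unfold trajDev
  refine Finset.measurable_sum _ fun τ hτ => ?_
  have hτ := Finset.mem_range.1 hτ
  refine Measurable.sub (measurable_expect_of_prefix hF ?_ (measurable_played_before R hτ)) ?_
  · exact (le_sup_left.trans le_sup_left).trans (observed_le_before R hτ)
  · refine measurable_of_discrete_prefix (k := k) (T := R.traj)
      (fun τ hτ => measurable_traj_before R hτ) (Φ := fun s => F τ s (s τ)) fun s t hst => ?_
    rw [hst τ hτ, hF τ s t fun σ hσ => hst σ (hσ.trans hτ)]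

theorem abs_trajDev_le {F : ℕ → (ℕ → Traj X A H) → Traj X A H → ℝ}
    (h0 : ∀ k s ι, 0 ≤ F k s ι) (h1 : ∀ k s ι, F k s ι ≤ 1) (k : ℕ) (ω : Ω) :
    |trajDev M R F k ω| ≤ k := by
  unfold trajDev
  refine (Finset.abs_sum_le_sum_abs _ _).trans ?_
  calc _ ≤ ∑ τ ∈ Finset.range k, (1 : ℝ) := Finset.sum_le_sum fun τ _ => by
        have e0 : 0 ≤ M.expect (Policy.det (R.played τ ω)) (F τ fun σ => R.traj σ ω) := by
          rw [← expect_const M (Policy.det (R.played τ ω)) 0]; exact expect_mono M _ (h0 _ _)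
        have e1 : M.expect (Policy.det (R.played τ ω)) (F τ fun σ => R.traj σ ω) ≤ 1 := by
          rw [← expect_const M (Policy.det (R.played τ ω)) 1]; exact expect_mono M _ (h1 _ _)
        rw [abs_le]
        constructor <;> linarith [h0 τ (fun σ => R.traj σ ω) (R.traj τ ω),
          h1 τ (fun σ => R.traj σ ω) (R.traj τ ω)]
    _ = k := by simp

theorem IsRELSVIRun.integral_exp_trajDev_le (hR : IsRELSVIRun μ M φ prm K R)
    {F : ℕ → (ℕ → Traj X A H) → Traj X A H → ℝ}
    (hF : ∀ k s t, (∀ τ < k, s τ = t τ) → F k s = F k t)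
    (h0 : ∀ k s ι, 0 ≤ F k s ι) (h1 : ∀ k s ι, F k s ι ≤ 1) {s : ℝ} (hs : 0 ≤ s) {k : ℕ}
    (hk : k ≤ K) :
    ∫ ω, Real.exp (s * trajDev M R F k ω) ∂μ ≤ Real.exp (k * (s ^ 2 / 2)) := by
  induction k with
  | zero => simp [trajDev]
  | succ k ih =>
    have hkK : k < K := by omega
    have hm := hR.planned_le hkK
    have hE : Measurable[R.planned k] fun ω =>
        M.expect (Policy.det (R.played k ω)) (F k fun σ => R.traj σ ω) :=
      measurable_expect_of_prefix hF le_sup_left (measurable_played_planned R k)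
    have hD : Measurable[R.planned k] (trajDev M R F k) :=
      (measurable_trajDev hF k).mono le_sup_left le_rfl
    have hDb : ∀ ω, Real.exp (s * trajDev M R F k ω) ≤ Real.exp (s * k) := fun ω =>
      Real.exp_le_exp.2 (mul_le_mul_of_nonneg_left
        ((le_abs_self _).trans (abs_trajDev_le h0 h1 k ω)) hs)
    have key := integral_le_of_condLaw (μ := μ) hm (T := R.traj k) (hR.traj_meas k hkK)
      (p := fun ω ι => M.trajProb (Policy.det (R.played k ω)) ι) (hR.traj_law k hkK)
      (F := fun ι ω => Real.exp (s * trajDev M R F k ω) * Real.exp (s *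
        (M.expect (Policy.det (R.played k ω)) (F k fun σ => R.traj σ ω) -
          F k (fun σ => R.traj σ ω) ι))) (c := Real.exp (s * k) * Real.exp (s * 1))
      (G := fun ω => Real.exp (s * trajDev M R F k ω) * Real.exp (s ^ 2 / 2)) ?_ ?_ ?_ ?_
    · rw [integral_mul_const] at key
      calc _ = _ := integral_congr_ae (ae_of_all _ fun ω => by
            simp only [trajDev, Finset.sum_range_succ]
            rw [mul_add, Real.exp_add])
        _ ≤ _ := key
        _ ≤ Real.exp (k * (s ^ 2 / 2)) * Real.exp (s ^ 2 / 2) :=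
            mul_le_mul_of_nonneg_right (ih (by omega)) (Real.exp_pos _).le
        _ = _ := by rw [← Real.exp_add]; congr 1; push_cast; ring
    · intro ι
      have h3 : Measurable[R.planned k] fun ω => F k (fun σ => R.traj σ ω) ι :=
        (measurable_of_discrete_prefix (k := k) (T := R.traj)
          (fun τ hτ => measurable_traj_before R hτ) (Φ := fun s => F k s ι)
          fun s t hst => by rw [hF k s t hst]).mono le_sup_left le_rfl
      exact (hD.const_mul s).exp.mul ((hE.sub h3).const_mul s).exp
    · intro ι ω
      rw [abs_mul, Real.abs_exp, Real.abs_exp]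
      refine mul_le_mul (hDb ω) (Real.exp_le_exp.2 (mul_le_mul_of_nonneg_left ?_ hs))
        (Real.exp_pos _).le (Real.exp_pos _).le
      have e1 : M.expect (Policy.det (R.played k ω)) (F k fun σ => R.traj σ ω) ≤ 1 := by
        rw [← expect_const M (Policy.det (R.played k ω)) 1]; exact expect_mono M _ (h1 _ _)
      linarith [h0 k (fun σ => R.traj σ ω) ι]
    · refine integrable_of_abs_le (c := Real.exp (s * k) * Real.exp (s ^ 2 / 2)) ?_ fun ω => ?_
      · have := hD.mono hm le_rfl
        fun_prop
      · rw [abs_mul, Real.abs_exp, Real.abs_exp]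
        exact mul_le_mul_of_nonneg_right (hDb ω) (Real.exp_pos _).le
    · intro ω
      have h4 := expect_exp_le M (Policy.det (R.played k ω)) (f := F k fun σ => R.traj σ ω)
        (h0 _ _) (h1 _ _) s
      calc _ = Real.exp (s * trajDev M R F k ω) * M.expect (Policy.det (R.played k ω)) (fun ι =>
            Real.exp (s * (M.expect (Policy.det (R.played k ω)) (F k fun σ => R.traj σ ω) -
              F k (fun σ => R.traj σ ω) ι))) := by
            rw [← expect_const_mul]; rfl
        _ ≤ _ := mul_le_mul_of_nonneg_left h4 (Real.exp_pos _).le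

/-- **Azuma–Hoeffding** for functions of the realized trajectories. -/
theorem IsRELSVIRun.measureReal_trajDev (hR : IsRELSVIRun μ M φ prm K R) (hK : 1 ≤ K)
    {F : ℕ → (ℕ → Traj X A H) → Traj X A H → ℝ}
    (hF : ∀ k s t, (∀ τ < k, s τ = t τ) → F k s = F k t)
    (h0 : ∀ k s ι, 0 ≤ F k s ι) (h1 : ∀ k s ι, F k s ι ≤ 1) {p : ℝ} (hp : 0 < p) (hp1 : p ≤ 1) :
    μ.real {ω | √(2 * K * Real.log p⁻¹) < trajDev M R F K ω} ≤ p := by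
  have hK' : (0 : ℝ) < K := by exact_mod_cast hK
  have hL : 0 ≤ Real.log p⁻¹ := Real.log_nonneg ((one_le_inv₀ hp).2 hp1)
  set r := √(2 * K * Real.log p⁻¹) with hr
  have hr2 : r ^ 2 = 2 * K * Real.log p⁻¹ := Real.sq_sqrt (by positivity)
  have hr0 : 0 ≤ r := Real.sqrt_nonneg _
  -- With this exponent K s²/2 = log p⁻¹ and s r = 2 log p⁻¹, so the exponential Markov bound is
  -- exactly p⁻¹ · p² = p.
  set s := r / K with hs
  have hs0 : 0 ≤ s := by positivity
  have hmeas : Measurable (trajDev M R F K) :=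
    (measurable_trajDev hF K).mono (hR.before_le le_rfl) le_rfl
  have hint : Integrable (fun ω => Real.exp (s * trajDev M R F K ω)) μ := by
    refine integrable_of_abs_le (by fun_prop) (c := Real.exp (s * K)) fun ω => ?_
    rw [Real.abs_exp]
    exact Real.exp_le_exp.2 (mul_le_mul_of_nonneg_left
      ((le_abs_self _).trans (abs_trajDev_le h0 h1 K ω)) hs0)
  have hI := hR.integral_exp_trajDev_le hF h0 h1 hs0 le_rfl
  have hexp : Real.exp (K * (s ^ 2 / 2)) = p⁻¹ := by
    have : K * (s ^ 2 / 2) = Real.log p⁻¹ := by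
      rw [hs, div_pow, hr2]; field_simp
    rw [this, Real.exp_log (by positivity)]
  have hexp2 : Real.exp (s * r) = p⁻¹ * p⁻¹ := by
    have : s * r = Real.log p⁻¹ + Real.log p⁻¹ := by
      rw [hs, div_mul_eq_mul_div, ← sq, hr2]; field_simp; ring
    rw [this, Real.exp_add, Real.exp_log (by positivity)]
  have h := measureReal_gt_le_of_integral_le_one (μ := μ)
    (W := fun ω => p * Real.exp (s * trajDev M R F K ω)) (fun ω => by positivity)
    (hint.const_mul _) (by
      rw [integral_const_mul]
      calc _ ≤ p * Real.exp (K * (s ^ 2 / 2)) := mul_le_mul_of_nonneg_left hI hp.le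
        _ = 1 := by rw [hexp, mul_inv_cancel₀ hp.ne']) hp
  -- For `p = 1` both `r` and `s` vanish and the strict comparison of exponents breaks down, but the
  -- claim is trivial.
  rcases hL.eq_or_lt with hL0 | hL0
  · have hp2 : p = 1 := by
      have := Real.eq_one_of_pos_of_log_eq_zero (inv_pos.2 hp) hL0.symm
      simpa using this
    rw [hp2]; exact measureReal_le_one
  refine (measureReal_mono fun ω hω => ?_).trans h
  have hs1 : 0 < s := div_pos (Real.sqrt_pos.2 (by positivity)) hK'
  have h3 := Real.exp_lt_exp.2 (mul_lt_mul_of_pos_left (show r < trajDev M R F K ω from hω) hs1)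
  rw [hexp2] at h3
  have h4 := mul_lt_mul_of_pos_left h3 hp
  rw [mul_inv_cancel_left₀ hp.ne'] at h4
  exact h4

end Run

section Noise

variable {Ω X A : Type*} [mΩ : MeasurableSpace Ω] [Fintype X] [Fintype A] [Nonempty A] {H d : ℕ}
  {μ : Measure Ω} {M : MDP X A H} {φ : X → A → EuclideanSpace ℝ (Fin d)} {prm : Params} {K : ℕ}
  {R : Interaction Ω X A H d prm.m} [IsProbabilityMeasure μ]

/-! ### Concentration and anti-concentration of the perturbations -/

/-- A bound on the probability of a history-dependent event for the perturbations of an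
episode. -/
theorem IsRELSVIRun.measureReal_noise_le (hR : IsRELSVIRun μ M φ prm K R) {k : ℕ} (hk : k < K)
    {B : (ℕ → Traj X A H) → Set (Fin prm.m → EuclideanSpace ℝ (Fin H × Fin d))}
    (hB : ∀ s, MeasurableSet (B s)) (hBc : ∀ s t, (∀ τ < k, s τ = t τ) → B s = B t) {p : ℝ}
    (hp : ∀ s : ℕ → Traj X A H, (Measure.pi fun _ : Fin prm.m => multivariateGaussian 0
      (prm.betaR ^ 2 • (aggCov φ prm.lamR s k)⁻¹)).real (B s) ≤ p) :
    μ.real {ω | R.noise k ω ∈ B fun τ => R.traj τ ω} ≤ p := by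
  have hT : Measurable[R.before k, ⊤] fun ω => fun τ : Fin k => R.traj τ ω :=
    measurable_of_discrete_prefix (k := k) (T := R.traj) (fun τ hτ => measurable_traj_before R hτ)
      (Φ := fun s (τ : Fin k) => s τ) fun s t hst => funext fun τ => hst τ τ.2
  have : Nonempty Ω := nonempty_of_isProbabilityMeasure μ
  let ω₀ : Ω := Classical.arbitrary Ω
  let ext : (Fin k → Traj X A H) → ℕ → Traj X A H := fun t τ =>
    if h : τ < k then t ⟨τ, h⟩ else R.traj τ ω₀
  have hext : ∀ ω, B (ext fun τ => R.traj τ ω) = B fun τ => R.traj τ ω := fun ω =>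
    hBc _ _ fun τ hτ => by simp [ext, hτ]
  have h := measureReal_le_of_hasCondLaw (hR.before_le hk.le) (hR.noise_meas k hk)
    (hR.noise_law k hk) hT (B := fun t => B (ext t)) (fun t => hB _) (p := p) fun ω => by
      rw [hext]; exact hp _
  simpa only [hext] using h

theorem aggCov_congr {lam : ℝ} {k : ℕ} {s t : ℕ → Traj X A H} (hst : ∀ τ < k, s τ = t τ) :
    aggCov φ lam s k = aggCov φ lam t k := by
  rw [aggCov_eq, aggCov_eq, regCov_congr fun τ hτ => by rw [hst τ hτ]]

theorem stepCov_congr {lam : ℝ} {k : ℕ} {s t : ℕ → Traj X A H} (hst : ∀ τ < k, s τ = t τ)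
    (h : Fin H) : stepCov φ lam s k h = stepCov φ lam t k h :=
  regCov_congr (f := fun τ => (φ (s τ h).1 (s τ h).2 : Fin d → ℝ))
    (g := fun τ => (φ (t τ h).1 (t τ h).2 : Fin d → ℝ)) fun τ hτ => by rw [hst τ hτ]

theorem posDef_aggCov {lam : ℝ} (hlam : 0 < lam) (s : ℕ → Traj X A H) (k : ℕ) :
    (aggCov φ lam s k).PosDef := posDef_regCov _ k hlam

theorem posDef_stepCov {lam : ℝ} (hlam : 0 < lam) (s : ℕ → Traj X A H) (k : ℕ) (h : Fin H) :
    (stepCov φ lam s k h).PosDef :=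
  posDef_regCov (fun τ => (φ (s τ h).1 (s τ h).2 : Fin d → ℝ)) k hlam

theorem continuous_wnorm {n : Type*} [Fintype n] (B : Matrix n n ℝ) :
    Continuous fun z : EuclideanSpace ℝ n => wnorm B z := by
  simp only [wnorm, dotProduct, mulVec]
  fun_prop

theorem smul_inv_inv {n : Type*} [Fintype n] [DecidableEq n] {β : ℝ} (hβ : 0 < β)
    {B : Matrix n n ℝ} (hB : B.PosDef) : (β ^ 2 • B⁻¹)⁻¹ = (β ^ 2)⁻¹ • B := by
  refine inv_eq_left_inv ?_
  rw [smul_mul_smul_comm, inv_mul_cancel₀ (by positivity),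
    mul_nonsing_inv _ ((isUnit_iff_isUnit_det _).1 hB.isUnit), one_smul]

theorem IsRELSVIRun.measureReal_noise_large (hR : IsRELSVIRun μ M φ prm K R)
    (hβ : 0 < prm.betaR) (hlam : 0 < prm.lamR) {b : ℝ} (hb : 0 ≤ b) :
    μ.real {ω | ∃ k < K, ∃ i, prm.betaR * b <
        wnorm (aggCov φ prm.lamR (fun τ => R.traj τ ω) k) (R.noise k ω i)} ≤
      K * (prm.m * (√2 ^ (H * d) * Real.exp (-(b ^ 2 / 4)))) := by
  have h1 : {ω | ∃ k < K, ∃ i, prm.betaR * b <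
        wnorm (aggCov φ prm.lamR (fun τ => R.traj τ ω) k) (R.noise k ω i)} =
      ⋃ k ∈ Finset.range K, {ω | R.noise k ω ∈ (fun s : ℕ → Traj X A H =>
        {z : Fin prm.m → EuclideanSpace ℝ (Fin H × Fin d) | ∃ i, prm.betaR * b <
          wnorm (aggCov φ prm.lamR s k) (z i)}) fun τ => R.traj τ ω} := by
    ext ω
    simp only [Set.mem_iUnion, Finset.mem_range, Set.mem_ofPred_eq, exists_prop]
  rw [h1]
  refine (measureReal_biUnion_finset_le _ _).trans ?_
  calc _ ≤ ∑ k ∈ Finset.range K, (prm.m * (√2 ^ (H * d) * Real.exp (-(b ^ 2 / 4)))) := by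
        refine Finset.sum_le_sum fun k hk => ?_
        refine hR.measureReal_noise_le (Finset.mem_range.1 hk) (B := fun s : ℕ → Traj X A H =>
          {z : Fin prm.m → EuclideanSpace ℝ (Fin H × Fin d) | ∃ i, prm.betaR * b <
            wnorm (aggCov φ prm.lamR s k) (z i)})
          (fun s => ?_) (fun s t hst => by simp only [aggCov_congr hst]) fun s => ?_
        · have : {z : Fin prm.m → EuclideanSpace ℝ (Fin H × Fin d) | ∃ i, prm.betaR * b <
              wnorm (aggCov φ prm.lamR s k) (z i)} = ⋃ i, {z | prm.betaR * b <
                wnorm (aggCov φ prm.lamR s k) (z i)} := by ext; simp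
          rw [this]
          exact MeasurableSet.iUnion fun i => measurableSet_lt measurable_const
            (((continuous_wnorm _).comp (continuous_apply i)).measurable)
        · have hΛ := posDef_aggCov (φ := φ) hlam s k
          have h2 := pi_multivariateGaussian_exists_gt_le
            (hΛ.inv.smul (show 0 < prm.betaR ^ 2 by positivity)) prm.m (b ^ 2)
          rw [Fintype.card_prod, Fintype.card_fin, Fintype.card_fin] at h2
          refine (measureReal_mono ?_).trans h2
          rintro z ⟨i, hi⟩
          refine ⟨i, ?_⟩
          rw [smul_inv_inv hβ hΛ, smul_mulVec, dotProduct_smul, smul_eq_mul,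
            ← wnorm_sq hΛ.posSemidef, lt_inv_mul_iff₀ (by positivity), ← mul_pow]
          exact pow_lt_pow_left₀ hi (by positivity) two_ne_zero
    _ = _ := by simp

/-- Because `u` is deterministic, the members fail independently given the past, each with
probability at most 8/9. One direction is enough for optimism, so no union over policies appears. -/
theorem IsRELSVIRun.measureReal_noise_small (hR : IsRELSVIRun μ M φ prm K R)
    (hβ : 0 < prm.betaR) (hlam : 0 < prm.lamR) (u : Fin H × Fin d → ℝ) :
    μ.real {ω | ∃ k < K, ∀ i, u ⬝ᵥ R.noise k ω i < prm.betaR *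
        wnorm (aggCov φ prm.lamR (fun τ => R.traj τ ω) k)⁻¹ u} ≤ K * (8 / 9) ^ prm.m := by
  have h1 : {ω | ∃ k < K, ∀ i, u ⬝ᵥ R.noise k ω i < prm.betaR *
        wnorm (aggCov φ prm.lamR (fun τ => R.traj τ ω) k)⁻¹ u} =
      ⋃ k ∈ Finset.range K, {ω | R.noise k ω ∈ (fun s : ℕ → Traj X A H =>
        {z : Fin prm.m → EuclideanSpace ℝ (Fin H × Fin d) | ∀ i, u ⬝ᵥ z i < prm.betaR *
          wnorm (aggCov φ prm.lamR s k)⁻¹ u}) fun τ => R.traj τ ω} := by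
    ext ω
    simp only [Set.mem_iUnion, Finset.mem_range, Set.mem_ofPred_eq, exists_prop]
  rw [h1]
  refine (measureReal_biUnion_finset_le _ _).trans ?_
  calc _ ≤ ∑ k ∈ Finset.range K, ((8 / 9) ^ prm.m : ℝ) := by
        refine Finset.sum_le_sum fun k hk => ?_
        refine hR.measureReal_noise_le (Finset.mem_range.1 hk) (B := fun s : ℕ → Traj X A H =>
          {z : Fin prm.m → EuclideanSpace ℝ (Fin H × Fin d) | ∀ i, u ⬝ᵥ z i < prm.betaR *
            wnorm (aggCov φ prm.lamR s k)⁻¹ u})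
          (fun s => ?_) (fun s t hst => by simp only [aggCov_congr hst]) fun s => ?_
        · have : {z : Fin prm.m → EuclideanSpace ℝ (Fin H × Fin d) | ∀ i, u ⬝ᵥ z i < prm.betaR *
              wnorm (aggCov φ prm.lamR s k)⁻¹ u} = ⋂ i, {z | u ⬝ᵥ z i < prm.betaR *
              wnorm (aggCov φ prm.lamR s k)⁻¹ u} := by ext; simp
          rw [this]
          refine MeasurableSet.iInter fun i => measurableSet_lt (Continuous.measurable ?_)
            measurable_const
          simp only [dotProduct]
          fun_prop
        · have hΛ := posDef_aggCov (φ := φ) hlam s k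
          have h2 := pi_multivariateGaussian_forall_lt_le
            (hΛ.inv.smul (show 0 < prm.betaR ^ 2 by positivity)).posSemidef prm.m u
          have h3 : √(u ⬝ᵥ (prm.betaR ^ 2 • (aggCov φ prm.lamR s k)⁻¹) *ᵥ u) =
              prm.betaR * wnorm (aggCov φ prm.lamR s k)⁻¹ u := by
            rw [smul_mulVec, dotProduct_smul, smul_eq_mul, Real.sqrt_mul (by positivity),
              Real.sqrt_sq hβ.le, wnorm]
          rwa [h3] at h2
    _ = _ := by simp

end Noise

/-! ### Ridge regression -/

/-- Substituting the model into the normal equations leaves the error Λ⁻¹(c S − λθ): a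
self-normalized noise term and a regularization bias. -/
theorem wnorm_ridge_error_le {n : Type*} [Fintype n] [DecidableEq n] {lam : ℝ} (hlam : 0 < lam)
    (f : ℕ → n → ℝ) (y η : ℕ → ℝ) (θ : n → ℝ) {c : ℝ} (hc : 0 ≤ c) (k : ℕ)
    (hy : ∀ τ < k, y τ = f τ ⬝ᵥ θ + c * η τ) :
    wnorm (regCov lam f k) ((regCov lam f k)⁻¹ *ᵥ (∑ τ ∈ Finset.range k, y τ • f τ) - θ) ≤
      c * wnorm (regCov lam f k)⁻¹ (∑ τ ∈ Finset.range k, η τ • f τ) +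
        √lam * ‖WithLp.toLp 2 θ‖ := by
  have hΛ := posDef_regCov f k hlam
  set S := ∑ τ ∈ Finset.range k, η τ • f τ with hS
  have h1 : ∑ τ ∈ Finset.range k, y τ • f τ = regCov lam f k *ᵥ θ + (c • S - lam • θ) := by
    rw [regCov_mulVec, hS, Finset.smul_sum]
    have : ∑ τ ∈ Finset.range k, y τ • f τ = ∑ τ ∈ Finset.range k, (f τ ⬝ᵥ θ) • f τ +
        ∑ τ ∈ Finset.range k, c • η τ • f τ := by
      rw [← Finset.sum_add_distrib]
      refine Finset.sum_congr rfl fun τ hτ => ?_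
      rw [hy τ (Finset.mem_range.1 hτ), add_smul, mul_smul]
    rw [this]; abel
  rw [h1, mulVec_add, inv_mulVec_mulVec hΛ, add_sub_cancel_left, wnorm_mulVec_inv hΛ]
  refine (wnorm_sub_le hΛ.inv.posSemidef _ _).trans ?_
  rw [wnorm_smul hΛ.inv.posSemidef, wnorm_smul hΛ.inv.posSemidef, abs_of_nonneg hc,
    abs_of_pos hlam]
  refine add_le_add le_rfl ?_
  have h2 := mul_le_mul_of_nonneg_left (wnorm_inv_regCov_le f k hlam θ) (Real.sqrt_nonneg lam)
  rwa [← mul_assoc, Real.mul_self_sqrt hlam.le] at h2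

section Linear

variable {X A : Type*} [Fintype X] {H d : ℕ} {M : MDP X A H}
  {φ : X → A → EuclideanSpace ℝ (Fin d)}

/-- The parameter of the linear map taking features to one-step backups. -/
def backupVec (ψ : Fin H → X → EuclideanSpace ℝ (Fin d)) (h : Fin H) (V : X → ℝ) : Fin d → ℝ :=
  fun j => ∑ x, V x * ψ h x j

theorem next_eq_dotProduct {ψ : Fin H → X → EuclideanSpace ℝ (Fin d)}
    (hP : ∀ h x a x', M.P h x a x' = φ x a ⬝ᵥ ψ h x') (h : Fin H) (V : X → ℝ) (x : X) (a : A) :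
    M.next h V x a = φ x a ⬝ᵥ backupVec ψ h V := by
  simp only [MDP.next, hP, dotProduct, backupVec, Finset.mul_sum, Finset.sum_mul]
  rw [Finset.sum_comm]
  exact Finset.sum_congr rfl fun j _ => Finset.sum_congr rfl fun x' _ => by ring

theorem norm_le_of_abs_le {n : Type*} [Fintype n] {v w : n → ℝ} (h : ∀ j, |v j| ≤ w j) :
    ‖WithLp.toLp 2 v‖ ≤ ‖WithLp.toLp 2 w‖ := by
  rw [EuclideanSpace.norm_eq, EuclideanSpace.norm_eq]
  refine Real.sqrt_le_sqrt (Finset.sum_le_sum fun j _ => ?_)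
  exact pow_le_pow_left₀ (norm_nonneg _) ((h j).trans (le_abs_self _)) 2

/-- Coordinatewise domination by `B` times the absolute sums; this is what the entrywise absolute
values in the normalization of ψ are for. -/
theorem norm_backupVec_le {ψ : Fin H → X → EuclideanSpace ℝ (Fin d)}
    (hψ : ∀ h, ‖WithLp.toLp 2 fun j : Fin d => ∑ x, |ψ h x j|‖ ≤ √(d : ℝ)) (h : Fin H)
    {V : X → ℝ} {B : ℝ} (hB : 0 ≤ B) (hV : ∀ x, |V x| ≤ B) :
    ‖WithLp.toLp 2 (backupVec ψ h V)‖ ≤ B * √(d : ℝ) := by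
  have h1 : ∀ j, |backupVec ψ h V j| ≤ (B • fun j : Fin d => ∑ x, |ψ h x j|) j := fun j => by
    rw [backupVec, Pi.smul_apply, smul_eq_mul, Finset.mul_sum]
    refine (Finset.abs_sum_le_sum_abs _ _).trans (Finset.sum_le_sum fun x _ => ?_)
    rw [abs_mul]
    exact mul_le_mul_of_nonneg_right (hV x) (abs_nonneg _)
  refine (norm_le_of_abs_le h1).trans ?_
  rw [WithLp.toLp_smul, norm_smul, Real.norm_of_nonneg hB]
  exact mul_le_mul_of_nonneg_left (hψ h) hB

theorem dotProduct_self_le_one (hφ : ∀ x a, ‖φ x a‖ ≤ 1) (x : X) (a : A) :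
    φ x a ⬝ᵥ φ x a ≤ 1 := by
  rw [← norm_euclidean_sq]
  exact pow_le_one₀ (norm_nonneg _) (hφ x a)

theorem aggFeat_dotProduct (ι : Traj X A H) (u : Fin H × Fin d → ℝ) :
    aggFeat φ ι ⬝ᵥ u = ∑ h, φ (ι h).1 (ι h).2 ⬝ᵥ fun j => u (h, j) := by
  simp only [dotProduct, aggFeat, Fintype.sum_prod_type]

theorem aggFeat_dotProduct_self_le (hφ : ∀ x a, ‖φ x a‖ ≤ 1) (ι : Traj X A H) :
    aggFeat φ ι ⬝ᵥ aggFeat φ ι ≤ H := by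
  rw [aggFeat_dotProduct]
  calc _ ≤ ∑ _h : Fin H, (1 : ℝ) := Finset.sum_le_sum fun h _ => dotProduct_self_le_one hφ _ _
    _ = H := by simp

/-- The concatenated reward parameter. -/
def rewardVec (θ : Fin H → EuclideanSpace ℝ (Fin d)) : Fin H × Fin d → ℝ := fun p => θ p.1 p.2

theorem aggFeat_dotProduct_rewardVec {θ : Fin H → EuclideanSpace ℝ (Fin d)}
    (hr : ∀ h x a, M.r h x a = φ x a ⬝ᵥ θ h) (ι : Traj X A H) :
    aggFeat φ ι ⬝ᵥ rewardVec θ = ∑ h, M.r h (ι h).1 (ι h).2 := by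
  rw [aggFeat_dotProduct]
  exact Finset.sum_congr rfl fun h _ => (hr h _ _).symm

theorem norm_rewardVec_le {θ : Fin H → EuclideanSpace ℝ (Fin d)} (hθ : ∀ h, ‖θ h‖ ≤ √(d : ℝ)) :
    ‖WithLp.toLp 2 (rewardVec θ)‖ ≤ √((d : ℝ) * H) := by
  refine Real.le_sqrt_of_sq_le ?_
  rw [norm_toLp_sq, dotProduct, Fintype.sum_prod_type]
  calc _ = ∑ h, ‖θ h‖ ^ 2 := Finset.sum_congr rfl fun h _ => by
        rw [norm_euclidean_sq]; rfl
    _ ≤ ∑ _h : Fin H, (d : ℝ) := Finset.sum_le_sum fun h _ => by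
        have := pow_le_pow_left₀ (norm_nonneg _) (hθ h) 2
        rwa [Real.sq_sqrt (by positivity)] at this
    _ = _ := by simp [mul_comm]

theorem norm_block_le (u : Fin H × Fin d → ℝ) (h : Fin H) :
    ‖WithLp.toLp 2 fun j => u (h, j)‖ ≤ ‖WithLp.toLp 2 u‖ := by
  refine abs_le_of_sq_le_sq' ?_ (norm_nonneg _) |>.2
  rw [norm_toLp_sq, norm_toLp_sq, dotProduct, dotProduct, Fintype.sum_prod_type]
  exact Finset.single_le_sum (f := fun h => ∑ j, u (h, j) * u (h, j))
    (fun i _ => Finset.sum_nonneg fun j _ => mul_self_nonneg _) (Finset.mem_univ h)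

theorem abs_feat_dotProduct_le (hφ : ∀ x a, ‖φ x a‖ ≤ 1) (x : X) (a : A) (u : Fin d → ℝ) :
    |φ x a ⬝ᵥ u| ≤ ‖WithLp.toLp 2 u‖ := by
  have := abs_real_inner_le_norm (WithLp.toLp 2 u : EuclideanSpace ℝ (Fin d)) (φ x a)
  rw [EuclideanSpace.inner_eq_star_dotProduct] at this
  simp only [star_trivial] at this
  exact this.trans (mul_le_of_le_one_right (norm_nonneg _) (hφ x a))

/-- Blocks of a vector are bounded by its weighted norm. -/
theorem norm_block_le_wnorm {lam : ℝ} (hlam : 0 < lam) (s : ℕ → Traj X A H) (k : ℕ)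
    (u : Fin H × Fin d → ℝ) (h : Fin H) :
    ‖WithLp.toLp 2 fun j => u (h, j)‖ ≤ wnorm (aggCov φ lam s k) u / √lam := by
  rw [le_div_iff₀ (Real.sqrt_pos.2 hlam), mul_comm]
  exact (mul_le_mul_of_nonneg_left (norm_block_le u h) (Real.sqrt_nonneg _)).trans
    (sqrt_mul_norm_le_regCov _ k hlam u)

/-! ### Transition errors -/

variable [Fintype A] [Nonempty A]

/-- One-step backups are linear in the features, so `psiHat` is a ridge regression with responses
`nextVal`. Dividing the noise by 2B brings it into [−1, 1]. -/
theorem abs_dotProduct_psiHat_sub_next_le {lam : ℝ} (hlam : 0 < lam)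
    {ψ : Fin H → X → EuclideanSpace ℝ (Fin d)}
    (hP : ∀ h x a x', M.P h x a x' = φ x a ⬝ᵥ ψ h x')
    (hψ : ∀ h, ‖WithLp.toLp 2 fun j : Fin d => ∑ x, |ψ h x j|‖ ≤ √(d : ℝ)) (h : Fin H)
    {V : X → ℝ} {B : ℝ} (hB : 0 < B) (hV : ∀ x, |V x| ≤ B) (s : ℕ → Traj X A H) (k : ℕ) (x : X)
    (a : A) :
    |φ x a ⬝ᵥ psiHat φ lam s k h V - M.next h V x a| ≤ wnorm (stepCov φ lam s k h)⁻¹ (φ x a) *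
      (2 * B * wnorm (stepCov φ lam s k h)⁻¹ (∑ τ ∈ Finset.range k,
        nextNoise M h V B (s τ) • (φ (s τ h).1 (s τ h).2 : Fin d → ℝ)) + √lam * (B * √(d : ℝ))) := by
  rw [next_eq_dotProduct hP, ← dotProduct_sub]
  refine (abs_dotProduct_le_wnorm (posDef_stepCov hlam s k h) _ _).trans
    (mul_le_mul_of_nonneg_left ?_ (wnorm_nonneg _ _))
  refine (wnorm_ridge_error_le hlam (fun τ => (φ (s τ h).1 (s τ h).2 : Fin d → ℝ))
    (fun τ => nextVal (s τ) h V) (fun τ => nextNoise M h V B (s τ)) (backupVec ψ h V)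
    (by linarith : 0 ≤ 2 * B) k fun τ _ => ?_).trans ?_
  · rw [← next_eq_dotProduct hP, nextNoise]
    field_simp
    ring
  · exact add_le_add le_rfl (mul_le_mul_of_nonneg_left (norm_backupVec_le hψ h hB.le hV)
      (Real.sqrt_nonneg _))

theorem abs_nextNoise_sub_le (h : Fin H) {V V' : X → ℝ} {B ε : ℝ} (hB : 0 < B) (hε : 0 ≤ ε)
    (hV : ∀ x, |V x - V' x| ≤ ε) (ι : Traj X A H) :
    |nextNoise M h V B ι - nextNoise M h V' B ι| ≤ ε / B := by
  have h1 : nextNoise M h V B ι - nextNoise M h V' B ι = ((nextVal ι h V - nextVal ι h V') -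
      (M.next h (V - V') (ι h).1 (ι h).2)) / (2 * B) := by
    simp only [nextNoise, MDP.next, Pi.sub_apply, mul_sub, Finset.sum_sub_distrib]
    ring
  have h2 : |nextVal ι h V - nextVal ι h V'| ≤ ε := by
    unfold nextVal
    split_ifs
    · exact hV _
    · simpa using hε
  have h3 : |M.next h (V - V') (ι h).1 (ι h).2| ≤ ε := abs_next_le M h hV _ _
  rw [h1, abs_div, abs_of_pos (by linarith : 0 < 2 * B), div_le_div_iff₀ (by linarith) hB]
  have := (abs_sub (nextVal ι h V - nextVal ι h V') (M.next h (V - V') (ι h).1 (ι h).2))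
  nlinarith

/-- Each noise moves by at most ε/B and each feature has inverse covariance norm at most 1, so the
triangle inequality costs `k * (ε / B)`. This crude loss is why the net is resolved to accuracy B/K.
-/
theorem wnorm_sum_nextNoise_le (hφ : ∀ x a, ‖φ x a‖ ≤ 1) (h : Fin H) {V V' : X → ℝ} {B ε : ℝ}
    (hB : 0 < B) (hε : 0 ≤ ε) (hV : ∀ x, |V x - V' x| ≤ ε) (s : ℕ → Traj X A H) (k : ℕ) :
    wnorm (stepCov φ 1 s k h)⁻¹ (∑ τ ∈ Finset.range k,
        nextNoise M h V B (s τ) • (φ (s τ h).1 (s τ h).2 : Fin d → ℝ)) ≤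
      wnorm (stepCov φ 1 s k h)⁻¹ (∑ τ ∈ Finset.range k,
        nextNoise M h V' B (s τ) • (φ (s τ h).1 (s τ h).2 : Fin d → ℝ)) + k * (ε / B) := by
  have hΛ := posDef_stepCov (φ := φ) one_pos s k h
  have h1 : ∑ τ ∈ Finset.range k, nextNoise M h V B (s τ) • (φ (s τ h).1 (s τ h).2 : Fin d → ℝ) =
      ∑ τ ∈ Finset.range k, nextNoise M h V' B (s τ) • (φ (s τ h).1 (s τ h).2 : Fin d → ℝ) +
      ∑ τ ∈ Finset.range k, (nextNoise M h V B (s τ) - nextNoise M h V' B (s τ)) •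
        (φ (s τ h).1 (s τ h).2 : Fin d → ℝ) := by
    rw [← Finset.sum_add_distrib]
    exact Finset.sum_congr rfl fun τ _ => by rw [sub_smul]; abel
  rw [h1]
  refine (wnorm_add_le hΛ.inv.posSemidef _ _).trans (add_le_add le_rfl ?_)
  refine (wnorm_sum_le hΛ.inv.posSemidef _ _).trans ?_
  calc _ ≤ ∑ τ ∈ Finset.range k, ε / B := by
        refine Finset.sum_le_sum fun τ _ => ?_
        rw [wnorm_smul hΛ.inv.posSemidef]
        have h2 := wnorm_inv_regCov_le (fun τ => (φ (s τ h).1 (s τ h).2 : Fin d → ℝ)) k one_pos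
          (φ (s τ h).1 (s τ h).2 : Fin d → ℝ)
        rw [Real.sqrt_one, one_mul] at h2
        exact (mul_le_mul (abs_nextNoise_sub_le h hB hε hV _) (h2.trans (hφ _ _))
          (wnorm_nonneg _ _) (by positivity)).trans_eq (mul_one _)
    _ = _ := by simp

end Linear

/-! ### Value estimates -/

theorem clip_mono {β z z' : ℝ} (h : z ≤ z') : clip β z ≤ clip β z' :=
  min_le_min le_rfl (max_le_max le_rfl h)

theorem abs_clip_le {β : ℝ} (hβ : 0 ≤ β) (z : ℝ) : |clip β z| ≤ β :=
  abs_le.2 ⟨le_min (by linarith) (le_max_left _ _), min_le_left _ _⟩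

theorem clip_eq_self {β z : ℝ} (h : |z| ≤ β) : clip β z = z := by
  obtain ⟨h1, h2⟩ := abs_le.1 h
  rw [clip, max_eq_right h1, min_eq_right h2]

/-- Clipping increases `z` only when `z < -β`, and then only to −β, which is still at most `y`. -/
theorem clip_le_of_le {β y z b : ℝ} (hy : |y| ≤ β) (hb : 0 ≤ b) (hz : z ≤ y + b) :
    clip β z ≤ y + b :=
  (min_le_right _ _).trans (max_le (by linarith [(abs_le.1 hy).1]) hz)

theorem abs_clip_sub_clip_le (β z z' : ℝ) : |clip β z - clip β z'| ≤ |z - z'| := by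
  unfold clip
  refine (abs_min_sub_min_le_max _ _ _ _).trans ?_
  rw [sub_self, abs_zero, max_eq_right (abs_nonneg _)]
  refine (abs_max_sub_max_le_max _ _ _ _).trans ?_
  rw [sub_self, abs_zero, max_eq_right (abs_nonneg _)]

section Estimates

variable {X A : Type*} [Fintype A] [Nonempty A] {H d : ℕ}
  {φ : X → A → EuclideanSpace ℝ (Fin d)} {prm : Params} {s : ℕ → Traj X A H} {v : ℕ → ℝ} {k : ℕ}
  {ζ : EuclideanSpace ℝ (Fin H × Fin d)}

theorem vHat_of_lt {n : ℕ} (hn : n < H) (x : X) :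
    vHat φ prm s v k ζ n x =
      Finset.univ.sup' Finset.univ_nonempty fun a : A => qHat φ prm s v k ζ ⟨n, hn⟩ x a := by
  rw [vHat, dif_pos hn]
  rfl

theorem vHat_of_ge {n : ℕ} (hn : H ≤ n) (x : X) : vHat φ prm s v k ζ n x = 0 := by
  rw [vHat, dif_neg (by omega)]

theorem qHat_le_vHat (h : Fin H) (x : X) (a : A) :
    qHat φ prm s v k ζ h x a ≤ vHat φ prm s v k ζ h x := by
  rw [vHat_of_lt h.2]
  exact Finset.le_sup' (fun a => qHat φ prm s v k ζ h x a) (Finset.mem_univ a)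

theorem vHat_eq_qHat_of_greedy {h : Fin H} {x : X} {a : A}
    (ha : ∀ a', qHat φ prm s v k ζ h x a' ≤ qHat φ prm s v k ζ h x a) :
    vHat φ prm s v k ζ h x = qHat φ prm s v k ζ h x a := by
  refine le_antisymm ?_ (qHat_le_vHat h x a)
  rw [vHat_of_lt h.2]
  exact Finset.sup'_le _ _ fun a' _ => ha a'

theorem abs_sup'_le {f : A → ℝ} {c : ℝ} (h : ∀ a, |f a| ≤ c) :
    |Finset.univ.sup' Finset.univ_nonempty f| ≤ c := by
  obtain ⟨a, -, ha⟩ := Finset.exists_mem_eq_sup' Finset.univ_nonempty f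
  rw [ha]; exact h a

theorem abs_vHat_le (hβ : 0 ≤ prm.betaRZ) (n : ℕ) (hn : n ≤ H) (x : X) :
    |vHat φ prm s v k ζ n x| ≤ ((H : ℝ) - n) * prm.betaRZ := by
  have hn' : (0 : ℝ) ≤ (H : ℝ) - n := by
    have : (n : ℝ) ≤ H := by exact_mod_cast hn
    linarith
  by_cases h : n < H
  · rw [vHat_of_lt h]
    exact abs_sup'_le fun a => abs_clip_le (by positivity) _
  · rw [vHat_of_ge (by omega), abs_zero]
    positivity

variable [Fintype X] {M : MDP X A H}

/-- The feature-wise reward estimate of an ensemble member. -/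
def pertReward (φ : X → A → EuclideanSpace ℝ (Fin d)) (prm : Params) (s : ℕ → Traj X A H)
    (v : ℕ → ℝ) (k : ℕ) (ζ : EuclideanSpace ℝ (Fin H × Fin d)) : Fin H × Fin d → ℝ :=
  fun p => thetaHat φ prm.lamR s v k p + ζ p

/-- Up to the transition errors, `Q̂` is a backup with respect to the true transitions. -/
theorem qHat_bounds (hβ : 0 ≤ prm.betaRZ) (hβp : 0 ≤ prm.betaP)
    (hrew : ∀ h x a, |φ x a ⬝ᵥ fun j => pertReward φ prm s v k ζ (h, j)| ≤ prm.betaRZ)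
    (htr : ∀ h x a, |φ x a ⬝ᵥ psiHat φ prm.lamP s k h (vHat φ prm s v k ζ (h.val + 1)) -
      M.next h (vHat φ prm s v k ζ (h.val + 1)) x a| ≤
        prm.betaP * wnorm (stepCov φ prm.lamP s k h)⁻¹ (φ x a)) (h : Fin H) (x : X) (a : A) :
    (φ x a ⬝ᵥ fun j => pertReward φ prm s v k ζ (h, j)) +
      M.next h (vHat φ prm s v k ζ (h.val + 1)) x a ≤ qHat φ prm s v k ζ h x a ∧
    qHat φ prm s v k ζ h x a ≤ ((φ x a ⬝ᵥ fun j => pertReward φ prm s v k ζ (h, j)) +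
      M.next h (vHat φ prm s v k ζ (h.val + 1)) x a) +
        2 * prm.betaP * wnorm (stepCov φ prm.lamP s k h)⁻¹ (φ x a) := by
  set b := prm.betaP * wnorm (stepCov φ prm.lamP s k h)⁻¹ (φ x a) with hb
  have hb0 : 0 ≤ b := mul_nonneg hβp (wnorm_nonneg _ _)
  set r := φ x a ⬝ᵥ fun j => pertReward φ prm s v k ζ (h, j) with hr
  set p := φ x a ⬝ᵥ psiHat φ prm.lamP s k h (vHat φ prm s v k ζ (h.val + 1)) with hp
  set q := M.next h (vHat φ prm s v k ζ (h.val + 1)) x a with hq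
  have hQ : qHat φ prm s v k ζ h x a = clip (((H : ℝ) - h.val) * prm.betaRZ) (r + p + b) := by
    rw [qHat, qBackup, hr, hp, hb, ← dotProduct_add]
    rfl
  have hpq := abs_le.1 (htr h x a)
  have hqb : |q| ≤ ((H : ℝ) - (h.val + 1 : ℕ)) * prm.betaRZ :=
    abs_next_le M h (abs_vHat_le hβ _ h.2) x a
  -- One unit β_{rζ} pays for the perturbed reward and the remaining H − h − 1 for the next value,
  -- so clipping fixes the true backup and monotonicity of `clip` preserves the lower bound.
  have hy : |r + q| ≤ ((H : ℝ) - h.val) * prm.betaRZ := by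
    refine (abs_add_le _ _).trans ?_
    have := hrew h x a
    push_cast at hqb
    linarith
  rw [hQ]
  constructor
  · rw [← clip_eq_self hy]
    exact clip_mono (by linarith [hpq.1])
  · have : 2 * prm.betaP * wnorm (stepCov φ prm.lamP s k h)⁻¹ (φ x a) = 2 * b := by rw [hb]; ring
    rw [this]
    exact clip_le_of_le hy (by linarith) (by linarith [hpq.2])

/-- Expected concatenated features of a policy. -/
def expFeat (M : MDP X A H) (φ : X → A → EuclideanSpace ℝ (Fin d)) (π : Policy X A H) :
    Fin H × Fin d → ℝ := fun p => M.expect π fun ι => aggFeat φ ι p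

theorem expFeat_dotProduct (π : Policy X A H) (u : Fin H × Fin d → ℝ) :
    expFeat M φ π ⬝ᵥ u = M.expect π fun ι => aggFeat φ ι ⬝ᵥ u := by
  simp only [dotProduct, expFeat]
  rw [expect_sum]
  refine Finset.sum_congr rfl fun p _ => ?_
  rw [mul_comm, ← expect_const_mul]
  simp only [mul_comm]

theorem value_eq_expFeat {θ : Fin H → EuclideanSpace ℝ (Fin d)}
    (hr : ∀ h x a, M.r h x a = φ x a ⬝ᵥ θ h) (π : Policy X A H) :
    M.value π = expFeat M φ π ⬝ᵥ rewardVec θ := by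
  rw [expFeat_dotProduct, MDP.value]
  simp only [aggFeat_dotProduct_rewardVec hr]

/-- **Optimism**: the value estimate dominates the perturbed value of every policy. -/
theorem expFeat_dotProduct_le_vHat (hH : 0 < H)
    (hlow : ∀ h x a, (φ x a ⬝ᵥ fun j => pertReward φ prm s v k ζ (h, j)) +
      M.next h (vHat φ prm s v k ζ (h.val + 1)) x a ≤ qHat φ prm s v k ζ h x a)
    (π : Policy X A H) :
    expFeat M φ π ⬝ᵥ pertReward φ prm s v k ζ ≤ vHat φ prm s v k ζ 0 M.init := by
  rw [expFeat_dotProduct, ← expect_sum_sub_next M π hH (vHat φ prm s v k ζ)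
    (funext fun x => vHat_of_ge le_rfl x)]
  refine expect_mono M π fun ι => ?_
  rw [aggFeat_dotProduct]
  refine Finset.sum_le_sum fun h _ => ?_
  have h1 := hlow h (ι h).1 (ι h).2
  have h2 := qHat_le_vHat (φ := φ) (prm := prm) (s := s) (v := v) (k := k) (ζ := ζ) h (ι h).1 (ι h).2
  linarith

/-- The value estimate is at most the perturbed value of the greedy policy plus its bonuses. -/
theorem vHat_le_expect (hH : 0 < H)
    (hup : ∀ h x a, qHat φ prm s v k ζ h x a ≤
      ((φ x a ⬝ᵥ fun j => pertReward φ prm s v k ζ (h, j)) +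
      M.next h (vHat φ prm s v k ζ (h.val + 1)) x a) +
        2 * prm.betaP * wnorm (stepCov φ prm.lamP s k h)⁻¹ (φ x a))
    {π : Fin H → X → A}
    (hπ : ∀ h x a, qHat φ prm s v k ζ h x a ≤ qHat φ prm s v k ζ h x (π h x)) :
    vHat φ prm s v k ζ 0 M.init ≤ M.expect (Policy.det π) fun ι =>
      aggFeat φ ι ⬝ᵥ pertReward φ prm s v k ζ + 2 * prm.betaP *
        ∑ h, wnorm (stepCov φ prm.lamP s k h)⁻¹ (φ (ι h).1 (ι h).2) := by
  rw [← expect_sum_sub_next M (Policy.det π) hH (vHat φ prm s v k ζ)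
    (funext fun x => vHat_of_ge le_rfl x)]
  -- On trajectories of positive probability the actions are the greedy ones, and only there does V̂
  -- equal Q̂ at the visited pairs.
  refine expect_mono_of_support M _ fun ι hι => ?_
  rw [aggFeat_dotProduct, Finset.mul_sum, ← Finset.sum_add_distrib]
  refine Finset.sum_le_sum fun h _ => ?_
  have h1 := hup h (ι h).1 (ι h).2
  have h2 : vHat φ prm s v k ζ h (ι h).1 = qHat φ prm s v k ζ h (ι h).1 (ι h).2 :=
    vHat_eq_qHat_of_greedy fun a' => by
      rw [action_eq_of_trajProb_ne_zero hι h]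
      exact hπ h _ a'
  linarith

/-- The per-episode regret bound in terms of expected feature norms. -/
theorem optValue_sub_value_le (hH : 0 < H) (hlam : 0 < prm.lamR) {br bz : ℝ}
    {θ : Fin H → EuclideanSpace ℝ (Fin d)} (hr : ∀ h x a, M.r h x a = φ x a ⬝ᵥ θ h)
    {πs : Policy X A H} (hπs : M.value πs = M.optValue)
    (hθ : wnorm (aggCov φ prm.lamR s k) (thetaHat φ prm.lamR s v k - rewardVec θ) ≤ br)
    {ζ' : EuclideanSpace ℝ (Fin H × Fin d)}
    (hopt : br * wnorm (aggCov φ prm.lamR s k)⁻¹ (expFeat M φ πs) ≤ expFeat M φ πs ⬝ᵥ ζ')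
    (hlow : ∀ h x a, (φ x a ⬝ᵥ fun j => pertReward φ prm s v k ζ' (h, j)) +
      M.next h (vHat φ prm s v k ζ' (h.val + 1)) x a ≤ qHat φ prm s v k ζ' h x a)
    (hlead : vHat φ prm s v k ζ' 0 M.init ≤ vHat φ prm s v k ζ 0 M.init)
    (hζ : wnorm (aggCov φ prm.lamR s k) ζ ≤ bz)
    (hup : ∀ h x a, qHat φ prm s v k ζ h x a ≤
      ((φ x a ⬝ᵥ fun j => pertReward φ prm s v k ζ (h, j)) +
      M.next h (vHat φ prm s v k ζ (h.val + 1)) x a) +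
        2 * prm.betaP * wnorm (stepCov φ prm.lamP s k h)⁻¹ (φ x a))
    {π : Fin H → X → A}
    (hπ : ∀ h x a, qHat φ prm s v k ζ h x a ≤ qHat φ prm s v k ζ h x (π h x)) :
    M.optValue - M.value (Policy.det π) ≤ M.expect (Policy.det π) fun ι =>
      (br + bz) * wnorm (aggCov φ prm.lamR s k)⁻¹ (aggFeat φ ι) + 2 * prm.betaP *
        ∑ h, wnorm (stepCov φ prm.lamP s k h)⁻¹ (φ (ι h).1 (ι h).2) := by
  have hΛ := posDef_aggCov (φ := φ) hlam s k
  have h1 : ∀ z : EuclideanSpace ℝ (Fin H × Fin d), pertReward φ prm s v k z =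
      rewardVec θ + ((thetaHat φ prm.lamR s v k - rewardVec θ) + z.ofLp) := fun z => by
    ext p; simp [pertReward]; ring
  -- The estimation error in the direction of the optimal features costs at most `br` times their
  -- norm, which the perturbation `ζ'` repays by `hopt`; `hlead` transfers the bound to the played
  -- member.
  have h2 : M.optValue ≤ vHat φ prm s v k ζ 0 M.init := by
    refine le_trans ?_ hlead
    refine le_trans ?_ (expFeat_dotProduct_le_vHat hH hlow πs)
    rw [h1, dotProduct_add, dotProduct_add, ← value_eq_expFeat hr, hπs]
    have h3 := (abs_le.1 (abs_dotProduct_le_wnorm hΛ (expFeat M φ πs)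
      (thetaHat φ prm.lamR s v k - rewardVec θ))).1
    have h4 := mul_le_mul_of_nonneg_left hθ
      (wnorm_nonneg (aggCov φ prm.lamR s k)⁻¹ (expFeat M φ πs))
    linarith
  have h5 : M.value (Policy.det π) =
      M.expect (Policy.det π) fun ι => aggFeat φ ι ⬝ᵥ rewardVec θ := by
    rw [value_eq_expFeat hr, expFeat_dotProduct]
  -- Both values are expectations over the same policy, so the true reward cancels; only features
  -- against θ̂ − θ + ζ and the bonuses remain.
  refine (sub_le_sub_right (h2.trans (vHat_le_expect hH hup hπ)) _).trans ?_
  rw [h5, ← expect_sub]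
  refine expect_mono M _ fun ι => ?_
  have h6 := (abs_le.1 (abs_dotProduct_le_wnorm hΛ (aggFeat φ ι)
    ((thetaHat φ prm.lamR s v k - rewardVec θ) + ζ.ofLp))).2
  have h7 : wnorm (aggCov φ prm.lamR s k)
      ((thetaHat φ prm.lamR s v k - rewardVec θ) + ζ.ofLp) ≤ br + bz :=
    (wnorm_add_le hΛ.posSemidef _ _).trans (add_le_add hθ hζ)
  have h8 := mul_le_mul_of_nonneg_left h7
    (wnorm_nonneg (aggCov φ prm.lamR s k)⁻¹ (aggFeat φ ι))
  rw [h1, dotProduct_add]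
  linarith

end Estimates

/-! ### A finite net of value functions -/

/-- Negative arguments are included, since `√` vanishes there: rounding the entries of a bonus
matrix need not keep it positive semidefinite. -/
theorem abs_sqrt_sub_sqrt_le (x y : ℝ) : |√x - √y| ≤ √|x - y| := by
  have key : ∀ x y : ℝ, √x ≤ √y + √|x - y| := fun x y => by
    rw [Real.sqrt_le_left (by positivity), add_sq, Real.sq_sqrt (abs_nonneg _)]
    have h1 : y ≤ √y ^ 2 := by rw [Real.sq_sqrt']; exact le_max_left _ _
    have h2 := le_abs_self (x - y)
    have h3 : 0 ≤ 2 * √y * √|x - y| := by positivity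
    linarith
  rw [abs_le]
  have h1 := key x y
  have h2 := key y x
  rw [abs_sub_comm] at h2
  constructor <;> linarith

theorem exists_int_mul_near {x W step : ℝ} (hs : 0 < step) (hx : |x| ≤ W) {a : ℕ}
    (ha : W / step + 1 / 2 ≤ a) :
    ∃ n ∈ Finset.Icc (-(a : ℤ)) a, |x - step * n| ≤ step := by
  have h1 := abs_sub_round (x / step)
  have h2 : |x / step| ≤ W / step := by
    rw [abs_div, abs_of_pos hs]; exact div_le_div_of_nonneg_right hx hs.le
  have h3 := abs_le.1 h1
  have h4 := abs_le.1 h2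
  refine ⟨round (x / step), Finset.mem_Icc.2 ⟨?_, ?_⟩, ?_⟩
  · have : ((-(a : ℤ) : ℤ) : ℝ) ≤ (round (x / step) : ℤ) := by push_cast; linarith [h3.2]
    exact_mod_cast this
  · have : ((round (x / step) : ℤ) : ℝ) ≤ ((a : ℤ) : ℝ) := by push_cast; linarith [h3.1]
    exact_mod_cast this
  · have : x - step * round (x / step) = step * (x / step - round (x / step)) := by
      field_simp
    rw [this, abs_mul, abs_of_pos hs]
    exact mul_le_of_le_one_right hs.le (h1.trans (by norm_num))

theorem abs_sup'_sub_sup'_le {A : Type*} [Fintype A] [Nonempty A] {f g : A → ℝ} {ε : ℝ}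
    (h : ∀ a, |f a - g a| ≤ ε) :
    |Finset.univ.sup' Finset.univ_nonempty f - Finset.univ.sup' Finset.univ_nonempty g| ≤ ε := by
  have key : ∀ f g : A → ℝ, (∀ a, |f a - g a| ≤ ε) →
      Finset.univ.sup' Finset.univ_nonempty f ≤ Finset.univ.sup' Finset.univ_nonempty g + ε :=
    fun f g h => Finset.sup'_le _ _ fun a _ => by
      have h1 := Finset.le_sup' g (Finset.mem_univ a)
      linarith [(abs_le.1 (h a)).2]
  rw [abs_le]
  have h1 := key f g h
  have h2 := key g f fun a => by rw [abs_sub_comm]; exact h a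
  constructor <;> linarith

section Net

variable {X A : Type*} [Fintype X] [Fintype A] [Nonempty A] {H d : ℕ}
  {φ : X → A → EuclideanSpace ℝ (Fin d)}

/-- The value function with linear part `w` and bonus matrix `B`. -/
def bonusVal (φ : X → A → EuclideanSpace ℝ (Fin d)) (c β : ℝ) (w : Fin d → ℝ)
    (B : Matrix (Fin d) (Fin d) ℝ) (x : X) : ℝ :=
  Finset.univ.sup' Finset.univ_nonempty fun a : A =>
    clip c (φ x a ⬝ᵥ w + β * wnorm B (φ x a))

theorem abs_bonusVal_le {c : ℝ} (hc : 0 ≤ c) (β : ℝ) (w : Fin d → ℝ)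
    (B : Matrix (Fin d) (Fin d) ℝ) (x : X) : |bonusVal φ c β w B x| ≤ c :=
  abs_sup'_le fun _ => abs_clip_le hc _

theorem abs_feat_apply_le (hφ : ∀ x a, ‖φ x a‖ ≤ 1) (x : X) (a : A) (j : Fin d) :
    |φ x a j| ≤ 1 :=
  (PiLp.norm_apply_le (φ x a) j).trans (hφ x a)

theorem abs_bonusVal_sub_le (hφ : ∀ x a, ‖φ x a‖ ≤ 1) (c : ℝ) {β : ℝ} (hβ : 0 ≤ β)
    {w w' : Fin d → ℝ} {B B' : Matrix (Fin d) (Fin d) ℝ} {e₁ e₂ : ℝ} (he₂ : 0 ≤ e₂)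
    (hw : ∀ j, |w j - w' j| ≤ e₁) (hB : ∀ p q, |B p q - B' p q| ≤ e₂) (x : X) :
    |bonusVal φ c β w B x - bonusVal φ c β w' B' x| ≤ d * e₁ + β * (d * √e₂) := by
  refine abs_sup'_sub_sup'_le fun a => (abs_clip_sub_clip_le _ _ _).trans ?_
  have h1 : |φ x a ⬝ᵥ (w - w')| ≤ d * e₁ := by
    refine (Finset.abs_sum_le_sum_abs _ _).trans ?_
    calc _ ≤ ∑ _j : Fin d, e₁ := Finset.sum_le_sum fun j _ => by
          rw [abs_mul]
          exact (mul_le_of_le_one_left (abs_nonneg _) (abs_feat_apply_le hφ x a j)).trans (hw j)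
      _ = _ := by simp
  have h2 : |φ x a ⬝ᵥ B *ᵥ φ x a - φ x a ⬝ᵥ B' *ᵥ φ x a| ≤ d ^ 2 * e₂ := by
    rw [← dotProduct_sub, ← sub_mulVec]
    refine (Finset.abs_sum_le_sum_abs _ _).trans ?_
    calc _ ≤ ∑ _p : Fin d, ∑ _q : Fin d, e₂ := Finset.sum_le_sum fun p _ => by
          rw [abs_mul]
          refine (mul_le_of_le_one_left (abs_nonneg _) (abs_feat_apply_le hφ x a p)).trans ?_
          change |∑ q, (B - B') p q * φ x a q| ≤ _
          refine (Finset.abs_sum_le_sum_abs _ _).trans (Finset.sum_le_sum fun q _ => ?_)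
          rw [abs_mul]
          exact (mul_le_of_le_one_right (abs_nonneg _) (abs_feat_apply_le hφ x a q)).trans (hB p q)
      _ = _ := by simp; ring
  have h3 : |wnorm B (φ x a) - wnorm B' (φ x a)| ≤ d * √e₂ := by
    refine (abs_sqrt_sub_sqrt_le _ _).trans ?_
    rw [Real.sqrt_le_left (by positivity), mul_pow, Real.sq_sqrt he₂]
    exact h2
  have h4 : φ x a ⬝ᵥ w + β * wnorm B (φ x a) - (φ x a ⬝ᵥ w' + β * wnorm B' (φ x a)) =
      φ x a ⬝ᵥ (w - w') + β * (wnorm B (φ x a) - wnorm B' (φ x a)) := by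
    rw [dotProduct_sub]; ring
  rw [h4]
  refine (abs_add_le _ _).trans (add_le_add h1 ?_)
  rw [abs_mul, abs_of_nonneg hβ]
  exact mul_le_mul_of_nonneg_left h3 hβ

/-- Indices of the net: integer coordinates for the linear part and the bonus matrix. -/
abbrev GridIdx (d : ℕ) := (Fin d → ℤ) × (Fin d × Fin d → ℤ)

/-- The coordinates in `[-a, a]`. -/
def gridSet (d a : ℕ) : Finset (GridIdx d) :=
  (Fintype.piFinset fun _ => Finset.Icc (-(a : ℤ)) a) ×ˢ
    Fintype.piFinset fun _ => Finset.Icc (-(a : ℤ)) a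

theorem card_gridSet (d a : ℕ) : (gridSet d a).card = (2 * a + 1) ^ (d + d * d) := by
  have : (a + 1 + a : ℤ).toNat = 2 * a + 1 := by omega
  simp [gridSet, Finset.card_product, Fintype.card_piFinset, pow_add, this]

/-- The value function with given grid coordinates. -/
def gridVal (φ : X → A → EuclideanSpace ℝ (Fin d)) (c β e₁ e₂ : ℝ) (i : GridIdx d) : X → ℝ :=
  bonusVal φ c β (fun j => e₁ * i.1 j) (Matrix.of fun p q => e₂ * i.2 (p, q))

theorem exists_gridVal_near (hφ : ∀ x a, ‖φ x a‖ ≤ 1) (c : ℝ) {β : ℝ} (hβ : 0 ≤ β)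
    {w : Fin d → ℝ} {B : Matrix (Fin d) (Fin d) ℝ} {e₁ e₂ W : ℝ} (he₁ : 0 < e₁) (he₂ : 0 < e₂)
    (hw : ∀ j, |w j| ≤ W) (hB : ∀ p q, |B p q| ≤ 1) {a : ℕ} (ha₁ : W / e₁ + 1 / 2 ≤ a)
    (ha₂ : 1 / e₂ + 1 / 2 ≤ a) :
    ∃ i ∈ gridSet d a, ∀ x : X, |bonusVal φ c β w B x - gridVal φ c β e₁ e₂ i x| ≤
      d * e₁ + β * (d * √e₂) := by
  choose n hn hn' using fun j => exists_int_mul_near he₁ (hw j) ha₁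
  choose N hN hN' using fun p : Fin d × Fin d => exists_int_mul_near he₂ (hB p.1 p.2) ha₂
  refine ⟨(n, N), Finset.mem_product.2 ⟨Fintype.mem_piFinset.2 hn, Fintype.mem_piFinset.2 hN⟩,
    fun x => ?_⟩
  exact abs_bonusVal_sub_le hφ c hβ he₂.le hn' (fun p q => hN' (p, q)) x

variable {prm : Params} {s : ℕ → Traj X A H} {v : ℕ → ℝ} {k : ℕ}
  {ζ : EuclideanSpace ℝ (Fin H × Fin d)}

theorem wnorm_inv_single_le (s : ℕ → Traj X A H) (k : ℕ) (h : Fin H) (j : Fin d) :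
    wnorm (stepCov φ 1 s k h)⁻¹ (Pi.single j 1) ≤ 1 := by
  have h1 := wnorm_inv_regCov_le (fun τ => (φ (s τ h).1 (s τ h).2 : Fin d → ℝ)) k one_pos
    (Pi.single j 1)
  rw [Real.sqrt_one, one_mul] at h1
  refine h1.trans ?_
  have := norm_toLp_sq (Pi.single j (1 : ℝ) : Fin d → ℝ)
  rw [single_dotProduct, Pi.single_eq_same, mul_one] at this
  exact (abs_le_of_sq_le_sq' (by rw [this, one_pow]) one_pos.le).2

theorem abs_stepCov_inv_apply_le (s : ℕ → Traj X A H) (k : ℕ) (h : Fin H) (p q : Fin d) :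
    |(stepCov φ 1 s k h)⁻¹ p q| ≤ 1 := by
  have h1 := abs_dotProduct_mulVec_le (posDef_stepCov (φ := φ) one_pos s k h).inv.posSemidef
    (Pi.single p 1) (Pi.single q 1)
  rw [single_dotProduct, one_mul, mulVec_single_one] at h1
  exact h1.trans (mul_le_one₀ (wnorm_inv_single_le s k h p) (wnorm_nonneg _ _)
    (wnorm_inv_single_le s k h q))

/-- A bound linear in `k` is good enough, because the range of the coordinates enters only through
the logarithm of the size of the net. -/
theorem abs_psiHat_apply_le (hφ : ∀ x a, ‖φ x a‖ ≤ 1) (s : ℕ → Traj X A H) (k : ℕ) (h : Fin H)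
    {V : X → ℝ} {B : ℝ} (hB : 0 ≤ B) (hV : ∀ x, |V x| ≤ B) (j : Fin d) :
    |psiHat φ 1 s k h V j| ≤ k * B := by
  have hΛ := posDef_stepCov (φ := φ) one_pos s k h
  have h1 : psiHat φ 1 s k h V j = Pi.single j 1 ⬝ᵥ (stepCov φ 1 s k h)⁻¹ *ᵥ
      ∑ τ ∈ Finset.range k, nextVal (s τ) h V • (φ (s τ h).1 (s τ h).2 : Fin d → ℝ) := by
    rw [single_dotProduct, one_mul]; rfl
  rw [h1]
  refine (abs_dotProduct_mulVec_le hΛ.inv.posSemidef _ _).trans ?_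
  refine (mul_le_of_le_one_left (wnorm_nonneg _ _) (wnorm_inv_single_le s k h j)).trans ?_
  refine (wnorm_sum_le hΛ.inv.posSemidef _ _).trans ?_
  calc _ ≤ ∑ τ ∈ Finset.range k, B := by
        refine Finset.sum_le_sum fun τ _ => ?_
        rw [wnorm_smul hΛ.inv.posSemidef]
        have h2 := wnorm_inv_regCov_le (fun τ => (φ (s τ h).1 (s τ h).2 : Fin d → ℝ)) k one_pos
          (φ (s τ h).1 (s τ h).2 : Fin d → ℝ)
        rw [Real.sqrt_one, one_mul] at h2
        have h3 : |nextVal (s τ) h V| ≤ B := by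
          unfold nextVal
          split_ifs
          · exact hV _
          · simpa using hB
        exact (mul_le_mul h3 (h2.trans (hφ _ _)) (wnorm_nonneg _ _) hB).trans_eq (mul_one _)
    _ = _ := by simp

/-- Value estimates are close to the net. -/
theorem exists_gridVal_near_vHat (hφ : ∀ x a, ‖φ x a‖ ≤ 1) (hlamP : prm.lamP = 1)
    (hβ : 0 ≤ prm.betaRZ) (hβp : 0 ≤ prm.betaP) {W e₁ e₂ : ℝ} (he₁ : 0 < e₁) (he₂ : 0 < e₂)
    (hrew : ∀ h j, |pertReward φ prm s v k ζ (h, j)| ≤ W) {a : ℕ}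
    (ha₁ : (W + k * (H * prm.betaRZ)) / e₁ + 1 / 2 ≤ a) (ha₂ : 1 / e₂ + 1 / 2 ≤ a) {n : ℕ}
    (hn : n < H) :
    ∃ i ∈ gridSet d a, ∀ x : X, |vHat φ prm s v k ζ n x -
      gridVal φ (((H : ℝ) - n) * prm.betaRZ) prm.betaP e₁ e₂ i x| ≤
        d * e₁ + prm.betaP * (d * √e₂) := by
  have hw : ∀ j, |thetaHat φ prm.lamR s v k (⟨n, hn⟩, j) + ζ (⟨n, hn⟩, j) +
      psiHat φ prm.lamP s k ⟨n, hn⟩ (vHat φ prm s v k ζ (n + 1)) j| ≤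
        W + k * (H * prm.betaRZ) := fun j => by
    refine (abs_add_le _ _).trans (add_le_add (hrew ⟨n, hn⟩ j) ?_)
    rw [hlamP]
    refine abs_psiHat_apply_le hφ s k _ (by positivity) (fun x => ?_) j
    refine (abs_vHat_le hβ _ hn x).trans (mul_le_mul_of_nonneg_right ?_ hβ)
    linarith [(Nat.cast_nonneg (n + 1) : (0 : ℝ) ≤ (n + 1 : ℕ))]
  have hB : ∀ p q, |(stepCov φ prm.lamP s k ⟨n, hn⟩)⁻¹ p q| ≤ 1 := fun p q => by
    rw [hlamP]
    exact abs_stepCov_inv_apply_le s k _ p q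
  obtain ⟨i, hi, h⟩ := exists_gridVal_near (X := X) hφ (((H : ℝ) - n) * prm.betaRZ) hβp he₁ he₂
    hw hB ha₁ ha₂
  refine ⟨i, hi, fun x => le_of_eq_of_le ?_ (h x)⟩
  rw [vHat_of_lt hn]
  rfl

variable {M : MDP X A H}

/-- On the concentration event for the net, the transition errors of the value estimates are
controlled. -/
theorem transition_error_le (hd : 0 < d) (hφ : ∀ x a, ‖φ x a‖ ≤ 1) (hlamP : prm.lamP = 1)
    (hβ : 0 < prm.betaRZ) (hβp : 0 ≤ prm.betaP) {W e₁ e₂ : ℝ} (he₁ : 0 < e₁) (he₂ : 0 < e₂)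
    (hrew : ∀ h j, |pertReward φ prm s v k ζ (h, j)| ≤ W) {a : ℕ}
    (ha₁ : (W + k * (H * prm.betaRZ)) / e₁ + 1 / 2 ≤ a) (ha₂ : 1 / e₂ + 1 / 2 ≤ a)
    {ψ : Fin H → X → EuclideanSpace ℝ (Fin d)}
    (hP : ∀ h x a x', M.P h x a x' = φ x a ⬝ᵥ ψ h x')
    (hψ : ∀ h, ‖WithLp.toLp 2 fun j : Fin d => ∑ x, |ψ h x j|‖ ≤ √(d : ℝ)) {p ε : ℝ}
    (hε : d * e₁ + prm.betaP * (d * √e₂) ≤ ε)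
    (hev : ∀ h : Fin H, ∀ i ∈ gridSet d a, h.val + 1 < H → nextProc M φ 1 h
      (gridVal φ (((H : ℝ) - (h.val + 1 : ℕ)) * prm.betaRZ) prm.betaP e₁ e₂ i) (H * prm.betaRZ) s k
        ≤ p⁻¹)
    (hbonus : 2 * (H * prm.betaRZ) * (√(2 * Real.log p⁻¹ + d * Real.log (1 + k / d)) +
      k * (ε / (H * prm.betaRZ))) + H * prm.betaRZ * √(d : ℝ) ≤ prm.betaP) (h : Fin H) (x : X)
    (b : A) :
    |φ x b ⬝ᵥ psiHat φ prm.lamP s k h (vHat φ prm s v k ζ (h.val + 1)) -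
      M.next h (vHat φ prm s v k ζ (h.val + 1)) x b| ≤
        prm.betaP * wnorm (stepCov φ prm.lamP s k h)⁻¹ (φ x b) := by
  have hH : 0 < H := h.pos
  set B := H * prm.betaRZ with hBdef
  have hB : 0 < B := by positivity
  by_cases hh : h.val + 1 < H
  · have hVB : ∀ x, |vHat φ prm s v k ζ (h.val + 1) x| ≤ B := fun x => by
      refine (abs_vHat_le hβ.le _ hh.le x).trans (mul_le_mul_of_nonneg_right ?_ hβ.le)
      linarith [(Nat.cast_nonneg (h.val + 1) : (0 : ℝ) ≤ (h.val + 1 : ℕ))]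
    obtain ⟨i, hi, hi'⟩ := exists_gridVal_near_vHat hφ hlamP hβ.le hβp he₁ he₂ hrew ha₁ ha₂ hh
    have hε0 : 0 ≤ ε := le_trans (by positivity) hε
    have : Nonempty (Fin d) := ⟨⟨0, hd⟩⟩
    have h1 := wnorm_sq_le_of_selfNormProc_le (lam := 1)
      (fun τ => (φ (s τ h).1 (s τ h).2 : Fin d → ℝ)) _ k one_pos (L := 1)
      (fun τ _ => dotProduct_self_le_one hφ _ _) (hev h i hi hh)
    rw [Fintype.card_fin, mul_one, one_mul] at h1
    have h2 := Real.le_sqrt_of_sq_le h1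
    have h3 := wnorm_sum_nextNoise_le (M := M) hφ h hB hε0 (fun x => (hi' x).trans hε) s k
    have h4 := abs_dotProduct_psiHat_sub_next_le (lam := 1) one_pos hP hψ h hB hVB s k x b
    rw [Real.sqrt_one, one_mul] at h4
    rw [hlamP]
    refine h4.trans ?_
    rw [mul_comm]
    refine mul_le_mul_of_nonneg_right (le_trans ?_ hbonus) (wnorm_nonneg _ _)
    refine add_le_add (mul_le_mul_of_nonneg_left (h3.trans (add_le_add h2 le_rfl)) ?_) le_rfl
    linarith
  -- After the last step there is no next state; V̂ is zero there and both backups vanish.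
  · have hV : vHat φ prm s v k ζ (h.val + 1) = 0 := funext fun x => vHat_of_ge (by omega) x
    rw [hV]
    have h1 : psiHat φ prm.lamP s k h (0 : X → ℝ) = 0 := by
      simp [psiHat, nextVal]
    have h2 : M.next h (0 : X → ℝ) x b = 0 := by simp [MDP.next]
    rw [h1, h2, dotProduct_zero, sub_zero, abs_zero]
    exact mul_nonneg hβp (wnorm_nonneg _ _)

end Net

/-! ### The parameter setting -/

section Parameters

variable {d H K : ℕ} {δ : ℝ}

theorem log_ge_of_two_pow_le {n : ℕ} {x : ℝ} (h : (2 : ℝ) ^ n ≤ x) :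
    (n : ℝ) * 0.69 ≤ Real.log x := by
  have h1 := Real.log_le_log (by positivity) h
  rw [Real.log_pow] at h1
  have h2 := Real.log_two_gt_d9
  have h3 : (n : ℝ) * 0.69 ≤ n * Real.log 2 :=
    mul_le_mul_of_nonneg_left (by linarith) (Nat.cast_nonneg n)
  linarith

theorem le_div_of_lt_one {x : ℝ} (hδ0 : 0 < δ) (hδ1 : δ < 1) (hx : 0 ≤ x) : x ≤ x / δ := by
  rw [le_div_iff₀ hδ0]; nlinarith

theorem log_five_ge (hK : 1 ≤ K) (hδ0 : 0 < δ) (hδ1 : δ < 1) :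
    1.38 ≤ Real.log (5 * K / δ) := by
  have hK' : (1 : ℝ) ≤ K := by exact_mod_cast hK
  have h := log_ge_of_two_pow_le (n := 2) (x := 5 * K / δ)
    (le_trans (by linarith) (le_div_of_lt_one hδ0 hδ1 (by positivity)))
  norm_num at h ⊢; linarith

theorem log_ten_ge (hK : 1 ≤ K) (hδ0 : 0 < δ) (hδ1 : δ < 1) :
    2 ≤ Real.log (10 * K / δ) := by
  have hK' : (1 : ℝ) ≤ K := by exact_mod_cast hK
  have h := log_ge_of_two_pow_le (n := 3) (x := 10 * K / δ)
    (le_trans (by linarith) (le_div_of_lt_one hδ0 hδ1 (by positivity)))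
  norm_num at h ⊢; linarith

theorem one_le_KdH (hd : 1 ≤ d) (hH : 1 ≤ H) (hK : 1 ≤ K) : (1 : ℝ) ≤ K * d * H := by
  have : 1 ≤ K * d * H := Nat.one_le_iff_ne_zero.2 (by positivity)
  exact_mod_cast this

theorem log_bonus_ge (hd : 1 ≤ d) (hH : 1 ≤ H) (hK : 1 ≤ K) (hδ0 : 0 < δ) (hδ1 : δ < 1) :
    4 ≤ Real.log (163 * K * d * H / δ) := by
  have h1 := one_le_KdH hd hH hK
  have h := log_ge_of_two_pow_le (n := 7) (x := 163 * K * d * H / δ)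
    (le_trans (by nlinarith) (le_div_of_lt_one hδ0 hδ1 (by positivity)))
  norm_num at h ⊢; linarith

theorem ensembleSize_ge (K : ℕ) (δ : ℝ) :
    9 * Real.log (5 * K / δ) ≤ ensembleSize K δ := Nat.le_ceil _

theorem five_ensembleSize_le (hK : 1 ≤ K) (hδ0 : 0 < δ) (hδ1 : δ < 1) :
    5 * (ensembleSize K δ : ℝ) ≤ 50 * Real.log (5 * K / δ) := by
  have h := log_five_ge hK hδ0 hδ1
  have h1 := Nat.ceil_lt_add_one (show 0 ≤ 9 * Real.log (5 * K / δ) by linarith)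
  rw [ensembleSize]
  norm_num at h; linarith

theorem log_ensemble_ge (hK : 1 ≤ K) (hδ0 : 0 < δ) (hδ1 : δ < 1) :
    3 ≤ Real.log (5 * ensembleSize K δ * K / δ) := by
  have hK' : (1 : ℝ) ≤ K := by exact_mod_cast hK
  have h1 := log_five_ge hK hδ0 hδ1
  have h2 := ensembleSize_ge K δ
  have h := log_ge_of_two_pow_le (n := 5) (x := 5 * ensembleSize K δ * K / δ)
    (le_trans (by norm_num at h1 ⊢; nlinarith) (le_div_of_lt_one hδ0 hδ1 (by positivity)))
  norm_num at h ⊢; linarith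

theorem betaR_sq (hK : 1 ≤ K) (hδ0 : 0 < δ) (hδ1 : δ < 1) :
    betaR d H K δ ^ 2 = 8 * H ^ 2 * (d * H * Real.log (10 * K / δ)) := by
  have := log_ten_ge hK hδ0 hδ1
  rw [betaR, mul_pow, Real.sq_sqrt (by positivity)]
  ring

theorem betaZ_sq (hK : 1 ≤ K) (hδ0 : 0 < δ) (hδ1 : δ < 1) :
    betaZ d H K δ ^ 2 = 11 / 2 * (d * H) * Real.log (5 * ensembleSize K δ * K / δ) := by
  have := log_ensemble_ge hK hδ0 hδ1
  rw [betaZ, Real.sq_sqrt (by positivity)]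
  ring

theorem betaR_nonneg : 0 ≤ betaR d H K δ := by unfold betaR; positivity

theorem one_le_dH (hd : 1 ≤ d) (hH : 1 ≤ H) : (1 : ℝ) ≤ d * H := by
  have : 1 ≤ d * H := Nat.one_le_iff_ne_zero.2 (by positivity)
  exact_mod_cast this

theorem four_le_betaZ (hd : 1 ≤ d) (hH : 1 ≤ H) (hK : 1 ≤ K) (hδ0 : 0 < δ) (hδ1 : δ < 1) :
    4 ≤ betaZ d H K δ := by
  have h1 := log_ensemble_ge hK hδ0 hδ1
  have h2 := one_le_dH hd hH
  have h0 : 0 ≤ betaZ d H K δ := Real.sqrt_nonneg _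
  refine (sq_le_sq₀ (by norm_num) h0).1 ?_
  rw [betaZ_sq hK hδ0 hδ1]
  nlinarith

theorem sqrt_dH_le_betaR (hd : 1 ≤ d) (hH : 1 ≤ H) (hK : 1 ≤ K) (hδ0 : 0 < δ) (hδ1 : δ < 1) :
    √((d : ℝ) * H) ≤ betaR d H K δ := by
  have hH' : (1 : ℝ) ≤ H := by exact_mod_cast hH
  have h1 := log_ten_ge hK hδ0 hδ1
  have h2 := one_le_dH hd hH
  rw [Real.sqrt_le_left betaR_nonneg, betaR_sq hK hδ0 hδ1]
  have h3 : (d : ℝ) * H ≤ d * H * Real.log (10 * K / δ) := by nlinarith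
  have h4 : (1 : ℝ) ≤ H ^ 2 := one_le_pow₀ hH'
  nlinarith

theorem betaR_pos (hd : 1 ≤ d) (hH : 1 ≤ H) (hK : 1 ≤ K) (hδ0 : 0 < δ) (hδ1 : δ < 1) :
    0 < betaR d H K δ :=
  lt_of_lt_of_le (Real.sqrt_pos.2 (by linarith [one_le_dH hd hH]))
    (sqrt_dH_le_betaR hd hH hK hδ0 hδ1)

/-- The confidence radius of the reward estimates. -/
theorem reward_radius_le (hd : 1 ≤ d) (hH : 1 ≤ H) (hδ0 : 0 < δ) (hδ1 : δ < 1)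
    {k : ℕ} (hk : k < K) :
    H * √(2 * Real.log (δ / (5 * K))⁻¹ +
        (H * d : ℕ) * Real.log (1 + k * H / (H * (H * d : ℕ)))) + √(H : ℝ) * √((d : ℝ) * H) ≤
      betaR d H K δ := by
  have hK : 1 ≤ K := by omega
  have hK' : (1 : ℝ) ≤ K := by exact_mod_cast hK
  have hH' : (1 : ℝ) ≤ H := by exact_mod_cast hH
  have hd' : (1 : ℝ) ≤ d := by exact_mod_cast hd
  have hkK : (k : ℝ) ≤ K := by exact_mod_cast hk.le
  have hdH := one_le_dH hd hH
  have hL := log_ten_ge hK hδ0 hδ1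
  set L := Real.log (10 * K / δ) with hLdef
  set a := √(d * H * L) with ha
  have ha2 : a ^ 2 = d * H * L := Real.sq_sqrt (by positivity)
  have ha0 : 0 ≤ a := Real.sqrt_nonneg _
  have h1 : Real.log (δ / (5 * K))⁻¹ ≤ L := by
    rw [inv_div]
    refine Real.log_le_log (by positivity) ?_
    gcongr; norm_num
  have h2 : Real.log (1 + k * H / (H * (H * d : ℕ))) ≤ L := by
    refine Real.log_le_log (by positivity) ?_
    have h3 : (k : ℝ) * H / (H * (H * d : ℕ)) ≤ K := by
      rw [div_le_iff₀ (by positivity)]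
      push_cast
      nlinarith [mul_le_mul hkK (le_mul_of_one_le_right (by positivity : (0 : ℝ) ≤ H)
        (by nlinarith : (1 : ℝ) ≤ H * d)) (by positivity) (by positivity)]
    exact le_trans (by linarith) (le_div_of_lt_one hδ0 hδ1 (by positivity))
  -- The radicand is at most 2L + dHL ≤ 3dHL, and 3 ≤ (7/4)². The bias is H√d ≤ (3/4)Ha, using L ≥
  -- 2.
  have h3 : √(2 * Real.log (δ / (5 * K))⁻¹ +
      (H * d : ℕ) * Real.log (1 + k * H / (H * (H * d : ℕ)))) ≤ 7 / 4 * a := by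
    rw [Real.sqrt_le_left (by positivity), mul_pow, ha2]
    have h4 := mul_le_mul_of_nonneg_left h2 (Nat.cast_nonneg (α := ℝ) (H * d))
    push_cast at h4 ⊢
    nlinarith
  have h4 : √(H : ℝ) * √((d : ℝ) * H) ≤ H * (3 / 4 * a) := by
    rw [Real.sqrt_mul (by positivity), mul_left_comm, Real.mul_self_sqrt (by positivity), mul_comm]
    refine mul_le_mul_of_nonneg_left ?_ (by positivity)
    rw [Real.sqrt_le_left (by positivity), mul_pow, ha2]
    have : (d : ℝ) * 2 ≤ d * H * L := by
      rw [mul_assoc]; exact mul_le_mul_of_nonneg_left (by nlinarith) (by positivity)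
    linarith
  -- The total (7/4 + 3/4)Ha equals 2H · (5/4)a, and 25/16 ≤ 2 fits it under β_r.
  have h5 : 5 / 4 * a ≤ √(2 * d * H * L) := by
    refine Real.le_sqrt_of_sq_le ?_
    rw [mul_pow, ha2]
    nlinarith
  rw [betaR]
  calc _ ≤ H * (7 / 4 * a) + H * (3 / 4 * a) := by gcongr
    _ = 2 * H * (5 / 4 * a) := by ring
    _ ≤ _ := by gcongr

/-- The bound on the value estimates. -/
theorem H_mul_betaRZ (hH : 1 ≤ H) :
    (H : ℝ) * (params d H K δ).betaRZ = 2 * √(H : ℝ) * betaZ d H K δ * betaR d H K δ := by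
  have hH' : (0 : ℝ) < H := by exact_mod_cast hH
  have h := Real.mul_self_sqrt hH'.le
  have h0 : √(H : ℝ) ≠ 0 := (Real.sqrt_pos.2 hH').ne'
  simp only [params]
  rw [mul_div_assoc', div_eq_iff h0]
  linear_combination -(2 * betaZ d H K δ * betaR d H K δ) * h

/-- Expressed through the bound B = Hβ_{rζ} on the value estimates, to which the confidence radius
of the transitions is proportional. -/
theorem betaP_eq (hH : 1 ≤ H) :
    (params d H K δ).betaP = 20 * (H * (params d H K δ).betaRZ) * (d *
      √(Real.log (163 * K * d * H / δ))) := by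
  rw [H_mul_betaRZ hH]
  simp only [params]
  rw [Real.sqrt_mul (by positivity)]
  ring

theorem betaRZ_pos (hd : 1 ≤ d) (hH : 1 ≤ H) (hK : 1 ≤ K) (hδ0 : 0 < δ) (hδ1 : δ < 1) :
    0 < (params d H K δ).betaRZ := by
  have h1 := betaR_pos hd hH hK hδ0 hδ1
  have h2 := four_le_betaZ hd hH hK hδ0 hδ1
  have hH' : (0 : ℝ) < H := by exact_mod_cast hH
  simp only [params]
  have : 0 < betaZ d H K δ := by linarith
  positivity

theorem betaP_pos (hd : 1 ≤ d) (hH : 1 ≤ H) (hK : 1 ≤ K) (hδ0 : 0 < δ) (hδ1 : δ < 1) :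
    0 < (params d H K δ).betaP := by
  have h1 := betaRZ_pos hd hH hK hδ0 hδ1
  have h2 := log_bonus_ge hd hH hK hδ0 hδ1
  have hH' : (0 : ℝ) < H := by exact_mod_cast hH
  have hd' : (0 : ℝ) < d := by exact_mod_cast hd
  rw [betaP_eq hH]
  have : 0 < √(Real.log (163 * K * d * H / δ)) := Real.sqrt_pos.2 (by linarith)
  positivity

/-- The perturbed rewards are below the truncation level. -/
theorem pert_le_betaRZ (hd : 1 ≤ d) (hH : 1 ≤ H) (hK : 1 ≤ K) (hδ0 : 0 < δ) (hδ1 : δ < 1) :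
    √(d : ℝ) + (betaR d H K δ + betaR d H K δ * betaZ d H K δ) / √(H : ℝ) ≤
      (params d H K δ).betaRZ := by
  have hH' : (0 : ℝ) < H := by exact_mod_cast hH
  have h1 := betaR_pos hd hH hK hδ0 hδ1
  have h2 := four_le_betaZ hd hH hK hδ0 hδ1
  have h3 := sqrt_dH_le_betaR hd hH hK hδ0 hδ1
  rw [Real.sqrt_mul (by positivity)] at h3
  have h0 : 0 < √(H : ℝ) := Real.sqrt_pos.2 hH'
  have e : √(d : ℝ) = √(d : ℝ) * √(H : ℝ) / √(H : ℝ) := by field_simp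
  simp only [params]
  rw [e, ← add_div]
  refine div_le_div_of_nonneg_right ?_ h0.le
  -- Since √d√H ≤ β_r, the numerator is at most 2β_r + β_rβ_ζ, and β_ζ ≥ 4 absorbs the first term.
  nlinarith

/-- Resolution of the net in the linear part. -/
def gridStep (B : ℝ) (K d : ℕ) : ℝ := B / (2 * K * d)

/-- Resolution of the net in the bonus matrix. -/
def gridStepBonus (B βp : ℝ) (K d : ℕ) : ℝ := (B / (2 * K * d * βp)) ^ 2

/-- Size of the net in each coordinate. -/
def gridSize (d H K : ℕ) (δ : ℝ) : ℕ :=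
  ⌈1600 * (K : ℝ) ^ 2 * d ^ 4 * Real.log (163 * K * d * H / δ) + 4 * K ^ 2 * d + 1⌉₊

/-- The two step sizes are chosen so that each term equals B/(2K). -/
theorem grid_resolution {B βp : ℝ} (hB : 0 < B) (hβp : 0 < βp) (hK : 1 ≤ K) (hd : 1 ≤ d) :
    d * gridStep B K d + βp * (d * √(gridStepBonus B βp K d)) ≤ B / K := by
  have hK' : (0 : ℝ) < K := by exact_mod_cast hK
  have hd' : (0 : ℝ) < d := by exact_mod_cast hd
  rw [gridStep, gridStepBonus, Real.sqrt_sq (by positivity)]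
  refine le_of_eq ?_
  field_simp
  ring

theorem le_gridSize_linear {B W : ℝ} (hB : 0 < B) (hW : W ≤ B) (hd : 1 ≤ d) (hH : 1 ≤ H)
    (hδ0 : 0 < δ) (hδ1 : δ < 1) {k : ℕ} (hk : k < K) :
    (W + k * B) / gridStep B K d + 1 / 2 ≤ gridSize d H K δ := by
  have hK : 1 ≤ K := by omega
  have hK' : (1 : ℝ) ≤ K := by exact_mod_cast hK
  have hd' : (1 : ℝ) ≤ d := by exact_mod_cast hd
  have hkK : (k : ℝ) ≤ K := by exact_mod_cast hk.le
  have hL := log_bonus_ge hd hH hK hδ0 hδ1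
  refine le_trans ?_ (Nat.le_ceil _)
  -- Coordinates are at most 2KB in absolute value, and the step is B/(2Kd).
  have h1 : (W + k * B) / gridStep B K d ≤ 4 * K ^ 2 * d := by
    rw [gridStep, div_div_eq_mul_div, div_le_iff₀ hB]
    have : W + k * B ≤ 2 * K * B := by nlinarith
    nlinarith [mul_le_mul_of_nonneg_right this (by positivity : (0 : ℝ) ≤ 2 * K * d)]
  have h2 : 0 ≤ 1600 * (K : ℝ) ^ 2 * d ^ 4 * Real.log (163 * K * d * H / δ) := by positivity
  linarith

theorem le_gridSize_bonus (hd : 1 ≤ d) (hH : 1 ≤ H) (hK : 1 ≤ K) (hδ0 : 0 < δ) (hδ1 : δ < 1) :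
    1 / gridStepBonus (H * (params d H K δ).betaRZ) (params d H K δ).betaP K d + 1 / 2 ≤
      gridSize d H K δ := by
  have hK' : (1 : ℝ) ≤ K := by exact_mod_cast hK
  have hd' : (1 : ℝ) ≤ d := by exact_mod_cast hd
  have hH' : (1 : ℝ) ≤ H := by exact_mod_cast hH
  have hL := log_bonus_ge hd hH hK hδ0 hδ1
  refine le_trans ?_ (Nat.le_ceil _)
  have hβ := betaRZ_pos hd hH hK hδ0 hδ1
  rw [betaP_eq hH]
  set B := H * (params d H K δ).betaRZ with hB
  have hB0 : 0 < B := by positivity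
  set L := Real.log (163 * K * d * H / δ)
  -- With β_p = 20 B d √L the inverse step is (2Kd · 20 d√L)², whence 1600.
  have h1 : 1 / gridStepBonus B (20 * B * (d * √L)) K d = 1600 * (K : ℝ) ^ 2 * d ^ 4 * L := by
    have hs : √L ^ 2 = L := Real.sq_sqrt (by linarith)
    have hs0 : 0 < √L := Real.sqrt_pos.2 (by linarith)
    rw [gridStepBonus]
    field_simp
    rw [hs]
    ring
  rw [h1]
  have : 0 ≤ 4 * (K : ℝ) ^ 2 * d := by positivity
  linarith

/-- The size of the net is polynomial in Kd, up to a logarithm. As y ≥ 163Kd, the factor 163⁴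
absorbs the constant 1600 and a sixth power of y dominates. -/
theorem log_gridSize_le (hd : 1 ≤ d) (hH : 1 ≤ H) (hK : 1 ≤ K) (hδ0 : 0 < δ) (hδ1 : δ < 1) :
    Real.log (2 * gridSize d H K δ + 1) ≤ 6 * Real.log (163 * K * d * H / δ) := by
  have hK' : (1 : ℝ) ≤ K := by exact_mod_cast hK
  have hd' : (1 : ℝ) ≤ d := by exact_mod_cast hd
  have hH' : (1 : ℝ) ≤ H := by exact_mod_cast hH
  have hL := log_bonus_ge hd hH hK hδ0 hδ1
  set y := 163 * K * d * H / δ with hy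
  have hKd : 1 ≤ (K : ℝ) * d := by nlinarith
  have h1 : 163 * (K * d) ≤ y := by
    refine le_trans ?_ (le_div_of_lt_one hδ0 hδ1 (by positivity))
    nlinarith
  set z := (K : ℝ) * d with hz
  have hy163 : 163 ≤ y := by linarith
  have hLy : Real.log y ≤ y := (Real.log_le_sub_one_of_pos (by linarith)).trans (by linarith)
  have hsize : (gridSize d H K δ : ℝ) ≤ 1600 * (K : ℝ) ^ 2 * d ^ 4 * Real.log y +
      4 * K ^ 2 * d + 2 := by
    have := Nat.ceil_lt_add_one (show 0 ≤ 1600 * (K : ℝ) ^ 2 * d ^ 4 * Real.log y +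
      4 * K ^ 2 * d + 1 by positivity)
    rw [gridSize]
    linarith
  have h2 : (K : ℝ) ^ 2 * d ^ 4 ≤ z ^ 4 := by
    rw [hz, mul_pow]
    gcongr
    norm_num
  have h3 : (K : ℝ) ^ 2 * d ≤ z ^ 4 := by
    rw [hz, mul_pow]
    exact mul_le_mul (pow_le_pow_right₀ hK' (by norm_num)) (le_self_pow₀ hd' (by norm_num))
      (by positivity) (by positivity)
  have h4 : z ^ 4 ≤ y ^ 4 / 163 ^ 4 := by
    rw [le_div_iff₀ (by norm_num)]
    calc z ^ 4 * 163 ^ 4 = (163 * z) ^ 4 := by ring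
      _ ≤ y ^ 4 := pow_le_pow_left₀ (by positivity) h1 4
  have hy4 : (0 : ℝ) ≤ y ^ 4 := by positivity
  have hfin : 2 * (gridSize d H K δ : ℝ) + 1 ≤ y ^ 6 := by
    have e1 : (K : ℝ) ^ 2 * d ^ 4 * Real.log y ≤ y ^ 4 / 163 ^ 4 * y :=
      mul_le_mul (h2.trans h4) hLy (by linarith) (by positivity)
    have e2 : y ^ 4 ≤ y ^ 4 * y := le_mul_of_one_le_right hy4 (by linarith)
    have e3 : 163 * (y ^ 4 * y) ≤ y ^ 6 := by
      have : y ^ 6 = (y ^ 4 * y) * y := by ring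
      rw [this]
      nlinarith [mul_nonneg hy4 (by linarith : (0 : ℝ) ≤ y)]
    have e4 : (1 : ℝ) ≤ y ^ 4 := one_le_pow₀ (by linarith)
    have e5 : y ^ 4 / 163 ^ 4 * y ≤ y ^ 4 * y / 3200 := by
      rw [div_mul_eq_mul_div]
      exact div_le_div_of_nonneg_left (by positivity) (by norm_num) (by norm_num)
    have e6 : y ^ 4 / 163 ^ 4 ≤ y ^ 4 := div_le_self hy4 (by norm_num)
    linarith
  calc _ ≤ Real.log (y ^ 6) := Real.log_le_log (by positivity) hfin
    _ = _ := by rw [Real.log_pow]; norm_num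

/-- The failure probability allotted to one member of the net in one step. -/
def gridProb (d H K : ℕ) (δ : ℝ) : ℝ :=
  δ / (5 * (K * (H * (2 * gridSize d H K δ + 1) ^ (d + d * d))))

theorem gridProb_pos (hH : 1 ≤ H) (hK : 1 ≤ K) (hδ0 : 0 < δ) :
    0 < gridProb d H K δ := by
  have hK' : (0 : ℝ) < K := by exact_mod_cast hK
  have hH' : (0 : ℝ) < H := by exact_mod_cast hH
  unfold gridProb; positivity

theorem card_mul_gridProb (hH : 1 ≤ H) (hK : 1 ≤ K) :
    K * (H * ((gridSet d (gridSize d H K δ)).card * gridProb d H K δ)) = δ / 5 := by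
  have hK' : (0 : ℝ) < K := by exact_mod_cast hK
  have hH' : (0 : ℝ) < H := by exact_mod_cast hH
  rw [card_gridSet, gridProb]
  push_cast
  field_simp

/-- The bonus coefficient dominates the confidence radius of the transitions. -/
theorem transition_radius_le (hd : 1 ≤ d) (hH : 1 ≤ H) (hδ0 : 0 < δ) (hδ1 : δ < 1) {k : ℕ}
    (hk : k < K) :
    2 * (H * (params d H K δ).betaRZ) * (√(2 * Real.log (gridProb d H K δ)⁻¹ +
      d * Real.log (1 + k / d)) + k * ((H * (params d H K δ).betaRZ / K) /
        (H * (params d H K δ).betaRZ))) + H * (params d H K δ).betaRZ * √(d : ℝ) ≤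
      (params d H K δ).betaP := by
  have hK : 1 ≤ K := by omega
  have hK' : (1 : ℝ) ≤ K := by exact_mod_cast hK
  have hd' : (1 : ℝ) ≤ d := by exact_mod_cast hd
  have hH' : (1 : ℝ) ≤ H := by exact_mod_cast hH
  have hkK : (k : ℝ) ≤ K := by exact_mod_cast hk.le
  have hL := log_bonus_ge hd hH hK hδ0 hδ1
  have hg := log_gridSize_le hd hH hK hδ0 hδ1
  have hβ := betaRZ_pos hd hH hK hδ0 hδ1
  rw [betaP_eq hH]
  set B := H * (params d H K δ).betaRZ with hB
  have hB0 : 0 < B := by positivity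
  set L := Real.log (163 * K * d * H / δ) with hLdef
  have hs0 : 2 ≤ √L := Real.le_sqrt_of_sq_le (by linarith)
  have h1 : Real.log (gridProb d H K δ)⁻¹ ≤ L + 12 * d ^ 2 * L := by
    have e : (gridProb d H K δ)⁻¹ = (5 * K * H / δ) *
        (2 * (gridSize d H K δ : ℝ) + 1) ^ (d + d * d) := by
      rw [gridProb, inv_div]; ring
    rw [e, Real.log_mul (by positivity) (by positivity), Real.log_pow]
    refine add_le_add ?_ ?_
    · refine Real.log_le_log (by positivity) (div_le_div_of_nonneg_right ?_ hδ0.le)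
      have : (K : ℝ) * H * 1 ≤ K * H * d := mul_le_mul_of_nonneg_left hd' (by positivity)
      nlinarith
    -- There are d + d² ≤ 2d² coordinates, each costing at most 6L.
    · push_cast
      calc ((d : ℝ) + d * d) * Real.log (2 * gridSize d H K δ + 1) ≤ (2 * d ^ 2) * (6 * L) := by
            refine mul_le_mul (by nlinarith) hg (Real.log_nonneg ?_) (by positivity)
            linarith [(Nat.cast_nonneg (gridSize d H K δ) : (0 : ℝ) ≤ _)]
        _ = _ := by ring
  have h2 : Real.log (1 + k / d) ≤ L := by
    refine Real.log_le_log (by positivity) ?_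
    have h3 : (k : ℝ) / d ≤ K := (div_le_self (by positivity) hd').trans hkK
    refine le_trans ?_ (le_div_of_lt_one hδ0 hδ1 (by positivity))
    have : (K : ℝ) * 1 ≤ K * (d * H) := mul_le_mul_of_nonneg_left (by nlinarith) (by positivity)
    nlinarith
  -- The radicand is at most 2L + 24d²L + dL ≤ 27d²L, below (6d)²L.
  have h3 : √(2 * Real.log (gridProb d H K δ)⁻¹ + d * Real.log (1 + k / d)) ≤ 6 * (d * √L) := by
    rw [Real.sqrt_le_left (by positivity), mul_pow, mul_pow, Real.sq_sqrt (by linarith)]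
    have e1 := mul_le_mul_of_nonneg_left h2 (by positivity : (0 : ℝ) ≤ d)
    have e2 : (d : ℝ) ≤ d ^ 2 := by nlinarith
    have e3 := mul_le_mul_of_nonneg_right e2 (by linarith : 0 ≤ L)
    have e4 := mul_le_mul_of_nonneg_right (hd'.trans e2) (by linarith : 0 ≤ L)
    nlinarith
  have h4 : (k : ℝ) * ((B / K) / B) ≤ 1 := by
    have : (B / K) / B = 1 / K := by field_simp
    rw [this, mul_one_div]
    exact (div_le_one (by linarith)).2 hkK
  have h5 : √(d : ℝ) ≤ d := by
    rw [Real.sqrt_le_left (by positivity)]; nlinarith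
  calc _ ≤ 2 * B * (6 * (d * √L) + 1) + B * d := by gcongr
    _ = B * (12 * (d * √L) + 2 + d) := by ring
    -- Here √L ≥ 2 is used: 8d√L ≥ 16d ≥ 2 + d.
    _ ≤ B * (20 * (d * √L)) := by
        refine mul_le_mul_of_nonneg_left ?_ hB0.le
        nlinarith
    _ = _ := by ring

/-- The exponent β_ζ²/4 is (11/8)dH log(5mK/δ); a part of it cancels √2^{dH} ≤ e^{7dH/20}, and at
least one full log(5mK/δ) is left for the union over members and episodes. -/
theorem noise_large_prob_le (hd : 1 ≤ d) (hH : 1 ≤ H) (hK : 1 ≤ K) (hδ0 : 0 < δ) (hδ1 : δ < 1) :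
    K * ((params d H K δ).m * (√2 ^ (H * d) * Real.exp (-(betaZ d H K δ ^ 2 / 4)))) ≤ δ / 5 := by
  have hK' : (1 : ℝ) ≤ K := by exact_mod_cast hK
  have hdH := one_le_dH hd hH
  have hL := log_ensemble_ge hK hδ0 hδ1
  have hm : (0 : ℝ) < ensembleSize K δ := by
    have h1 := ensembleSize_ge K δ
    have h2 := log_five_ge hK hδ0 hδ1
    norm_num at h2; linarith
  have h2 : √2 ^ (H * d) ≤ Real.exp (d * H * (7 / 20)) := by
    have : √2 = Real.exp (Real.log 2 / 2) := by
      rw [Real.sqrt_eq_rpow, Real.rpow_def_of_pos (by norm_num)]; ring_nf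
    rw [this, ← Real.exp_nat_mul]
    refine Real.exp_le_exp.2 ?_
    have := Real.log_two_lt_d9
    push_cast
    nlinarith
  have h3 : √2 ^ (H * d) * Real.exp (-(betaZ d H K δ ^ 2 / 4)) ≤
      Real.exp (-Real.log (5 * ensembleSize K δ * K / δ)) := by
    refine (mul_le_mul_of_nonneg_right h2 (Real.exp_pos _).le).trans ?_
    rw [← Real.exp_add, betaZ_sq hK hδ0 hδ1]
    refine Real.exp_le_exp.2 ?_
    nlinarith
  have e : Real.exp (-Real.log (5 * ensembleSize K δ * K / δ)) =
      δ / (5 * ensembleSize K δ * K) := by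
    rw [Real.exp_neg, Real.exp_log (by positivity), inv_div]
  rw [e] at h3
  calc _ ≤ K * (ensembleSize K δ * (δ / (5 * ensembleSize K δ * K))) := by
        simp only [params]; gcongr
    _ = δ / 5 := by field_simp

/-- The constant 9 in the ensemble size comes from 8/9 ≤ e^{−1/9}. -/
theorem noise_small_prob_le (hK : 1 ≤ K) (hδ0 : 0 < δ) :
    K * (8 / 9 : ℝ) ^ (params d H K δ).m ≤ δ / 5 := by
  have hK' : (1 : ℝ) ≤ K := by exact_mod_cast hK
  have h1 : (8 / 9 : ℝ) ≤ Real.exp (-(1 / 9)) := by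
    have := Real.add_one_le_exp (-(1 / 9 : ℝ)); linarith
  have h2 : (8 / 9 : ℝ) ^ (params d H K δ).m ≤ Real.exp (-Real.log (5 * K / δ)) := by
    refine (pow_le_pow_left₀ (by norm_num) h1 _).trans ?_
    rw [← Real.exp_nat_mul]
    refine Real.exp_le_exp.2 ?_
    have := ensembleSize_ge K δ
    simp only [params]
    linarith
  rw [Real.exp_neg, Real.exp_log (by positivity), inv_div] at h2
  calc _ ≤ K * (δ / (5 * K)) := by gcongr
    _ = δ / 5 := by field_simp

/-! ### The final bound -/

/-- The logarithmic factor of the regret bound. -/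
def regretLog (d H K : ℕ) (δ : ℝ) : ℝ :=
  Real.log (1467 * K * d * H * Real.log (5 * K / δ) / δ)

theorem log_le_regretLog (hδ0 : 0 < δ) {x : ℝ} (hx : 0 < x)
    (h : x ≤ 1467 * K * d * H * Real.log (5 * K / δ)) :
    Real.log (x / δ) ≤ regretLog d H K δ :=
  Real.log_le_log (by positivity) (div_le_div_of_nonneg_right h hδ0.le)

theorem betaP_le (hd : 1 ≤ d) (hH : 1 ≤ H) (hK : 1 ≤ K) (hδ0 : 0 < δ) (hδ1 : δ < 1) :
    (params d H K δ).betaP ^ 2 ≤ 70400 * d ^ 4 * H ^ 5 * regretLog d H K δ ^ 3 := by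
  have hK' : (1 : ℝ) ≤ K := by exact_mod_cast hK
  have hd' : (1 : ℝ) ≤ d := by exact_mod_cast hd
  have hH' : (1 : ℝ) ≤ H := by exact_mod_cast hH
  have hL0 := log_five_ge hK hδ0 hδ1
  have h1 := log_ensemble_ge hK hδ0 hδ1
  have h2 := log_ten_ge hK hδ0 hδ1
  have h3 := log_bonus_ge hd hH hK hδ0 hδ1
  have hdH := one_le_dH hd hH
  have hKdH := one_le_KdH hd hH hK
  have hm := five_ensembleSize_le hK hδ0 hδ1
  norm_num at hL0
  set L0 := Real.log (5 * K / δ) with hL0def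
  have hm0 : (0 : ℝ) < ensembleSize K δ := by
    have := ensembleSize_ge K δ
    linarith
  have hK2 : (K : ℝ) ≤ K * d * H := by nlinarith
  have hK2' : (K : ℝ) * L0 ≤ K * d * H * L0 := mul_le_mul_of_nonneg_right hK2 (by linarith)
  have hK3 : (K : ℝ) * d * H * 1 ≤ K * d * H * L0 :=
    mul_le_mul_of_nonneg_left (by linarith) (by linarith)
  have l1 : Real.log (5 * ensembleSize K δ * K / δ) ≤ regretLog d H K δ := by
    refine log_le_regretLog hδ0 (by positivity) ?_
    have := mul_le_mul_of_nonneg_right hm (by linarith : (0 : ℝ) ≤ K)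
    nlinarith
  have l2 : Real.log (10 * K / δ) ≤ regretLog d H K δ := by
    refine log_le_regretLog hδ0 (by positivity) ?_
    nlinarith
  have l3 : Real.log (163 * K * d * H / δ) ≤ regretLog d H K δ := by
    refine log_le_regretLog hδ0 (by positivity) ?_
    nlinarith
  -- The constant is 70400 = 40² · (11/2) · 8, from β_p², β_ζ² and β_r².
  have e : (params d H K δ).betaP ^ 2 = 70400 * d ^ 4 * H ^ 5 *
      (Real.log (5 * ensembleSize K δ * K / δ) * Real.log (10 * K / δ) *
        Real.log (163 * K * d * H / δ)) := by
    simp only [params]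
    rw [mul_pow, mul_pow, mul_pow, mul_pow, betaZ_sq hK hδ0 hδ1, betaR_sq hK hδ0 hδ1,
      Real.sq_sqrt (by positivity)]
    ring
  rw [e]
  refine mul_le_mul_of_nonneg_left ?_ (by positivity)
  rw [pow_succ, pow_succ, pow_one]
  have hr : 0 ≤ regretLog d H K δ := by linarith
  exact mul_le_mul (mul_le_mul l1 l2 (by linarith) hr) l3 (by linarith) (by positivity)

/-- The reward part of the regret is dominated by the bonus part. -/
theorem reward_coef_le (hd : 2 ≤ d) (hH : 1 ≤ H) (hK : 1 ≤ K) (hδ0 : 0 < δ) (hδ1 : δ < 1) {cr : ℝ}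
    (hcr : cr ≤ 2 * (betaR d H K δ * betaZ d H K δ)) :
    cr * √(H : ℝ) ≤ (params d H K δ).betaP * H / 40 := by
  have hd1 : 1 ≤ d := by omega
  have hd' : (2 : ℝ) ≤ d := by exact_mod_cast hd
  have hH' : (1 : ℝ) ≤ H := by exact_mod_cast hH
  have hL3 := log_bonus_ge hd1 hH hK hδ0 hδ1
  have hβp := betaP_pos hd1 hH hK hδ0 hδ1
  have hβr := betaR_pos hd1 hH hK hδ0 hδ1
  have hβz := four_le_betaZ hd1 hH hK hδ0 hδ1
  have hs0 : 2 ≤ √(Real.log (163 * K * d * H / δ)) := Real.le_sqrt_of_sq_le (by linarith)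
  have hds : 4 ≤ d * √(Real.log (163 * K * d * H / δ)) := by nlinarith
  set w := √(H : ℝ) * (betaR d H K δ * betaZ d H K δ) with hw_def
  have hw : 0 ≤ w := by positivity
  have e : (params d H K δ).betaP = 40 * (w * (d * √(Real.log (163 * K * d * H / δ)))) := by
    rw [betaP_eq hH, H_mul_betaRZ hH]; ring
  have h1 := mul_le_mul_of_nonneg_left hds hw
  have h2 : cr * √(H : ℝ) ≤ 2 * w := by
    have := mul_le_mul_of_nonneg_right hcr (Real.sqrt_nonneg (H : ℝ))
    refine this.trans (le_of_eq ?_)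
    rw [hw_def]; ring
  have h3 := le_mul_of_one_le_right hβp.le hH'
  linarith

/-- AM–GM applied to a and D b rather than to the two squares gives (D + 1)(a + b), and D ≥ 2 turns
D + 1 into 3D/2. -/
theorem sq_sqrt_add_sqrt_le {D a b L : ℝ} (hD : 2 ≤ D) (ha : 0 ≤ a) (hb : 0 ≤ b)
    (hab : a + b ≤ L) : (√(D * a) + √b) ^ 2 ≤ 3 / 2 * D * L := by
  have hq2 : √(D * a) ^ 2 = D * a := Real.sq_sqrt (by positivity)
  have hr2 : √b ^ 2 = b := Real.sq_sqrt hb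
  set q := √(D * a)
  set r := √b
  have h2 : 2 * (q * r) ≤ a + D * b := by
    have h3 : (q * r) ^ 2 = a * (D * b) := by rw [mul_pow, hq2, hr2]; ring
    have h4 : (2 * (q * r)) ^ 2 ≤ (a + D * b) ^ 2 := by
      nlinarith [sq_nonneg (a - D * b)]
    exact (abs_le_of_sq_le_sq' h4 (by positivity)).2
  calc (q + r) ^ 2 = q ^ 2 + 2 * (q * r) + r ^ 2 := by ring
    _ ≤ (D + 1) * (a + b) := by rw [hq2, hr2]; linarith
    _ ≤ (3 / 2 * D) * L := mul_le_mul (by linarith) hab (by linarith) (by linarith)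

/-- The numerical part of the regret bound. -/
theorem total_le (hd : 2 ≤ d) (hH : 1 ≤ H) (hK : 1 ≤ K) (hδ0 : 0 < δ) (hδ1 : δ < 1) {cr : ℝ}
    (hcr0 : 0 ≤ cr) (hcr : cr ≤ 2 * (betaR d H K δ * betaZ d H K δ)) :
    (cr + 2 * (params d H K δ).betaP * H) * √(2 * K * Real.log (δ / 5)⁻¹) +
      (cr * √(K * (2 * ((H * d : ℕ) * Real.log (1 + K)))) +
        2 * (params d H K δ).betaP * (H * √(K * (2 * (d * Real.log (1 + K)))))) ≤
      1088 * √((d : ℝ) ^ 5 * (H : ℝ) ^ 7 * K) * regretLog d H K δ ^ 2 := by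
  have hd1 : 1 ≤ d := by omega
  have hK' : (1 : ℝ) ≤ K := by exact_mod_cast hK
  have hd' : (2 : ℝ) ≤ d := by exact_mod_cast hd
  have hH' : (1 : ℝ) ≤ H := by exact_mod_cast hH
  have hL0 := log_five_ge hK hδ0 hδ1
  norm_num at hL0
  have hL3 := log_bonus_ge hd1 hH hK hδ0 hδ1
  have hβp := betaP_pos hd1 hH hK hδ0 hδ1
  have hβp2 := betaP_le hd1 hH hK hδ0 hδ1
  set P := (params d H K δ).betaP with hP
  set a := Real.log (1 + K) with ha
  set b := Real.log (δ / 5)⁻¹ with hb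
  set Ls := regretLog d H K δ with hLs
  have ha0 : 0 ≤ a := Real.log_nonneg (by linarith)
  have hb0 : 0 ≤ b := by
    rw [hb, inv_div]; refine Real.log_nonneg ?_
    rw [le_div_iff₀ hδ0]; linarith
  have hab : a + b ≤ Ls := by
    rw [ha, hb, inv_div, ← Real.log_mul (by positivity) (by positivity), ← mul_div_assoc]
    refine log_le_regretLog hδ0 (by positivity) ?_
    have h1 : (K : ℝ) ≤ K * d * H := by
      rw [mul_assoc]; exact le_mul_of_one_le_right (by linarith) (by nlinarith)
    have h2 : (K : ℝ) * d * H * 1 ≤ K * d * H * Real.log (5 * K / δ) :=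
      mul_le_mul_of_nonneg_left (by linarith) (by positivity)
    nlinarith
  have hLs0 : 0 ≤ Ls := by linarith
  have hsH : 1 ≤ √(H : ℝ) := Real.one_le_sqrt.2 hH'
  have hsH2 : √(H : ℝ) * √(H : ℝ) = H := Real.mul_self_sqrt (by linarith)
  have hcrP : cr * √(H : ℝ) ≤ P * H / 40 := reward_coef_le hd hH hK hδ0 hδ1 hcr
  have hcr1 : cr ≤ cr * √(H : ℝ) := le_mul_of_one_le_right hcr0 hsH
  have s1 : √(2 * K * b) = √(2 * K) * √b := Real.sqrt_mul (by positivity) _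
  have s2 : √(K * (2 * ((H * d : ℕ) * a))) = √(2 * K) * (√(H : ℝ) * √(d * a)) := by
    rw [← Real.sqrt_mul (by positivity), ← Real.sqrt_mul (by positivity)]
    congr 1; push_cast; ring
  have s3 : √(K * (2 * (d * a))) = √(2 * K) * √(d * a) := by
    rw [← Real.sqrt_mul (by positivity)]
    congr 1; ring
  rw [s1, s2, s3]
  set q := √(d * a) with hq
  set r := √b with hr
  have hq0 : 0 ≤ q := Real.sqrt_nonneg _
  have hr0 : 0 ≤ r := Real.sqrt_nonneg _
  have hqr : (q + r) ^ 2 ≤ 3 / 2 * d * Ls := sq_sqrt_add_sqrt_le hd' ha0 hb0 hab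
  -- The reward part adds at most 1/40 of P H to the factor 2 of the bonuses, hence 81/40.
  have hmain : (cr + 2 * P * H) * (√(2 * K) * r) + (cr * (√(2 * K) * (√(H : ℝ) * q)) +
      2 * P * (H * (√(2 * K) * q))) ≤ 81 / 40 * (P * H * (√(2 * K) * (q + r))) := by
    have e : (cr + 2 * P * H) * (√(2 * K) * r) + (cr * (√(2 * K) * (√(H : ℝ) * q)) +
        2 * P * (H * (√(2 * K) * q))) = √(2 * K) * (cr * r + (cr * √(H : ℝ)) * q) +
          2 * (P * H * (√(2 * K) * (q + r))) := by ring
    rw [e]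
    have h1 : cr * r ≤ P * H / 40 * r := mul_le_mul_of_nonneg_right (hcr1.trans hcrP) hr0
    have h2 : (cr * √(H : ℝ)) * q ≤ P * H / 40 * q := mul_le_mul_of_nonneg_right hcrP hq0
    have h3 := mul_le_mul_of_nonneg_left (add_le_add h1 h2) (Real.sqrt_nonneg (2 * (K : ℝ)))
    linarith
  refine hmain.trans ?_
  refine abs_le_of_sq_le_sq' ?_ (by positivity) |>.2
  have e1 : (81 / 40 * (P * H * (√(2 * K) * (q + r)))) ^ 2 =
      (81 / 40) ^ 2 * (P ^ 2 * H ^ 2 * (2 * K * (q + r) ^ 2)) := by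
    rw [mul_pow, mul_pow, mul_pow, mul_pow, Real.sq_sqrt (by positivity)]
  have e2 : (1088 * √((d : ℝ) ^ 5 * (H : ℝ) ^ 7 * K) * Ls ^ 2) ^ 2 =
      1088 ^ 2 * ((d : ℝ) ^ 5 * (H : ℝ) ^ 7 * K) * Ls ^ 4 := by
    rw [mul_pow, mul_pow, Real.sq_sqrt (by positivity)]; ring
  rw [e1, e2]
  calc _ ≤ (81 / 40) ^ 2 * (70400 * d ^ 4 * H ^ 5 * Ls ^ 3 * H ^ 2 *
        (2 * K * (3 / 2 * d * Ls))) := by gcongr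
    _ = ((81 / 40) ^ 2 * 70400 * 3) * ((d : ℝ) ^ 5 * (H : ℝ) ^ 7 * K * Ls ^ 4) := by ring
    -- Numerically (81/40)² · 70400 · 3 is about 866000, below 1088².
    _ ≤ 1088 ^ 2 * ((d : ℝ) ^ 5 * (H : ℝ) ^ 7 * K * Ls ^ 4) :=
        mul_le_mul_of_nonneg_right (by norm_num) (by positivity)
    _ = _ := by ring

/-- The explicit logarithmic factor is absorbed by the cube of `log (dHK/δ)`. -/
theorem regretLog_sq_le (hd : 2 ≤ d) (hH : 1 ≤ H) (hK : 1 ≤ K) (hδ0 : 0 < δ) (hδ1 : δ < 1) :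
    regretLog d H K δ ^ 2 ≤ 450 * Real.log (d * H * K / δ) ^ 3 := by
  have hK' : (1 : ℝ) ≤ K := by exact_mod_cast hK
  have hd' : (2 : ℝ) ≤ d := by exact_mod_cast hd
  have hH' : (1 : ℝ) ≤ H := by exact_mod_cast hH
  have hL0 := log_five_ge hK hδ0 hδ1
  norm_num at hL0
  have hdHK : 2 ≤ (d : ℝ) * H * K := by
    have : (2 : ℝ) * 1 ≤ d * H := mul_le_mul hd' hH' (by norm_num) (by linarith)
    nlinarith
  set y := (d : ℝ) * H * K / δ with hy
  have hy2 : 2 ≤ y := hdHK.trans (le_div_of_lt_one hδ0 hδ1 (by linarith))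
  have hly : 0.69 ≤ Real.log y := by
    have := log_ge_of_two_pow_le (n := 1) (x := y) (by linarith)
    norm_num at this ⊢; linarith
  have hlog2 : Real.log 2 ≤ Real.log y := Real.log_le_log (by norm_num) hy2
  have h1 : regretLog d H K δ ≤ 15 * Real.log y := by
    -- The inner logarithm is at most 5y and 1467 · 5 ≤ 2^13. Then log 2 ≤ log y turns 13 log 2 + 2
    -- log y into 15 log y.
    have h2 : 1467 * K * d * H * Real.log (5 * K / δ) / δ ≤ 2 ^ 13 * y ^ 2 := by
      have e : 1467 * K * d * H * Real.log (5 * K / δ) / δ = 1467 * y * Real.log (5 * K / δ) := by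
        rw [hy]; ring
      have h3 : Real.log (5 * K / δ) ≤ 5 * y := by
        have h4 := Real.log_le_sub_one_of_pos (show 0 < 5 * K / δ by positivity)
        have h5 : 5 * K / δ ≤ 5 * y := by
          rw [hy, ← mul_div_assoc]
          refine div_le_div_of_nonneg_right ?_ hδ0.le
          have : 1 * (K : ℝ) ≤ d * H * K := mul_le_mul_of_nonneg_right (by nlinarith) (by linarith)
          linarith
        linarith
      rw [e]
      have := mul_le_mul_of_nonneg_left h3 (by positivity : 0 ≤ 1467 * y)
      nlinarith
    calc _ ≤ Real.log (2 ^ 13 * y ^ 2) := Real.log_le_log (by positivity) h2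
      _ = 13 * Real.log 2 + 2 * Real.log y := by
          rw [Real.log_mul (by positivity) (by positivity), Real.log_pow, Real.log_pow]; norm_num
      _ ≤ _ := by linarith
  have h0 : 0 ≤ regretLog d H K δ := by
    refine Real.log_nonneg ?_
    rw [le_div_iff₀ hδ0]
    have : (1 : ℝ) ≤ K * d * H := one_le_KdH (by omega) hH hK
    nlinarith [mul_le_mul this hL0 (by norm_num) (by linarith)]
  have h2 := pow_le_pow_left₀ h0 h1 2
  norm_num at hly
  -- Since y ≥ 2, one has 2 log y ≥ 1, which raises the square to a cube and gives 450 = 2 · 15².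
  have h3 : Real.log y ^ 2 * 1 ≤ Real.log y ^ 2 * (2 * Real.log y) :=
    mul_le_mul_of_nonneg_left (by linarith) (sq_nonneg _)
  nlinarith

end Parameters

/-! ### Degenerate dimensions -/

section Dimension

variable {X A : Type*} [Fintype X] [Fintype A] [Nonempty A] {H d : ℕ} {M : MDP X A H}
  {φ : X → A → EuclideanSpace ℝ (Fin d)}

/-- In dimension 0 all transition probabilities would vanish, yet they sum to 1. -/
theorem MDP.IsLinear.one_le_dim (hM : M.IsLinear φ) (hH : 1 ≤ H) : 1 ≤ d := by
  obtain ⟨-, θ, ψ, -, hP, -, -⟩ := hM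
  rcases Nat.eq_zero_or_pos d with rfl | hd
  · have h1 := (M.P_mem ⟨0, hH⟩ M.init (Classical.arbitrary A)).2
    simp [hP, dotProduct] at h1
  · exact hd

/-- In dimension one all policies have the same value. -/
theorem MDP.IsLinear.value_eq_of_dim_eq_one (hM : M.IsLinear φ) (hH : 1 ≤ H) (hd : d = 1)
    (π π' : Policy X A H) : M.value π = M.value π' := by
  subst hd
  obtain ⟨-, θ, ψ, hr, hP, -, -⟩ := hM
  -- Total probability one makes every feature the inverse of the same scalar, so features, and with
  -- them rewards, do not depend on the state or action.
  have h1 : ∀ x a, φ x a 0 * ∑ x', ψ ⟨0, hH⟩ x' 0 = 1 := fun x a => by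
    have := (M.P_mem ⟨0, hH⟩ x a).2
    simpa [hP, dotProduct, Finset.mul_sum] using this
  have h2 : ∀ x a, φ x a 0 = (∑ x', ψ ⟨0, hH⟩ x' 0)⁻¹ := fun x a =>
    eq_inv_of_mul_eq_one_left (h1 x a)
  have h3 : ∀ π : Policy X A H, M.value π = ∑ h, (∑ x', ψ ⟨0, hH⟩ x' 0)⁻¹ * θ h 0 := fun π => by
    have : (fun ι : Traj X A H => ∑ h, M.r h (ι h).1 (ι h).2) =
        fun _ => ∑ h, (∑ x', ψ ⟨0, hH⟩ x' 0)⁻¹ * θ h 0 := funext fun ι =>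
      Finset.sum_congr rfl fun h _ => by simp [hr, dotProduct, h2]
    rw [MDP.value, this, expect_const]
  rw [h3, h3]

end Dimension

/-! ### Sums of feature norms -/

theorem sum_le_sqrt_of_sum_sq_le {a : ℕ → ℝ} {K : ℕ} {S : ℝ}
    (h : ∑ k ∈ Finset.range K, a k ^ 2 ≤ S) : ∑ k ∈ Finset.range K, a k ≤ √(K * S) := by
  refine Real.le_sqrt_of_sq_le ?_
  have h1 := sq_sum_le_card_mul_sum_sq (s := Finset.range K) (f := a)
  rw [Finset.card_range] at h1
  exact h1.trans (mul_le_mul_of_nonneg_left h (Nat.cast_nonneg K))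

section Bonus

variable {X A : Type*} [Fintype X] [Fintype A] [Nonempty A] {H d : ℕ}
  {φ : X → A → EuclideanSpace ℝ (Fin d)} {prm : Params} {c : ℝ}

/-- The bound on the regret of an episode along a trajectory. -/
def normBound (φ : X → A → EuclideanSpace ℝ (Fin d)) (prm : Params) (c : ℝ) (k : ℕ)
    (s : ℕ → Traj X A H) (ι : Traj X A H) : ℝ :=
  c * wnorm (aggCov φ prm.lamR s k)⁻¹ (aggFeat φ ι) + 2 * prm.betaP *
    ∑ h, wnorm (stepCov φ prm.lamP s k h)⁻¹ (φ (ι h).1 (ι h).2)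

theorem normBound_nonneg (hc : 0 ≤ c) (hβp : 0 ≤ prm.betaP) (k : ℕ) (s : ℕ → Traj X A H)
    (ι : Traj X A H) : 0 ≤ normBound φ prm c k s ι := by
  have h1 : 0 ≤ ∑ h, wnorm (stepCov φ prm.lamP s k h)⁻¹ (φ (ι h).1 (ι h).2) :=
    Finset.sum_nonneg fun h _ => wnorm_nonneg _ _
  have h2 := wnorm_nonneg (aggCov φ prm.lamR s k)⁻¹ (aggFeat φ ι)
  unfold normBound
  positivity

theorem normBound_congr {k : ℕ} {s t : ℕ → Traj X A H} (h : ∀ τ < k, s τ = t τ) :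
    normBound φ prm c k s = normBound φ prm c k t := by
  funext ι
  rw [normBound, normBound, aggCov_congr h]
  simp only [stepCov_congr h]

theorem normBound_le (hφ : ∀ x a, ‖φ x a‖ ≤ 1) (hH : 1 ≤ H) (hlamR : prm.lamR = H)
    (hlamP : prm.lamP = 1) (hc : 0 ≤ c) (hβp : 0 ≤ prm.betaP) (k : ℕ) (s : ℕ → Traj X A H)
    (ι : Traj X A H) : normBound φ prm c k s ι ≤ c + 2 * prm.betaP * H := by
  have hH' : (0 : ℝ) < H := by exact_mod_cast hH
  have h1 : wnorm (aggCov φ prm.lamR s k)⁻¹ (aggFeat φ ι) ≤ 1 := by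
    rw [hlamR, aggCov_eq]
    have h2 := wnorm_inv_regCov_le (fun τ => aggFeat φ (s τ)) k hH' (aggFeat φ ι)
    have h3 : ‖WithLp.toLp 2 (aggFeat φ ι)‖ ≤ √(H : ℝ) := by
      refine Real.le_sqrt_of_sq_le ?_
      rw [norm_toLp_sq]
      exact aggFeat_dotProduct_self_le hφ ι
    exact le_of_mul_le_mul_left ((h2.trans h3).trans_eq (mul_one _).symm) (Real.sqrt_pos.2 hH')
  have h2 : ∑ h, wnorm (stepCov φ prm.lamP s k h)⁻¹ (φ (ι h).1 (ι h).2) ≤ H := by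
    calc _ ≤ ∑ _h : Fin H, (1 : ℝ) := Finset.sum_le_sum fun h _ => by
          have h3 := wnorm_inv_regCov_le (fun τ => (φ (s τ h).1 (s τ h).2 : Fin d → ℝ)) k one_pos
            (φ (ι h).1 (ι h).2 : Fin d → ℝ)
          rw [Real.sqrt_one, one_mul] at h3
          rw [hlamP]
          exact h3.trans (hφ _ _)
      _ = H := by simp
  exact add_le_add (mul_le_of_le_one_right hc h1) (mul_le_mul_of_nonneg_left h2 (by positivity))

/-- Cauchy–Schwarz over the episodes reduces to squared norms, which the elliptical potential lemma
bounds: once in dimension dH, and once per step in dimension d. -/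
theorem sum_normBound_le (hφ : ∀ x a, ‖φ x a‖ ≤ 1) (hd : 1 ≤ d) (hH : 1 ≤ H)
    (hlamR : prm.lamR = H) (hlamP : prm.lamP = 1) (hc : 0 ≤ c) (hβp : 0 ≤ prm.betaP) (K : ℕ)
    (s : ℕ → Traj X A H) :
    ∑ k ∈ Finset.range K, normBound φ prm c k s (s k) ≤
      c * √(K * (2 * ((H * d : ℕ) * Real.log (1 + K)))) +
        2 * prm.betaP * (H * √(K * (2 * (d * Real.log (1 + K))))) := by
  have hH' : (0 : ℝ) < H := by exact_mod_cast hH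
  have : Nonempty (Fin d) := ⟨⟨0, hd⟩⟩
  have : Nonempty (Fin H) := ⟨⟨0, hH⟩⟩
  have h1 : ∑ k ∈ Finset.range K, wnorm (aggCov φ prm.lamR s k)⁻¹ (aggFeat φ (s k)) ≤
      √(K * (2 * ((H * d : ℕ) * Real.log (1 + K)))) := by
    refine sum_le_sqrt_of_sum_sq_le ?_
    have h2 := sum_wnorm_sq_le (fun τ => aggFeat φ (s τ)) K hH'
      fun τ _ => aggFeat_dotProduct_self_le hφ _
    rw [Fintype.card_prod, Fintype.card_fin, Fintype.card_fin] at h2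
    rw [hlamR]
    exact h2
  have h2 : ∀ h : Fin H, ∑ k ∈ Finset.range K,
      wnorm (stepCov φ prm.lamP s k h)⁻¹ (φ (s k h).1 (s k h).2) ≤
        √(K * (2 * (d * Real.log (1 + K)))) := fun h => by
    refine sum_le_sqrt_of_sum_sq_le ?_
    have h3 := sum_wnorm_sq_le (fun τ => (φ (s τ h).1 (s τ h).2 : Fin d → ℝ)) K one_pos
      fun τ _ => dotProduct_self_le_one hφ _ _
    rw [Fintype.card_fin] at h3
    rw [hlamP]
    exact h3
  simp only [normBound]
  rw [Finset.sum_add_distrib, ← Finset.mul_sum, ← Finset.mul_sum, Finset.sum_comm]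
  refine add_le_add (mul_le_mul_of_nonneg_left h1 hc) (mul_le_mul_of_nonneg_left ?_ (by positivity))
  exact (Finset.sum_le_sum fun h _ => h2 h).trans_eq (by simp)

end Bonus

/-! ### The good event -/

section Regret

variable {Ω X A : Type*} [Fintype X] [Fintype A] [Nonempty A] {d H K : ℕ} {δ : ℝ}
  {M : MDP X A H} {φ : X → A → EuclideanSpace ℝ (Fin d)}
  {R : Interaction Ω X A H d (params d H K δ).m}

/-- The coefficient of the aggregate feature norm in the regret bound. -/
def rewardCoef (d H K : ℕ) (δ : ℝ) : ℝ := betaR d H K δ + betaR d H K δ * betaZ d H K δ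

/-- The regret bound of an episode, normalized to take values in `[0, 1]`. -/
def unitBound (φ : X → A → EuclideanSpace ℝ (Fin d)) (H K : ℕ) (δ : ℝ) (k : ℕ)
    (s : ℕ → Traj X A H) (ι : Traj X A H) : ℝ :=
  normBound φ (params d H K δ) (rewardCoef d H K δ) k s ι /
    (rewardCoef d H K δ + 2 * (params d H K δ).betaP * H)

/-- The members of the net of value functions for the step after `h`. -/
def netVal (φ : X → A → EuclideanSpace ℝ (Fin d)) (K : ℕ) (δ : ℝ) (h : Fin H) (i : GridIdx d) :
    X → ℝ :=
  gridVal φ (((H : ℝ) - (h.val + 1 : ℕ)) * (params d H K δ).betaRZ) (params d H K δ).betaP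
    (gridStep (H * (params d H K δ).betaRZ) K d)
    (gridStepBonus (H * (params d H K δ).betaRZ) (params d H K δ).betaP K d) i

/-- The event on which the regret bound holds; `u` stands for the expected features of an optimal
policy. -/
structure GoodEvent (M : MDP X A H) (φ : X → A → EuclideanSpace ℝ (Fin d))
    (R : Interaction Ω X A H d (params d H K δ).m) (u : Fin H × Fin d → ℝ) (ω : Ω) : Prop where
  reward : ∀ k < K, rewardProc M φ H R k ω ≤ (δ / (5 * K))⁻¹
  noise : ∀ k < K, ∀ i, wnorm (aggCov φ H (fun τ => R.traj τ ω) k) (R.noise k ω i) ≤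
    betaR d H K δ * betaZ d H K δ
  next : ∀ k < K, ∀ h : Fin H, ∀ i ∈ gridSet d (gridSize d H K δ), h.val + 1 < H →
    nextProc M φ 1 h (netVal φ K δ h i) (H * (params d H K δ).betaRZ) (fun τ => R.traj τ ω) k ≤
      (gridProb d H K δ)⁻¹
  optimism : ∀ k < K, ∃ i, betaR d H K δ * wnorm (aggCov φ H (fun τ => R.traj τ ω) k)⁻¹ u ≤
    u ⬝ᵥ R.noise k ω i
  deviation : trajDev M R (unitBound φ H K δ) K ω ≤ √(2 * K * Real.log (δ / 5)⁻¹)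

theorem rewardCoef_pos (hd : 1 ≤ d) (hH : 1 ≤ H) (hK : 1 ≤ K) (hδ0 : 0 < δ) (hδ1 : δ < 1) :
    0 < rewardCoef d H K δ := by
  have h1 := betaR_pos hd hH hK hδ0 hδ1
  have h2 := four_le_betaZ hd hH hK hδ0 hδ1
  unfold rewardCoef
  nlinarith

/-- The reward estimates are accurate on the good event. -/
theorem GoodEvent.wnorm_thetaHat_sub_le {u : Fin H × Fin d → ℝ} {ω : Ω}
    (hω : GoodEvent M φ R u ω) (hφ : ∀ x a, ‖φ x a‖ ≤ 1) (hd : 1 ≤ d) (hH : 1 ≤ H) (hδ0 : 0 < δ)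
    (hδ1 : δ < 1) {θ : Fin H → EuclideanSpace ℝ (Fin d)}
    (hr : ∀ h x a, M.r h x a = φ x a ⬝ᵥ θ h) (hθ : ∀ h, ‖θ h‖ ≤ √(d : ℝ)) {k : ℕ} (hk : k < K) :
    wnorm (aggCov φ H (fun τ => R.traj τ ω) k)
      (thetaHat φ H (fun τ => R.traj τ ω) (fun τ => R.aggReward τ ω) k - rewardVec θ) ≤
        betaR d H K δ := by
  have hH' : (0 : ℝ) < H := by exact_mod_cast hH
  have : Nonempty (Fin d) := ⟨⟨0, hd⟩⟩
  have : Nonempty (Fin H) := ⟨⟨0, hH⟩⟩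
  have h1 := wnorm_ridge_error_le hH' (fun τ => aggFeat φ (R.traj τ ω))
    (fun τ => R.aggReward τ ω) (fun τ => rewardNoise M R τ ω) (rewardVec θ) hH'.le k
    fun τ _ => by
      rw [aggFeat_dotProduct_rewardVec hr, rewardNoise]
      field_simp
      ring
  have h2 := wnorm_sq_le_of_selfNormProc_le (fun τ => aggFeat φ (R.traj τ ω))
    (fun τ => rewardNoise M R τ ω) k hH' (fun τ _ => aggFeat_dotProduct_self_le hφ _)
    (hω.reward k hk)
  rw [Fintype.card_prod, Fintype.card_fin, Fintype.card_fin] at h2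
  refine h1.trans (le_trans ?_ (reward_radius_le hd hH hδ0 hδ1 hk))
  exact add_le_add (mul_le_mul_of_nonneg_left (Real.le_sqrt_of_sq_le h2) hH'.le)
    (mul_le_mul_of_nonneg_left (norm_rewardVec_le hθ) (Real.sqrt_nonneg _))

/-- The perturbed rewards are bounded on the good event. -/
theorem GoodEvent.norm_pertReward_le {u : Fin H × Fin d → ℝ} {ω : Ω}
    (hω : GoodEvent M φ R u ω) (hφ : ∀ x a, ‖φ x a‖ ≤ 1) (hd : 1 ≤ d) (hH : 1 ≤ H) (hδ0 : 0 < δ)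
    (hδ1 : δ < 1) {θ : Fin H → EuclideanSpace ℝ (Fin d)}
    (hr : ∀ h x a, M.r h x a = φ x a ⬝ᵥ θ h) (hθ : ∀ h, ‖θ h‖ ≤ √(d : ℝ)) {k : ℕ} (hk : k < K)
    (i : Fin (params d H K δ).m) (h : Fin H) :
    ‖WithLp.toLp 2 fun j => pertReward φ (params d H K δ) (fun τ => R.traj τ ω)
      (fun τ => R.aggReward τ ω) k (R.noise k ω i) (h, j)‖ ≤ (params d H K δ).betaRZ := by
  have hH' : (0 : ℝ) < H := by exact_mod_cast hH
  have hK : 1 ≤ K := by omega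
  refine le_trans ?_ (pert_le_betaRZ hd hH hK hδ0 hδ1)
  set e : Fin H × Fin d → ℝ := (thetaHat φ H (fun τ => R.traj τ ω)
    (fun τ => R.aggReward τ ω) k - rewardVec θ) + (R.noise k ω i).ofLp with he
  have h1 : (WithLp.toLp 2 fun j => pertReward φ (params d H K δ) (fun τ => R.traj τ ω)
      (fun τ => R.aggReward τ ω) k (R.noise k ω i) (h, j)) =
      θ h + WithLp.toLp 2 fun j => e (h, j) := by
    ext j
    simp [pertReward, he, rewardVec, params]
    ring
  rw [h1]
  refine (norm_add_le _ _).trans (add_le_add (hθ h) ?_)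
  -- Single blocks are controlled only through the regularization λ_r = H, which yields the division
  -- by √H in β_{rζ}.
  refine (norm_block_le_wnorm (φ := φ) hH' (fun τ => R.traj τ ω) k e h).trans ?_
  refine div_le_div_of_nonneg_right ?_ (Real.sqrt_nonneg _)
  exact (wnorm_add_le (posDef_aggCov hH' _ k).posSemidef _ _).trans
    (add_le_add (hω.wnorm_thetaHat_sub_le hφ hd hH hδ0 hδ1 hr hθ hk) (hω.noise k hk i))

/-- The value estimates nearly solve the Bellman equations on the good event. -/
theorem GoodEvent.qHat_bounds {u : Fin H × Fin d → ℝ} {ω : Ω}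
    (hω : GoodEvent M φ R u ω) (hd : 1 ≤ d) (hH : 1 ≤ H) (hδ0 : 0 < δ)
    (hδ1 : δ < 1) (hM : M.IsLinear φ) {k : ℕ} (hk : k < K) (i : Fin (params d H K δ).m)
    (h : Fin H) (x : X) (a : A) :
    (φ x a ⬝ᵥ fun j => pertReward φ (params d H K δ) (fun τ => R.traj τ ω)
        (fun τ => R.aggReward τ ω) k (R.noise k ω i) (h, j)) +
      M.next h (vHat φ (params d H K δ) (fun τ => R.traj τ ω)
        (fun τ => R.aggReward τ ω) k (R.noise k ω i) (h.val + 1)) x a ≤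
      qHat φ (params d H K δ) (fun τ => R.traj τ ω)
        (fun τ => R.aggReward τ ω) k (R.noise k ω i) h x a ∧
    qHat φ (params d H K δ) (fun τ => R.traj τ ω)
        (fun τ => R.aggReward τ ω) k (R.noise k ω i) h x a ≤
      ((φ x a ⬝ᵥ fun j => pertReward φ (params d H K δ) (fun τ => R.traj τ ω)
        (fun τ => R.aggReward τ ω) k (R.noise k ω i) (h, j)) +
      M.next h (vHat φ (params d H K δ) (fun τ => R.traj τ ω)
        (fun τ => R.aggReward τ ω) k (R.noise k ω i) (h.val + 1)) x a) +
        2 * (params d H K δ).betaP *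
          wnorm (stepCov φ (params d H K δ).lamP (fun τ => R.traj τ ω) k h)⁻¹ (φ x a) := by
  obtain ⟨hφ, θ, ψ, hr, hP, hθ, hψ⟩ := hM
  have hK : 1 ≤ K := by omega
  have hH' : (1 : ℝ) ≤ H := by exact_mod_cast hH
  have hK' : (0 : ℝ) < K := by exact_mod_cast hK
  have hβ := betaRZ_pos hd hH hK hδ0 hδ1
  have hβp := betaP_pos hd hH hK hδ0 hδ1
  have hB : 0 < H * (params d H K δ).betaRZ := by positivity
  have hd' : (0 : ℝ) < d := by exact_mod_cast hd
  have hpert := fun h => hω.norm_pertReward_le hφ hd hH hδ0 hδ1 hr hθ hk i h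
  refine AggMDP.qHat_bounds hβ.le hβp.le
    (fun h x a => (abs_feat_dotProduct_le hφ x a _).trans (hpert h)) ?_ h x a
  have hs1 : 0 < gridStep (H * (params d H K δ).betaRZ) K d := by
    unfold gridStep; positivity
  have hs2 : 0 < gridStepBonus (H * (params d H K δ).betaRZ) (params d H K δ).betaP K d := by
    unfold gridStepBonus; positivity
  exact transition_error_le hd hφ rfl hβ hβp.le hs1 hs2
    (fun h j => (PiLp.norm_apply_le (WithLp.toLp 2 fun j => pertReward φ (params d H K δ)
      (fun τ => R.traj τ ω) (fun τ => R.aggReward τ ω) k (R.noise k ω i) (h, j)) j).trans (hpert h))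
    (le_gridSize_linear hB (le_mul_of_one_le_left hβ.le hH') hd hH hδ0 hδ1 hk)
    (le_gridSize_bonus hd hH hK hδ0 hδ1) hP hψ (grid_resolution hB hβp hK hd)
    (hω.next k hk) (transition_radius_le hd hH hδ0 hδ1 hk)

variable [MeasurableSpace Ω] {μ : Measure Ω}

/-- The regret of an episode on the good event. -/
theorem GoodEvent.optValue_sub_value_le {πs : Policy X A H} (hπs : M.value πs = M.optValue)
    {ω : Ω} (hω : GoodEvent M φ R (expFeat M φ πs) ω)
    (hR : IsRELSVIRun μ M φ (params d H K δ) K R) (hd : 1 ≤ d) (hH : 1 ≤ H) (hδ0 : 0 < δ)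
    (hδ1 : δ < 1) (hM : M.IsLinear φ) {k : ℕ} (hk : k < K) :
    M.optValue - M.value (Policy.det (R.played k ω)) ≤
      M.expect (Policy.det (R.played k ω)) (normBound φ (params d H K δ) (rewardCoef d H K δ) k
        fun τ => R.traj τ ω) := by
  obtain ⟨i, hi⟩ := hω.optimism k hk
  have hH' : (0 : ℝ) < H := by exact_mod_cast hH
  have hb := fun i => hω.qHat_bounds hd hH hδ0 hδ1 hM hk i
  obtain ⟨hφ, θ, ψ, hr, -, hθ, -⟩ := hM
  exact AggMDP.optValue_sub_value_le (prm := params d H K δ) hH hH' hr hπs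
    (hω.wnorm_thetaHat_sub_le hφ hd hH hδ0 hδ1 hr hθ hk) hi
    (fun h x a => (hb i h x a).1) (hR.leader_max k hk ω i) (hω.noise k hk _)
    (fun h x a => (hb _ h x a).2) (hR.greedy k hk ω _)

/-- The regret bound on the good event. -/
theorem GoodEvent.regret_le {πs : Policy X A H} (hπs : M.value πs = M.optValue)
    {ω : Ω} (hω : GoodEvent M φ R (expFeat M φ πs) ω)
    (hR : IsRELSVIRun μ M φ (params d H K δ) K R) (hd : 2 ≤ d) (hH : 1 ≤ H) (hK : 1 ≤ K)
    (hδ0 : 0 < δ) (hδ1 : δ < 1) (hM : M.IsLinear φ) :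
    regret M R K ω ≤ 1088 * √((d : ℝ) ^ 5 * (H : ℝ) ^ 7 * K) * regretLog d H K δ ^ 2 := by
  have hd1 : 1 ≤ d := by omega
  have hc := rewardCoef_pos hd1 hH hK hδ0 hδ1
  have hβp := betaP_pos hd1 hH hK hδ0 hδ1
  have hc2 : rewardCoef d H K δ ≤ 2 * (betaR d H K δ * betaZ d H K δ) := by
    have h1 := betaR_pos hd1 hH hK hδ0 hδ1
    have h2 := four_le_betaZ hd1 hH hK hδ0 hδ1
    unfold rewardCoef
    nlinarith
  set B := rewardCoef d H K δ + 2 * (params d H K δ).betaP * H with hB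
  have hB0 : 0 < B := by positivity
  -- Expected norms are exchanged for realized ones; the difference is the deviation of the
  -- normalized bounds, scaled back by `B`.
  have h1 : regret M R K ω ≤ B * trajDev M R (unitBound φ H K δ) K ω +
      ∑ k ∈ Finset.range K, normBound φ (params d H K δ) (rewardCoef d H K δ) k
        (fun τ => R.traj τ ω) (R.traj k ω) := by
    rw [regret, trajDev, Finset.mul_sum, ← Finset.sum_add_distrib]
    refine Finset.sum_le_sum fun k hk => ?_
    refine (hω.optValue_sub_value_le hπs hR hd1 hH hδ0 hδ1 hM
      (Finset.mem_range.1 hk)).trans_eq ?_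
    have h2 : ∀ s ι, normBound φ (params d H K δ) (rewardCoef d H K δ) k s ι =
        B * unitBound φ H K δ k s ι := fun s ι => by
      rw [unitBound, ← hB]; field_simp
    have h3 : normBound φ (params d H K δ) (rewardCoef d H K δ) k (fun τ => R.traj τ ω) =
        fun ι => B * unitBound φ H K δ k (fun τ => R.traj τ ω) ι := funext fun ι => h2 _ ι
    rw [h3, expect_const_mul]
    ring
  refine h1.trans ((add_le_add (mul_le_mul_of_nonneg_left hω.deviation hB0.le)
    (sum_normBound_le hM.1 hd1 hH rfl rfl hc.le hβp.le K fun τ => R.traj τ ω)).trans ?_)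
  exact total_le hd hH hK hδ0 hδ1 hc.le hc2

/-- The good event has probability at least `1 - δ`. -/
theorem IsRELSVIRun.measureReal_goodEvent [IsProbabilityMeasure μ]
    (hR : IsRELSVIRun μ M φ (params d H K δ) K R) (hd : 1 ≤ d) (hH : 1 ≤ H) (hK : 1 ≤ K)
    (hδ0 : 0 < δ) (hδ1 : δ < 1) (hφ : ∀ x a, ‖φ x a‖ ≤ 1) (u : Fin H × Fin d → ℝ) :
    1 - δ ≤ μ.real {ω | GoodEvent M φ R u ω} := by
  have hH' : (0 : ℝ) < H := by exact_mod_cast hH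
  have hK' : (0 : ℝ) < K := by exact_mod_cast hK
  have hβr := betaR_pos hd hH hK hδ0 hδ1
  have hβz := four_le_betaZ hd hH hK hδ0 hδ1
  have hβ := betaRZ_pos hd hH hK hδ0 hδ1
  have hβp := betaP_pos hd hH hK hδ0 hδ1
  have hc := rewardCoef_pos hd hH hK hδ0 hδ1
  have hB : 0 < H * (params d H K δ).betaRZ := by positivity
  have hD : 0 < rewardCoef d H K δ + 2 * (params d H K δ).betaP * H := by positivity
  have p1 := (hR.measureReal_rewardProc hH H (p := δ / (5 * K)) (by positivity)).trans_eq
    (show (K : ℝ) * (δ / (5 * K)) = δ / 5 by field_simp)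
  have p2 := (hR.measureReal_noise_large hβr hH' (b := betaZ d H K δ) (by linarith)).trans
    (noise_large_prob_le hd hH hK hδ0 hδ1)
  have p3 := (hR.measureReal_nextProc 1 (gridSet d (gridSize d H K δ)) (netVal φ K δ) hB
    (fun h i x => (abs_bonusVal_le (mul_nonneg (sub_nonneg.2 (by exact_mod_cast h.2)) hβ.le)
      _ _ _ x).trans (mul_le_mul_of_nonneg_right
        (sub_le_self _ (Nat.cast_nonneg (h.val + 1))) hβ.le))
    (gridProb_pos hH hK hδ0)).trans_eq (card_mul_gridProb hH hK)
  have p4 := (hR.measureReal_noise_small hβr hH' u).trans (noise_small_prob_le hK hδ0)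
  have p5 := hR.measureReal_trajDev hK (F := unitBound φ H K δ)
    (fun k s t h => by funext ι; rw [unitBound, unitBound, normBound_congr h])
    (fun k s ι => div_nonneg (normBound_nonneg hc.le hβp.le k s ι) hD.le)
    (fun k s ι => (div_le_one hD).2 (normBound_le hφ hH rfl rfl hc.le hβp.le k s ι))
    (p := δ / 5) (by positivity) (by linarith)
  set E1 := {ω | ∃ k < K, (δ / (5 * K))⁻¹ < rewardProc M φ H R k ω}
  set E2 := {ω | ∃ k < K, ∃ i, (params d H K δ).betaR * betaZ d H K δ <
        wnorm (aggCov φ (params d H K δ).lamR (fun τ => R.traj τ ω) k) (R.noise k ω i)}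
  set E3 := {ω | ∃ k < K, ∃ h : Fin H, ∃ i ∈ gridSet d (gridSize d H K δ), h.val + 1 < H ∧
      (gridProb d H K δ)⁻¹ < nextProc M φ 1 h (netVal φ K δ h i) (H * (params d H K δ).betaRZ)
        (fun τ => R.traj τ ω) k}
  set E4 := {ω | ∃ k < K, ∀ i, u ⬝ᵥ R.noise k ω i < (params d H K δ).betaR *
        wnorm (aggCov φ (params d H K δ).lamR (fun τ => R.traj τ ω) k)⁻¹ u}
  set E5 := {ω | √(2 * K * Real.log (δ / 5)⁻¹) < trajDev M R (unitBound φ H K δ) K ω}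
  -- Covering the whole space and using subadditivity avoids showing that the good event is
  -- measurable.
  have hcover : (Set.univ : Set Ω) ⊆
      {ω | GoodEvent M φ R u ω} ∪ (E1 ∪ (E2 ∪ (E3 ∪ (E4 ∪ E5)))) := by
    intro ω _
    by_contra hω
    simp only [Set.mem_union, not_or] at hω
    obtain ⟨h0, h1, h2, h3, h4, h5⟩ := hω
    refine h0 ⟨fun k hk => ?_, fun k hk i => ?_, fun k hk h i hi hh => ?_, fun k hk => ?_, ?_⟩
    · exact not_lt.1 fun hlt => h1 ⟨k, hk, hlt⟩
    · exact not_lt.1 fun hlt => h2 ⟨k, hk, i, hlt⟩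
    · exact not_lt.1 fun hlt => h3 ⟨k, hk, h, i, hi, hh, hlt⟩
    · by_contra hne
      exact h4 ⟨k, hk, fun i => not_le.1 fun hle => hne ⟨i, hle⟩⟩
    · exact not_lt.1 h5
  have hu := measureReal_mono (μ := μ) hcover
  rw [probReal_univ] at hu
  have u1 := measureReal_union_le (μ := μ) {ω | GoodEvent M φ R u ω}
    (E1 ∪ (E2 ∪ (E3 ∪ (E4 ∪ E5))))
  have u2 := measureReal_union_le (μ := μ) E1 (E2 ∪ (E3 ∪ (E4 ∪ E5)))
  have u3 := measureReal_union_le (μ := μ) E2 (E3 ∪ (E4 ∪ E5))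
  have u4 := measureReal_union_le (μ := μ) E3 (E4 ∪ E5)
  have u5 := measureReal_union_le (μ := μ) E4 E5
  linarith

end Regret

end AggMDP

end

/-! ### The regret theorem -/

theorem theorem1 :
    ∃ C : ℝ, 0 < C ∧
      ∀ {Ω X A : Type*} [MeasurableSpace Ω] (μ : Measure Ω) [IsProbabilityMeasure μ]
        [Fintype X] [Fintype A] [Nonempty A] (d H K : ℕ) (_hH : 1 ≤ H) (_hK : 1 ≤ K)
        (δ : ℝ) (_hδ0 : 0 < δ) (_hδ1 : δ < 1)
        (M : AggMDP.MDP X A H) (φ : X → A → EuclideanSpace ℝ (Fin d)) (_hM : M.IsLinear φ)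
        (R : AggMDP.Interaction Ω X A H d (AggMDP.params d H K δ).m)
        (_hR : AggMDP.IsRELSVIRun μ M φ (AggMDP.params d H K δ) K R),
        1 - δ ≤ μ.real {ω |
          AggMDP.regret M R K ω ≤
            1088 * √((d : ℝ) ^ 5 * (H : ℝ) ^ 7 * K) *
              Real.log (1467 * K * d * H * Real.log (5 * K / δ) / δ) ^ 2 ∧
          AggMDP.regret M R K ω ≤
            C * √((d : ℝ) ^ 5 * (H : ℝ) ^ 7 * K * Real.log (d * H * K / δ) ^ 6)} := by
  -- The constant combines the explicit bound with `regretLog_sq_le`.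
  refine ⟨1088 * 450, by norm_num, ?_⟩
  intro Ω X A _ μ _ _ _ _ d H K hH hK δ hδ0 hδ1 M φ hM R hR
  have hd := hM.one_le_dim hH
  obtain ⟨πs, hπs, -⟩ := AggMDP.exists_value_eq_optValue M
  -- For d = H = K = 1 the quantity log(dHK/δ) can be arbitrarily small, so the second bound needs
  -- the regret to vanish; for d ≥ 2 that logarithm is bounded below.
  rcases eq_or_ne d 1 with hd1 | hd1
  · have h0 : ∀ ω, AggMDP.regret M R K ω = 0 := fun ω => Finset.sum_eq_zero fun k _ => by
      rw [← hπs, hM.value_eq_of_dim_eq_one hH hd1 πs, sub_self]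
    have huniv : {ω | AggMDP.regret M R K ω ≤ 1088 * √((d : ℝ) ^ 5 * (H : ℝ) ^ 7 * K) *
          Real.log (1467 * K * d * H * Real.log (5 * K / δ) / δ) ^ 2 ∧
        AggMDP.regret M R K ω ≤ 1088 * 450 *
          √((d : ℝ) ^ 5 * (H : ℝ) ^ 7 * K * Real.log (d * H * K / δ) ^ 6)} = Set.univ :=
      Set.eq_univ_of_forall fun ω => by
        refine ⟨?_, ?_⟩ <;> · rw [h0]; positivity
    rw [huniv, probReal_univ]
    linarith
  · have hd2 : 2 ≤ d := by omega
    refine (hR.measureReal_goodEvent hd hH hK hδ0 hδ1 hM.1 (AggMDP.expFeat M φ πs)).trans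
      (measureReal_mono fun ω hω => ?_)
    have h1 := AggMDP.GoodEvent.regret_le hπs hω hR hd2 hH hK hδ0 hδ1 hM
    refine ⟨h1, h1.trans ?_⟩
    have h2 := AggMDP.regretLog_sq_le hd2 hH hK hδ0 hδ1
    have h3 : 0 ≤ Real.log (d * H * K / δ) := by
      refine Real.log_nonneg ?_
      have h4 : (1 : ℝ) ≤ d * H * K := by
        have : 1 ≤ d * H * K := Nat.one_le_iff_ne_zero.2 (by positivity)
        exact_mod_cast this
      exact h4.trans (AggMDP.le_div_of_lt_one hδ0 hδ1 (by linarith))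
    have h5 : √((d : ℝ) ^ 5 * (H : ℝ) ^ 7 * K * Real.log (d * H * K / δ) ^ 6) =
        √((d : ℝ) ^ 5 * (H : ℝ) ^ 7 * K) * Real.log (d * H * K / δ) ^ 3 := by
      rw [Real.sqrt_mul (by positivity), show Real.log (d * H * K / δ) ^ 6 =
        (Real.log (d * H * K / δ) ^ 3) ^ 2 by ring, Real.sqrt_sq (by positivity)]
    rw [h5]
    calc _ ≤ 1088 * √((d : ℝ) ^ 5 * (H : ℝ) ^ 7 * K) *
          (450 * Real.log (d * H * K / δ) ^ 3) := by gcongr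
      _ = _ := by ring
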